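/- Fix a finite set $\mathcal G$ of quantum gates (unitary operators on finitely many qubits) over which the NOT gate and the Toffoli gate can be implemented exactly by circuits, possibly with ancilla qubits that start and end in $|0\rangle$. A \emph{verifier} $V$ for a short quantum game maps each $x\in\{0,1\}^*$ to three circuits $V(x)=(V_0,V_1,V_2)$ over $\mathcal G$, acting on the qubits of $\mathcal M_Y\otimes\mathcal V\otimes\mathcal M_N$ (message qubits shared with the yes-prover, private qubits of the verifier including a designated output qubit, message qubits shared with the no-prover); a description of $V(x)$, with numbers of qubits in unary, must be computable from $x$ by a deterministic Turing machine in time polynomial in $|x|$. A \emph{yes-prover} $Y$ (\emph{no-prover} $N$) chooses for each $x$ a finite number of private qubits, with space $\mathcal Y$ (resp. $\mathcal N$), and an arbitrary unitary operator $Y_1$ on $\mathcal Y\otimes\mathcal M_Y$ (resp. $N_1$ on $\mathcal M_N\otimes\mathcal N$). The game on $x$ \emph{accepts} (\emph{rejects}) with the probability that measuring the output qubit of the state $V_2N_1V_1Y_1V_0|0\rangle$ in the standard basis gives $1$ (resp. $0$), where all qubits start in $|0\rangle$ and each operator is extended by the identity. For $c,s:\mathbb N\to\mathbb R$, $\mathrm{SQG}(c,s)$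 is the class of all languages $L\subseteq\{0,1\}^*$ for which there is such a verifier $V$ with 1. (completeness) there is a yes-prover $Y$ such that for every no-prover $N$ and every $x\in L$ the game rejects $x$ with probability at most $c(|x|)$; and 2. (soundness) there is a no-prover $N$ such that for every yes-prover $Y$ and every $x\notin L$ the game accepts $x$ with probability at most $s(|x|)$. $\mathrm{SQG}_*(c,s)$ is defined in the same way with the additional requirement that the circuit $V_0$ is empty for every $x$. Let $\mathit{poly}$ be the set of functions $k:\mathbb N\to\mathbb N\setminus\{0\}$ that are bounded by a polynomial and for which $k(n)$ is computable by a deterministic Turing machine in time polynomial in $n$. **Theorem (Partial Robustness of Short Quantum Games).** For all $c,s:\mathbb N\to[0,1]$ and all $k\in\mathit{poly}$, $$\mathrm{SQG}(c,s)\subseteq\mathrm{SQG}(kc,s^k)\cap\mathrm{SQG}(c^k,ks)\quad\text{and}\quad \mathrm{SQG}_*(c,s)\subseteq\mathrm{SQG}_*(kc,s^k)\cap\mathrm{SQG}_*(c^k,ks),$$ where $kc$, $s^k$, $c^k$, $ks$ denote the pointwise functions $n\mapsto k(n)c(n)$, $n\mapsto s(n)^{k(n)}$, etc. -/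

import Mathlib

namespace ShortQuantumGames

/-! ### Qubits, gates and circuits

A collection of qubits is a finite type `W` of wires; its Hilbert space is `ℂ ^ (W → Bool)`, with
the standard basis indexed by the assignments `W → Bool`. -/

/-- Operators (square matrices) on the Hilbert space of the qubits `W`. -/
abbrev Op (W : Type) : Type := Matrix (W → Bool) (W → Bool) ℂ

open Classical in
/-- The operator `U` on the qubits `A`, applied to the qubits `e a` of a larger collection `W` and
extended by the identity (via the Kronecker product) to all other qubits of `W`. -/
noncomputable def lift {A W : Type} (e : A ↪ W) (U : Op A) : Op W :=
  Matrix.of fun x y => if ∀ w, w ∉ Set.range e → x w = y w then U (x ∘ e) (y ∘ e) else 0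

/-- A finite set of quantum gates: each gate is a unitary operator on some number of qubits. -/
structure GateSet where
  card : ℕ
  arity : Fin card → ℕ
  gate : ∀ g : Fin card, Matrix.unitaryGroup (Fin (arity g) → Bool) ℂ

/-- The application of a gate to distinct qubits of `W`, listed in order. -/
structure Instr (G : GateSet) (W : Type) where
  gate : Fin G.card
  wires : Fin (G.arity gate) ↪ W

/-- A quantum circuit over the gate set `G` on the qubits `W`; the head of the list is applied
first. -/
abbrev Circuit (G : GateSet) (W : Type) : Type := List (Instr G W)

/-- The unitary matrix associated with a circuit. -/
noncomputable def Circuit.op {G : GateSet} {W : Type} [Fintype W] [DecidableEq W] :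
    Circuit G W → Op W
  | [] => 1
  | I :: C => Circuit.op C * lift I.wires (G.gate I.gate : Op (Fin (G.arity I.gate)))

/-- The operator `U` on `n` qubits is computed exactly by some circuit over `G`, possibly with the
help of `a` ancilla qubits that start and end in the state `|0⟩`. -/
def GateSet.Implements (G : GateSet) {n : ℕ} (U : Op (Fin n)) : Prop :=
  ∃ (a : ℕ) (C : Circuit G (Fin n ⊕ Fin a)), ∀ (x y : Fin n → Bool) (z : Fin a → Bool),
    Circuit.op C (Sum.elim x z) (Sum.elim y fun _ => false) =
      if z = (fun _ => false) then U x y else 0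

/-- The matrix of a classical map `f` on bit assignments, `|y⟩ ↦ |f y⟩`. -/
def classicalOp {n : ℕ} (f : (Fin n → Bool) → (Fin n → Bool)) : Op (Fin n) :=
  Matrix.of fun x y => if x = f y then 1 else 0

/-- The NOT gate. -/
def notGate : Op (Fin 1) := classicalOp fun x i => !(x i)

/-- The Toffoli gate, with target qubit `2` and control qubits `0` and `1`. -/
def toffoliGate : Op (Fin 3) :=
  classicalOp fun x => Function.update x 2 (xor (x 2) (x 0 && x 1))

/-! ### Verifiers and provers -/

/-- The qubits of a verifier: `mY` message qubits shared with the yes-prover, `work + 1` private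
qubits, and `mN` message qubits shared with the no-prover. -/
abbrev VWire (mY work mN : ℕ) : Type := Fin mY ⊕ Fin (work + 1) ⊕ Fin mN

/-- The circuits `V₀, V₁, V₂` of a verifier of a short quantum game on one input string. The first
private qubit is the output qubit. -/
structure VerifierCircuits (G : GateSet) where
  mY : ℕ
  work : ℕ
  mN : ℕ
  V0 : Circuit G (VWire mY work mN)
  V1 : Circuit G (VWire mY work mN)
  V2 : Circuit G (VWire mY work mN)

/-- The finite alphabet in which verifiers are described. -/
inductive Sym (G : GateSet)
  | gate (g : Fin G.card)
  | reg (r : Fin 3)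
  | tick
  | sep

/-- A qubit is written as its register followed by its index in unary. -/
def encodeWire (G : GateSet) {mY work mN : ℕ} : VWire mY work mN → List (Sym G)
  | Sum.inl i => Sym.reg 0 :: List.replicate i Sym.tick
  | Sum.inr (Sum.inl i) => Sym.reg 1 :: List.replicate i Sym.tick
  | Sum.inr (Sum.inr i) => Sym.reg 2 :: List.replicate i Sym.tick

/-- A circuit is written gate by gate, each gate being followed by the qubits it acts on. -/
def encodeCircuit {G : GateSet} {mY work mN : ℕ} (C : Circuit G (VWire mY work mN)) :
    List (Sym G) :=
  C.flatMap fun I => Sym.gate I.gate :: (List.ofFn fun j => encodeWire G (I.wires j)).flatten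

/-- The description of a verifier's circuits as a string: the sizes of its registers in unary,
followed by the three circuits. -/
def VerifierCircuits.encode {G : GateSet} (V : VerifierCircuits G) : List (Sym G) :=
  List.replicate V.mY Sym.tick ++ Sym.sep :: (List.replicate V.work Sym.tick ++
    Sym.sep :: (List.replicate V.mN Sym.tick ++ Sym.sep :: (encodeCircuit V.V0 ++
      Sym.sep :: (encodeCircuit V.V1 ++ Sym.sep :: encodeCircuit V.V2))))

/-- A verifier `x ↦ (V₀, V₁, V₂)` is generated by a deterministic Turing machine that, on input
`x`, outputs the description of its circuits in time polynomial in `|x|`. -/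
def PolyTimeVerifier {G : GateSet} (V : List Bool → VerifierCircuits G) : Prop :=
  Nonempty (Turing.TM2ComputableInPolyTime (fun x : List Bool => x) VerifierCircuits.encode V)

/-- A one-round yes-prover playing with the verifier `V`: on every input, a number of private
qubits and an arbitrary unitary operator on its private and message qubits. -/
structure YesProver {G : GateSet} (V : List Bool → VerifierCircuits G) where
  priv : List Bool → ℕ
  op : ∀ x, Matrix.unitaryGroup (Fin (priv x) ⊕ Fin (V x).mY → Bool) ℂ

/-- A one-round no-prover playing with the verifier `V`. -/
structure NoProver {G : GateSet} (V : List Bool → VerifierCircuits G) where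
  priv : List Bool → ℕ
  op : ∀ x, Matrix.unitaryGroup (Fin (V x).mN ⊕ Fin (priv x) → Bool) ℂ

/-! ### The interaction -/

/-- All qubits of a game, `Y ⊗ (M_Y ⊗ V ⊗ M_N) ⊗ N`. -/
abbrev GameWire (y mY work mN n : ℕ) : Type := Fin y ⊕ VWire mY work mN ⊕ Fin n

/-- The qubits of the verifier among all qubits of the game. -/
def verifierWires (y mY work mN n : ℕ) : VWire mY work mN ↪ GameWire y mY work mN n where
  toFun w := Sum.inr (Sum.inl w)
  inj' := fun _ _ h => by simpa using h

/-- The qubits of the yes-prover among all qubits of the game. -/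
def yesWires (y mY work mN n : ℕ) : Fin y ⊕ Fin mY ↪ GameWire y mY work mN n where
  toFun
    | Sum.inl i => Sum.inl i
    | Sum.inr i => Sum.inr (Sum.inl (Sum.inl i))
  inj' := by rintro (a | a) (b | b) h <;> simp_all

/-- The qubits of the no-prover among all qubits of the game. -/
def noWires (y mY work mN n : ℕ) : Fin mN ⊕ Fin n ↪ GameWire y mY work mN n where
  toFun
    | Sum.inl i => Sum.inr (Sum.inl (Sum.inr (Sum.inr i)))
    | Sum.inr i => Sum.inr (Sum.inr i)
  inj' := by rintro (a | a) (b | b) h <;> simp_all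

/-- The output qubit among all qubits of the game. -/
def outputWire (y mY work mN n : ℕ) : GameWire y mY work mN n :=
  Sum.inr (Sum.inl (Sum.inr (Sum.inl 0)))

open Matrix in
/-- The final state `V₂ N₁ V₁ Y₁ V₀ |0⟩` of a short quantum game in which the provers have `y` and
`n` private qubits. -/
noncomputable def finalState {G : GateSet} (V : VerifierCircuits G) (y n : ℕ)
    (Y : Op (Fin y ⊕ Fin V.mY)) (N : Op (Fin V.mN ⊕ Fin n)) :
    (GameWire y V.mY V.work V.mN n → Bool) → ℂ :=
  lift (verifierWires y V.mY V.work V.mN n) (Circuit.op V.V2) *ᵥ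
    (lift (noWires y V.mY V.work V.mN n) N *ᵥ
      (lift (verifierWires y V.mY V.work V.mN n) (Circuit.op V.V1) *ᵥ
        (lift (yesWires y V.mY V.work V.mN n) Y *ᵥ
          (lift (verifierWires y V.mY V.work V.mN n) (Circuit.op V.V0) *ᵥ
            Pi.single (fun _ => false) 1))))

/-- The probability that the standard measurement of the output qubit of the final state yields
the value `b`, i.e. the squared norm of the corresponding projection of the state. -/
noncomputable def outcomeProb {G : GateSet} (b : Bool) (V : List Bool → VerifierCircuits G)
    (Y : YesProver V) (N : NoProver V) (x : List Bool) : ℝ :=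
  ∑ z : GameWire (Y.priv x) (V x).mY (V x).work (V x).mN (N.priv x) → Bool,
    if z (outputWire (Y.priv x) (V x).mY (V x).work (V x).mN (N.priv x)) = b then
      ‖finalState (V x) (Y.priv x) (N.priv x) (Y.op x) (N.op x) z‖ ^ 2
    else 0

/-- The probability that the game is accepted on input `x`. -/
noncomputable def acceptProb {G : GateSet} (V : List Bool → VerifierCircuits G)
    (Y : YesProver V) (N : NoProver V) (x : List Bool) : ℝ := outcomeProb true V Y N x

/-- The probability that the game is rejected on input `x`. -/
noncomputable def rejectProb {G : GateSet} (V : List Bool → VerifierCircuits G)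
    (Y : YesProver V) (N : NoProver V) (x : List Bool) : ℝ := outcomeProb false V Y N x

/-! ### Complexity classes -/

/-- The verifier `V` decides `L` with completeness error `c` and soundness error `s`. -/
def Decides {G : GateSet} (V : List Bool → VerifierCircuits G) (L : Set (List Bool))
    (c s : ℕ → ℝ) : Prop :=
  (∃ Y : YesProver V, ∀ N : NoProver V, ∀ x ∈ L, rejectProb V Y N x ≤ c x.length) ∧
  (∃ N : NoProver V, ∀ Y : YesProver V, ∀ x ∉ L, acceptProb V Y N x ≤ s x.length)

/-- The class `SQG(c, s)` of languages that have short quantum games with completeness error `c`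
and soundness error `s` (with verifier circuits over the gate set `G`). -/
def SQG (G : GateSet) (c s : ℕ → ℝ) : Set (Set (List Bool)) :=
  {L | ∃ V : List Bool → VerifierCircuits G, PolyTimeVerifier V ∧ Decides V L c s}

/-- The class `SQG_*(c, s)`: the verifier's first circuit is empty, so that the verifier does not
send a message to the yes-prover. -/
def SQGStar (G : GateSet) (c s : ℕ → ℝ) : Set (Set (List Bool)) :=
  {L | ∃ V : List Bool → VerifierCircuits G, PolyTimeVerifier V ∧ (∀ x, (V x).V0 = []) ∧
    Decides V L c s}

/-- `poly`: the positive, polynomially bounded functions on `ℕ` that are computable in polynomial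
time (from `n` in unary, i.e. in time polynomial in `n`, with the value written in binary). -/
def IsPoly (k : ℕ → ℕ) : Prop :=
  (∀ n, 0 < k n) ∧ (∃ p : Polynomial ℕ, ∀ n, k n ≤ p.eval n) ∧
    Nonempty (Turing.TM2ComputableInPolyTime Computability.unaryEncodeNat Computability.encodeNat k)

end ShortQuantumGames

set_option linter.unusedSectionVars false

namespace ShortQuantumGames

open Matrix
open scoped ComplexOrder

/-! The new verifier runs `k` copies of the old game in parallel on disjoint qubits and outputs the
conjunction of the `k` outcomes (errors `kc` and `s^k`) or their disjunction (errors `c^k` and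
`ks`). The honest prover plays its old strategy in each copy. The opponent may apply one unitary
jointly to all copies, so the outcomes need not be independent. All four bounds follow from one
inequality: if an outcome has probability at most `s` in a single game, then it occurs in all copies
of a set `S` with probability at most `s^|S|`. Taking all copies gives the powers; taking single
copies and the union bound gives the factors `k` (`combined_sum_le`).

The inequality rests on semidefinite duality. With the honest prover fixed, a single game consists
of a state `P|0⟩`, a unitary of the opponent on its own qubits, an operator `T` and a measurement
`Π`. Purifications with equal marginals are unitarily equivalent
(`exists_unitary_of_conjTranspose_mul_self_eq`), so the opponent can reach every positive `X` whose
partial trace over its message qubits is that of `P|0⟩`. Its optimum is therefore a semidefinite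
program: maximize `tr(QX)` with `Q = Tᴴ Π T`. Separating a point from a closed convex cone
(`exists_dual`) yields an operator `Z` on the qubits out of the opponent's reach with `1 ⊗ Z ≥ Q`
and with expectation at most `s + ε` in the state `P|0⟩` (`exists_dual_of_game`).

In the repeated game the tensor product of the `Z` dominates that of the `Q`, because all factors
are positive, and it commutes with the joint unitary, which therefore cancels. What remains is a
product of expectations in single copies (`vacuum_tens_le`); `ε → 0` then gives `repeated_game_le`.

Two constructive points remain. The conjunction or disjunction is computed from NOT and Toffoli
gates on clean auxiliary qubits (`sends_combine`, `vacuumProb_combine_mul`). The description of the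
new verifier must be computable in polynomial time: structured stack programs that may call given
machines are compiled to Turing machines (`Prog.implemented`), and the copies of a circuit arise
from its description by substituting symbols (`encodeWire_copyWires`). An empty `V₀` stays empty
because the new `V₀` consists of copies of the old one. -/

theorem exists_eq_conjTranspose_mul_self_of_posSemidef {n : Type*} [Fintype n]
    {A : Matrix n n ℂ} (hA : A.PosSemidef) : ∃ R : Matrix n n ℂ, A = Rᴴ * R := by
  classical
  open scoped MatrixOrder in
  obtain ⟨X, hX, -, rfl⟩ :=
    CFC.exists_sqrt_of_isSelfAdjoint_of_quasispectrumRestricts hA.isHermitian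
      (QuasispectrumRestricts.nnreal_of_nonneg hA.nonneg)
  exact ⟨X, by rw [← Matrix.star_eq_conjTranspose, hX.star_eq]⟩

/-! ### Operators on subsets of the qubits -/

section Lift

variable {A B W : Type}

theorem lift_apply_of_eq_off (e : A ↪ W) (U : Op A) {x y : W → Bool}
    (h : ∀ w, w ∉ Set.range e → x w = y w) : lift e U x y = U (x ∘ e) (y ∘ e) := by
  simp only [lift, Matrix.of_apply, if_pos h]

theorem lift_apply_of_ne_off (e : A ↪ W) (U : Op A) {x y : W → Bool}
    (h : ¬ ∀ w, w ∉ Set.range e → x w = y w) : lift e U x y = 0 := by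
  simp only [lift, Matrix.of_apply, if_neg h]

theorem extend_comp_embedding (e : A ↪ W) (a : A → Bool) (x : W → Bool) :
    Function.extend e a x ∘ e = a :=
  funext fun i => e.injective.extend_apply a x i

theorem extend_off (e : A ↪ W) (a : A → Bool) (x : W → Bool) {w : W} (hw : w ∉ Set.range e) :
    Function.extend e a x w = x w :=
  Function.extend_apply' a x w fun ⟨i, hi⟩ => hw ⟨i, hi⟩

theorem eq_extend_of_eq_off (e : A ↪ W) {x y : W → Bool}
    (h : ∀ w, w ∉ Set.range e → x w = y w) : y = Function.extend e (y ∘ e) x := by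
  funext w
  by_cases hw : w ∈ Set.range e
  · obtain ⟨i, rfl⟩ := hw
    rw [e.injective.extend_apply]; rfl
  · rw [extend_off e _ _ hw, h w hw]

theorem extend_comp_self (e : A ↪ W) (x : W → Bool) : Function.extend e (x ∘ e) x = x :=
  (eq_extend_of_eq_off e fun _ _ => rfl).symm

theorem extend_injective (e : A ↪ W) (x : W → Bool) :
    Function.Injective fun a : A → Bool => Function.extend e a x := fun a b h => by
  have := congrArg (· ∘ e) h
  simpa only [extend_comp_embedding] using this

theorem lift_extend_left (e : A ↪ W) (U : Op A) (a : A → Bool) (x : W → Bool) :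
    lift e U x (Function.extend e a x) = U (x ∘ e) a := by
  rw [lift_apply_of_eq_off e U fun w hw => (extend_off e a x hw).symm, extend_comp_embedding]

theorem lift_sub (e : A ↪ W) (U V : Op A) : lift e (U - V) = lift e U - lift e V := by
  ext x y
  rw [Matrix.sub_apply]
  simp only [lift, Matrix.of_apply, Matrix.sub_apply]
  split_ifs <;> simp

theorem lift_conjTranspose (e : A ↪ W) (U : Op A) : lift e Uᴴ = (lift e U)ᴴ := by
  ext x y
  by_cases h : ∀ w, w ∉ Set.range e → x w = y w
  · rw [Matrix.conjTranspose_apply, lift_apply_of_eq_off e _ h,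
      lift_apply_of_eq_off e _ fun w hw => (h w hw).symm, Matrix.conjTranspose_apply]
  · rw [Matrix.conjTranspose_apply, lift_apply_of_ne_off e _ h, lift_apply_of_ne_off, star_zero]
    exact fun h' => h fun w hw => (h' w hw).symm

theorem lift_one [Fintype A] [Fintype W] [DecidableEq A] [DecidableEq W] (e : A ↪ W) :
    lift e (1 : Op A) = 1 := by
  ext x y
  by_cases h : ∀ w, w ∉ Set.range e → x w = y w
  · rw [lift_apply_of_eq_off e _ h]
    by_cases hxy : x = y
    · subst hxy
      rw [Matrix.one_apply_eq, Matrix.one_apply_eq]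
    · rw [Matrix.one_apply_ne hxy, Matrix.one_apply_ne]
      intro h'
      refine hxy ?_
      rw [eq_extend_of_eq_off e h, ← h', extend_comp_self]
  · rw [lift_apply_of_ne_off e _ h, Matrix.one_apply_ne]
    rintro rfl
    exact h fun _ _ => rfl

theorem lift_lift (e : A ↪ W) (f : B ↪ A) (U : Op B) :
    lift e (lift f U) = lift (f.trans e) U := by
  ext x y
  by_cases h : ∀ w, w ∉ Set.range (f.trans e) → x w = y w
  · rw [lift_apply_of_eq_off _ _ h, lift_apply_of_eq_off e, lift_apply_of_eq_off f]
    · rfl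
    · rintro w hw
      refine h _ ?_
      rintro ⟨b, hb⟩
      exact hw ⟨b, e.injective hb⟩
    · rintro w hw
      refine h _ ?_
      rintro ⟨b, hb⟩
      exact hw ⟨f b, hb⟩
  · rw [lift_apply_of_ne_off _ _ h]
    by_cases h1 : ∀ w, w ∉ Set.range e → x w = y w
    · rw [lift_apply_of_eq_off e _ h1, lift_apply_of_ne_off]
      intro h2
      refine h fun w hw => ?_
      by_cases hw' : w ∈ Set.range e
      · obtain ⟨a, rfl⟩ := hw'
        refine h2 a ?_
        rintro ⟨b, rfl⟩
        exact hw ⟨b, rfl⟩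
      · exact h1 w hw'
    · rw [lift_apply_of_ne_off e _ h1]

theorem lift_equiv_apply (e : A ≃ W) (U : Op A) (x y : W → Bool) :
    lift e.toEmbedding U x y = U (x ∘ e) (y ∘ e) :=
  lift_apply_of_eq_off _ _ fun w hw => absurd ⟨e.symm w, by simp⟩ hw

theorem lift_diagonal [Fintype A] [Fintype W] [DecidableEq A] [DecidableEq W] (e : A ↪ W) (d : (A → Bool) → ℂ) :
    lift e (Matrix.diagonal d) = Matrix.diagonal fun x => d (x ∘ e) := by
  ext x y
  by_cases h : ∀ w, w ∉ Set.range e → x w = y w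
  · rw [lift_apply_of_eq_off e _ h]
    by_cases hxy : x = y
    · simp [hxy]
    · rw [Matrix.diagonal_apply_ne _ hxy, Matrix.diagonal_apply_ne]
      intro h'
      refine hxy ?_
      rw [eq_extend_of_eq_off e h, ← h', extend_comp_self]
  · rw [lift_apply_of_ne_off e _ h, Matrix.diagonal_apply_ne]
    rintro rfl
    exact h fun _ _ => rfl

variable [Fintype A] [DecidableEq A] [Fintype B] [DecidableEq B] [Fintype W] [DecidableEq W]

/-- A lifted operator acts on the lifted qubits only. -/
theorem lift_mul_apply {ι : Type*} (e : A ↪ W) (U : Op A) (M : Matrix (W → Bool) ι ℂ)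
    (x : W → Bool) (z : ι) :
    (lift e U * M) x z = ∑ a : A → Bool, U (x ∘ e) a * M (Function.extend e a x) z := by
  rw [Matrix.mul_apply]
  symm
  rw [← Finset.sum_subset (Finset.subset_univ
    ((Finset.univ : Finset (A → Bool)).map ⟨_, extend_injective e x⟩))]
  · rw [Finset.sum_map]
    refine Finset.sum_congr rfl fun a _ => ?_
    simp only [Function.Embedding.coeFn_mk]
    rw [lift_extend_left]
  · intro y _ hy
    rw [lift_apply_of_ne_off, zero_mul]
    intro h
    refine hy ?_
    rw [Finset.mem_map]
    exact ⟨y ∘ e, Finset.mem_univ _, (eq_extend_of_eq_off e h).symm⟩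

theorem lift_mul (e : A ↪ W) (U V : Op A) : lift e (U * V) = lift e U * lift e V := by
  ext x z
  rw [lift_mul_apply]
  by_cases h : ∀ w, w ∉ Set.range e → x w = z w
  · rw [lift_apply_of_eq_off e _ h, Matrix.mul_apply]
    refine Finset.sum_congr rfl fun a _ => ?_
    rw [lift_apply_of_eq_off e V, extend_comp_embedding]
    intro w hw
    rw [extend_off e a x hw, h w hw]
  · rw [lift_apply_of_ne_off e _ h]
    refine (Finset.sum_eq_zero fun a _ => ?_).symm
    rw [lift_apply_of_ne_off e V, mul_zero]
    intro h'
    refine h fun w hw => ?_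
    rw [← h' w hw, extend_off e a x hw]

/-- The right-hand side is symmetric in the two operators up to commuting scalars, and this is what
makes operators on disjoint qubits commute in `lift_commute`. -/
theorem lift_mul_lift_apply_of_disjoint (e : A ↪ W) (f : B ↪ W)
    (hef : Disjoint (Set.range e) (Set.range f)) (U : Op A) (V : Op B) (x z : W → Bool)
    [Decidable (∀ w, w ∉ Set.range e → w ∉ Set.range f → x w = z w)] :
    (lift e U * lift f V) x z =
      if ∀ w, w ∉ Set.range e → w ∉ Set.range f → x w = z w then
        U (x ∘ e) (z ∘ e) * V (x ∘ f) (z ∘ f) else 0 := by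
  have hd : ∀ w, w ∈ Set.range e → w ∉ Set.range f := fun w h => Set.disjoint_left.1 hef h
  rw [lift_mul_apply]
  have hf : ∀ a, Function.extend e a x ∘ f = x ∘ f := fun a => funext fun j =>
    extend_off e a x fun h => hd _ h ⟨j, rfl⟩
  rw [Finset.sum_eq_single (z ∘ e)]
  · split_ifs with h
    · rw [lift_apply_of_eq_off f V, hf]
      intro w hw
      by_cases hwe : w ∈ Set.range e
      · obtain ⟨i, rfl⟩ := hwe
        rw [e.injective.extend_apply]; rfl
      · rw [extend_off e _ _ hwe, h w hwe hw]
    · rw [lift_apply_of_ne_off f V, mul_zero]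
      intro h'
      refine h fun w hwe hwf => ?_
      rw [← h' w hwf, extend_off e _ _ hwe]
  · intro a _ ha
    rw [lift_apply_of_ne_off f V, mul_zero]
    intro h'
    refine ha (funext fun i => ?_)
    rw [Function.comp_apply, ← h' (e i) (hd _ ⟨i, rfl⟩), e.injective.extend_apply]
  · intro h
    exact absurd (Finset.mem_univ _) h

theorem lift_commute (e : A ↪ W) (f : B ↪ W) (hef : Disjoint (Set.range e) (Set.range f))
    (U : Op A) (V : Op B) : Commute (lift e U) (lift f V) := by
  classical
  ext x z
  rw [lift_mul_lift_apply_of_disjoint e f hef, lift_mul_lift_apply_of_disjoint f e hef.symm]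
  simp only [mul_comm (V _ _)]
  congr 1
  exact propext ⟨fun h w h1 h2 => h w h2 h1, fun h w h1 h2 => h w h2 h1⟩

theorem lift_mem_unitaryGroup (e : A ↪ W) {U : Op A} (hU : U ∈ Matrix.unitaryGroup (A → Bool) ℂ) :
    lift e U ∈ Matrix.unitaryGroup (W → Bool) ℂ := by
  rw [Matrix.mem_unitaryGroup_iff, Matrix.star_eq_conjTranspose] at hU ⊢
  rw [← lift_conjTranspose, ← lift_mul, hU, lift_one]

/-- If `N` commutes with all operators on the qubits `e`, then the qubits `e` of `N |0⟩` are
zero. -/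
theorem apply_zero_eq_zero_of_commute (e : A ↪ W) (N : Op W)
    (hN : ∀ X : Op A, Commute N (lift e X)) {y : W → Bool} (hy : y ∘ e ≠ fun _ => false) :
    N y (fun _ => false) = 0 := by
  -- The test operator is the projection of the qubits `e` onto zero. Multiplication by it on the
  -- right fixes the column of `|0⟩`, on the left it kills the row of `y`.
  have h := hN (Matrix.diagonal fun a => if a = fun _ => false then 1 else 0)
  have h' := congrFun (congrFun h.eq y) fun _ => false
  rw [lift_diagonal, Matrix.mul_diagonal, Matrix.diagonal_mul] at h'
  rw [if_neg hy, zero_mul, Function.comp_def, if_pos rfl, mul_one] at h'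
  exact h'

/-- The vacuum expectation factorizes over commuting sets of qubits. -/
theorem lift_mul_apply_zero_zero (e : A ↪ W) (M : Op A) (N : Op W)
    (hN : ∀ X : Op A, Commute N (lift e X)) :
    (lift e M * N) (fun _ => false) (fun _ => false) =
      M (fun _ => false) (fun _ => false) * N (fun _ => false) (fun _ => false) := by
  -- `N` leaves the qubits `e` of `|0⟩` at zero, so only the zero assignment contributes to the sum.
  rw [lift_mul_apply, Finset.sum_eq_single fun _ => false]
  · have := extend_comp_self e fun _ => false
    rw [Function.comp_def] at this ⊢
    rw [this]
  · intro a _ ha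
    rw [apply_zero_eq_zero_of_commute e N hN, mul_zero]
    rwa [extend_comp_embedding]
  · intro h
    exact absurd (Finset.mem_univ _) h

end Lift

/-! ### Circuits -/

section Circuits

variable {G : GateSet} {A B W : Type}

/-- The circuit `C` with its qubits renamed along `e`. -/
def Circuit.rename (e : A ↪ W) (C : Circuit G A) : Circuit G W :=
  C.map fun I => ⟨I.gate, I.wires.trans e⟩

variable [Fintype A] [DecidableEq A] [Fintype W] [DecidableEq W]

theorem Circuit.op_append (C D : Circuit G W) :
    Circuit.op (C ++ D) = Circuit.op D * Circuit.op C := by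
  induction C with
  | nil => simp [Circuit.op]
  | cons I C ih => rw [List.cons_append, Circuit.op, ih, Circuit.op, mul_assoc]

theorem Circuit.op_rename (e : A ↪ W) (C : Circuit G A) :
    Circuit.op (C.rename e) = lift e (Circuit.op C) := by
  induction C with
  | nil => simp [Circuit.rename, Circuit.op, lift_one]
  | cons I C ih =>
    rw [Circuit.op, lift_mul, lift_lift, ← ih]
    rfl

theorem Circuit.op_mem_unitaryGroup (C : Circuit G W) :
    Circuit.op C ∈ Matrix.unitaryGroup (W → Bool) ℂ := by
  induction C with
  | nil => exact one_mem _
  | cons I C ih => exact mul_mem ih (lift_mem_unitaryGroup _ (G.gate I.gate).2)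

end Circuits

end ShortQuantumGames

namespace ShortQuantumGames

open Matrix
open scoped ComplexOrder

/-! ### Tensor products of local operators -/

section Tens

variable {ι C B W : Type} [Fintype C] [DecidableEq C] [Fintype B] [DecidableEq B]
  [Fintype W] [DecidableEq W]

/-- The tensor product of operators `X i` acting on the disjoint collections `c i` of qubits. -/
noncomputable def tens (l : List ι) (c : ι → C ↪ W) (X : ι → Op C) : Op W :=
  (l.map fun i => lift (c i) (X i)).prod

theorem tens_nil (c : ι → C ↪ W) (X : ι → Op C) : tens [] c X = 1 := rfl

theorem tens_cons (i : ι) (l : List ι) (c : ι → C ↪ W) (X : ι → Op C) :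
    tens (i :: l) c X = lift (c i) (X i) * tens l c X := by
  simp [tens]

theorem commute_tens {N : Op W} {l : List ι} {c : ι → C ↪ W} {X : ι → Op C}
    (h : ∀ i ∈ l, Commute N (lift (c i) (X i))) : Commute N (tens l c X) := by
  refine Commute.list_prod_right _ _ fun M hM => ?_
  obtain ⟨i, hi, rfl⟩ := List.mem_map.1 hM
  exact h i hi

theorem tens_congr {l : List ι} {c : ι → C ↪ W} {X Y : ι → Op C} (h : ∀ i ∈ l, X i = Y i) :
    tens l c X = tens l c Y := by
  unfold tens
  congr 1
  exact List.map_congr_left fun i hi => by rw [h i hi]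

theorem tens_lift (l : List ι) (c : ι → C ↪ W) (f : B ↪ C) (X : ι → Op B) :
    tens l c (fun i => lift f (X i)) = tens l (fun i => f.trans (c i)) X := by
  simp only [tens, lift_lift]

theorem lift_tens {W' : Type} [Fintype W'] [DecidableEq W'] (l : List ι) (c : ι → C ↪ W)
    (e : W ↪ W') (X : ι → Op C) :
    lift e (tens l c X) = tens l (fun i => (c i).trans e) X := by
  induction l with
  | nil => exact lift_one e
  | cons i l ih => rw [tens_cons, tens_cons, lift_mul, ih, lift_lift]

/-- Positive operators on commuting sets of qubits have a positive product. -/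
theorem posSemidef_lift_mul (e : C ↪ W) {M : Op C} (hM : M.PosSemidef) {N : Op W}
    (hN : N.PosSemidef) (h : ∀ X : Op C, Commute N (lift e X)) :
    (lift e M * N).PosSemidef := by
  obtain ⟨R, rfl⟩ := exists_eq_conjTranspose_mul_self_of_posSemidef hM
  -- One factor of the decomposition `M = Rᴴ R` is moved past `N`, which exhibits the product as a
  -- conjugate of `N`.
  have : lift e (Rᴴ * R) * N = (lift e R)ᴴ * N * lift e R := by
    rw [lift_mul, mul_assoc, ← (h R).eq, ← mul_assoc, lift_conjTranspose]
  rw [this]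
  exact hN.conjTranspose_mul_mul_same _

variable {l : List ι} {c : ι → C ↪ W}
  (hc : Pairwise fun i j => Disjoint (Set.range (c i)) (Set.range (c j)))
include hc

theorem tens_commute_lift {i : ι} (hi : i ∉ l) (X : ι → Op C) (M : Op C) :
    Commute (tens l c X) (lift (c i) M) := by
  refine (commute_tens fun j hj => ?_).symm
  exact lift_commute _ _ (hc (by rintro rfl; exact hi hj)) _ _

theorem tens_mul (hl : l.Nodup) (X Y : ι → Op C) :
    tens l c X * tens l c Y = tens l c fun i => X i * Y i := by
  induction l with
  | nil => simp [tens_nil]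
  | cons i l ih =>
    rw [List.nodup_cons] at hl
    rw [tens_cons, tens_cons, tens_cons, ← ih hl.2, lift_mul, mul_assoc, mul_assoc,
      ← mul_assoc (tens l c X), (tens_commute_lift hc hl.1 X (Y i)).eq, mul_assoc]

theorem tens_conjTranspose (hl : l.Nodup) (X : ι → Op C) :
    (tens l c X)ᴴ = tens l c fun i => (X i)ᴴ := by
  induction l with
  | nil => exact conjTranspose_one
  | cons i l ih =>
    rw [List.nodup_cons] at hl
    rw [tens_cons, tens_cons, conjTranspose_mul, ih hl.2, lift_conjTranspose,
      ← lift_conjTranspose, (tens_commute_lift hc hl.1 _ _).eq]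

theorem tens_zero_zero (hl : l.Nodup) (X : ι → Op C) :
    tens l c X (fun _ => false) (fun _ => false) =
      (l.map fun i => X i (fun _ => false) (fun _ => false)).prod := by
  induction l with
  | nil => simp [tens_nil]
  | cons i l ih =>
    rw [List.nodup_cons] at hl
    rw [tens_cons, lift_mul_apply_zero_zero _ _ _ (tens_commute_lift hc hl.1 X), ih hl.2]
    simp

theorem posSemidef_tens (hl : l.Nodup) {X : ι → Op C} (hX : ∀ i, (X i).PosSemidef) :
    (tens l c X).PosSemidef := by
  induction l with
  | nil => exact PosSemidef.one
  | cons i l ih =>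
    rw [List.nodup_cons] at hl
    rw [tens_cons]
    exact posSemidef_lift_mul _ (hX i) (ih hl.2) (tens_commute_lift hc hl.1 X)

/-- Telescoping: `Y₁ ⊗ Y − X₁ ⊗ X = Y₁ ⊗ (Y − X) + (Y₁ − X₁) ⊗ X`, where each summand is a product
of positive operators. This needs `X i ≥ 0`, which also makes `Y i` positive. -/
theorem posSemidef_tens_sub_tens (hl : l.Nodup) {X Y : ι → Op C} (hX : ∀ i, (X i).PosSemidef)
    (hXY : ∀ i, (Y i - X i).PosSemidef) : (tens l c Y - tens l c X).PosSemidef := by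
  induction l with
  | nil => rw [tens_nil, tens_nil, sub_self]; exact PosSemidef.zero
  | cons i l ih =>
    rw [List.nodup_cons] at hl
    have hY : (Y i).PosSemidef := by simpa using (hX i).add (hXY i)
    have : tens (i :: l) c Y - tens (i :: l) c X =
        lift (c i) (Y i) * (tens l c Y - tens l c X) +
          lift (c i) (Y i - X i) * tens l c X := by
      rw [tens_cons, tens_cons, lift_sub, mul_sub, sub_mul]
      abel
    rw [this]
    refine PosSemidef.add ?_ ?_
    · exact posSemidef_lift_mul _ hY (ih hl.2) fun M =>
        (tens_commute_lift hc hl.1 Y M).sub_left (tens_commute_lift hc hl.1 X M)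
    · exact posSemidef_lift_mul _ (hXY i) (posSemidef_tens hc hl.2 hX)
        (tens_commute_lift hc hl.1 X)

/-- Weak duality for repeated games: a joint unitary `U` that does not interfere with the
dual-feasible operators `Z i` cannot make the `Q i` exceed the product of the dual values. -/
theorem vacuum_tens_le (hl : l.Nodup) {Q Z : ι → Op C} (hQ : ∀ i, (Q i).PosSemidef)
    (hZ : ∀ i, (Z i - Q i).PosSemidef) {U : Op W} (hU : Uᴴ * U = 1)
    (hUZ : ∀ i, Commute U (lift (c i) (Z i))) (P : ι → Op C) :
    ((U * tens l c P)ᴴ * tens l c Q * (U * tens l c P)) (fun _ => false) (fun _ => false) ≤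
      (l.map fun i => ((P i)ᴴ * Z i * P i) (fun _ => false) (fun _ => false)).prod := by
  -- The inequality of tensor products is conjugated by the operator that prepares the state, and
  -- the diagonal entry at `|0⟩` is read off.
  have h := ((posSemidef_tens_sub_tens hc hl hQ hZ).conjTranspose_mul_mul_same
    (U * tens l c P)).diag_nonneg (i := fun _ => false)
  rw [mul_sub, sub_mul, Matrix.sub_apply, sub_nonneg] at h
  refine h.trans_eq ?_
  have hc' : Commute U (tens l c Z) := commute_tens fun i _ => hUZ i
  -- `U` moves past the tensor product of the `Z i` and cancels against `Uᴴ`; the remaining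
  -- operators are local, so the expectation factorizes.
  rw [conjTranspose_mul, mul_assoc _ Uᴴ, mul_assoc, mul_assoc Uᴴ, ← mul_assoc (tens l c Z),
    ← hc'.eq, mul_assoc U, ← mul_assoc Uᴴ, hU, one_mul, tens_conjTranspose hc hl,
    tens_mul hc hl, tens_mul hc hl, tens_zero_zero hc hl]
  simp only [mul_assoc]

end Tens

end ShortQuantumGames

namespace ShortQuantumGames

open Matrix
open scoped ComplexOrder Kronecker

/-! ### Semidefinite programming duality -/

section Duality

variable {α β : Type*} [Fintype α] [DecidableEq α] [Fintype β] [DecidableEq β]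

/-- The partial trace over the first tensor factor. -/
def partialTrace (X : Matrix (α × β) (α × β) ℂ) : β → β → ℂ :=
  fun b b' => ∑ a, X (a, b) (a, b')

/-- The values of all feasible and slack variables of the semidefinite program of a prover. -/
def sdpCone (Q : Matrix (α × β) (α × β) ℂ) : Set ((β → β → ℂ) × ℝ) :=
  {e | ∃ X : Matrix (α × β) (α × β) ℂ, X.PosSemidef ∧ partialTrace X = e.1 ∧
    e.2 ≤ (Q * X).trace.re}

theorem partialTrace_add (X Y : Matrix (α × β) (α × β) ℂ) :
    partialTrace (X + Y) = partialTrace X + partialTrace Y := by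
  funext b b'
  simp [partialTrace, Finset.sum_add_distrib]

theorem partialTrace_smul (r : ℝ) (X : Matrix (α × β) (α × β) ℂ) :
    partialTrace (r • X) = r • partialTrace X := by
  funext b b'
  simp [partialTrace, Finset.mul_sum]

theorem sdpCone_add {Q : Matrix (α × β) (α × β) ℂ} {d e : (β → β → ℂ) × ℝ}
    (hd : d ∈ sdpCone Q) (he : e ∈ sdpCone Q) : d + e ∈ sdpCone Q := by
  obtain ⟨X, hX, h1, h2⟩ := hd
  obtain ⟨Y, hY, h3, h4⟩ := he
  refine ⟨X + Y, hX.add hY, by rw [partialTrace_add, h1, h3]; rfl, ?_⟩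
  rw [mul_add, trace_add, Complex.add_re]
  exact add_le_add h2 h4

theorem sdpCone_smul {Q : Matrix (α × β) (α × β) ℂ} {e : (β → β → ℂ) × ℝ} {r : ℝ}
    (hr : 0 ≤ r) (he : e ∈ sdpCone Q) : r • e ∈ sdpCone Q := by
  obtain ⟨Y, hY, h3, h4⟩ := he
  refine ⟨r • Y, hY.smul hr, by rw [partialTrace_smul, h3]; rfl, ?_⟩
  rw [Matrix.mul_smul, trace_smul, Complex.smul_re]
  exact mul_le_mul_of_nonneg_left h4 hr

theorem convex_sdpCone (Q : Matrix (α × β) (α × β) ℂ) : Convex ℝ (sdpCone Q) :=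
  fun _ hd _ he _ _ ha hb _ => sdpCone_add (sdpCone_smul ha hd) (sdpCone_smul hb he)

/-- The trace of the partial trace is the full trace of `Rᴴ * R`, which is the sum of the squared
moduli of all entries of `R`. A bounded marginal thus confines `R` to a compact set. -/
theorem norm_sq_le_partialTrace (R : Matrix (α × β) (α × β) ℂ) (i j : α × β) :
    ‖R i j‖ ^ 2 ≤ ∑ b, (partialTrace (Rᴴ * R) b b).re := by
  have h1 : ∑ b, (partialTrace (Rᴴ * R) b b).re = ∑ j : α × β, ∑ i, ‖R i j‖ ^ 2 := by
    rw [Fintype.sum_prod_type_right]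
    refine Finset.sum_congr rfl fun b _ => ?_
    rw [partialTrace, Complex.re_sum]
    refine Finset.sum_congr rfl fun a _ => ?_
    rw [Matrix.mul_apply, Complex.re_sum]
    refine Finset.sum_congr rfl fun i _ => ?_
    rw [conjTranspose_apply, Complex.star_def, ← Complex.normSq_eq_conj_mul_self,
      Complex.ofReal_re, Complex.normSq_eq_norm_sq]
  rw [h1]
  refine le_trans ?_ (Finset.single_le_sum (f := fun j => ∑ i, ‖R i j‖ ^ 2)
    (fun j _ => Finset.sum_nonneg fun i _ => by positivity) (Finset.mem_univ j))
  exact Finset.single_le_sum (f := fun i => ‖R i j‖ ^ 2) (fun i _ => by positivity)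
    (Finset.mem_univ i)

/-- Along a convergent sequence in the cone the marginals are bounded, hence so are the factors of
`Xₙ = Rₙᴴ Rₙ`. A subsequence of the factors converges, and its limit `R₀` provides the feasible
matrix `R₀ᴴ R₀`. Closedness is what permits strict separation in `exists_dual`. -/
theorem isClosed_sdpCone (Q : Matrix (α × β) (α × β) ℂ) : IsClosed (sdpCone Q) := by
  refine IsSeqClosed.isClosed fun e e₀ he hlim => ?_
  choose X hX h1 h2 using he
  choose R hR using fun n => exists_eq_conjTranspose_mul_self_of_posSemidef (hX n)
  have hc : Continuous fun e : (β → β → ℂ) × ℝ => ∑ b, (e.1 b b).re := by fun_prop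
  obtain ⟨B, hB⟩ := ((hc.tendsto e₀).comp hlim).bddAbove_range
  have hB' : ∀ n i j, ‖R n i j‖ ≤ Real.sqrt B := fun n i j => by
    refine Real.le_sqrt_of_sq_le ((norm_sq_le_partialTrace (R n) i j).trans ?_)
    rw [← hR, h1]
    exact hB ⟨n, rfl⟩
  let R' : ℕ → (α × β → α × β → ℂ) := R
  have hmem : ∀ n, R' n ∈ Metric.closedBall (0 : α × β → α × β → ℂ) (Real.sqrt B) := by
    intro n
    rw [mem_closedBall_zero_iff, pi_norm_le_iff_of_nonneg (Real.sqrt_nonneg _)]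
    intro i
    rw [pi_norm_le_iff_of_nonneg (Real.sqrt_nonneg _)]
    exact hB' n i
  obtain ⟨R₀, -, φ, hφ, hRlim⟩ := (isCompact_closedBall _ _).tendsto_subseq hmem
  have hcont : Continuous fun R : α × β → α × β → ℂ =>
      ((Matrix.of R)ᴴ * Matrix.of R : Matrix (α × β) (α × β) ℂ) := by
    refine Continuous.matrix_mul (Continuous.matrix_conjTranspose ?_) ?_ <;> exact continuous_id
  have hXlim := (hcont.tendsto R₀).comp hRlim
  have hlim' := hlim.comp hφ.tendsto_atTop
  refine ⟨(Matrix.of R₀)ᴴ * Matrix.of R₀, posSemidef_conjTranspose_mul_self _, ?_, ?_⟩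
  · have hp : Continuous fun X : Matrix (α × β) (α × β) ℂ => partialTrace X := by
      unfold partialTrace
      fun_prop
    refine tendsto_nhds_unique ((hp.tendsto _).comp hXlim) ?_
    refine Filter.Tendsto.congr (fun n => ?_) ((continuous_fst.tendsto _).comp hlim')
    simp only [Function.comp_apply]
    rw [← h1, hR]
    rfl
  · have hq : Continuous fun X : Matrix (α × β) (α × β) ℂ => (Q * X).trace.re :=
      Complex.continuous_re.comp (Continuous.matrix_trace (continuous_const.matrix_mul continuous_id))
    refine le_of_tendsto_of_tendsto' ((continuous_snd.tendsto _).comp hlim')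
      ((hq.tendsto _).comp hXlim) fun n => ?_
    simp only [Function.comp_apply]
    refine (h2 _).trans_eq ?_
    rw [hR]
    rfl

theorem trace_mul_vecMulVec_star (Q : Matrix (α × β) (α × β) ℂ) (ξ : α × β → ℂ) :
    (Q * vecMulVec ξ (star ξ)).trace = star ξ ⬝ᵥ (Q *ᵥ ξ) := by
  rw [mul_vecMulVec, trace_vecMulVec, dotProduct_comm]

/-- A real functional on matrices is the trace against a Hermitian matrix, as far as partial
traces of rank-one operators are concerned. -/
theorem exists_hermitian_of_functional (g : (β → β → ℂ) →ₗ[ℝ] ℝ) :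
    ∃ Z : Matrix β β ℂ, Z.IsHermitian ∧ ∀ ξ : α × β → ℂ,
      (star ξ ⬝ᵥ (((1 : Matrix α α ℂ) ⊗ₖ Z) *ᵥ ξ)).re =
        g (partialTrace (vecMulVec ξ (star ξ))) := by
  let E : β → β → ℂ → (β → β → ℂ) := fun b b' m => Pi.single b (Pi.single b' m)
  -- `g` is only real linear. Its values at `1` and `I` in each entry are combined so that `g M` is
  -- the real part of `tr (M Z₀)`; the sign comes from `I * I = -1`.
  let Z₀ : Matrix β β ℂ := Matrix.of fun b' b => (g (E b b' 1) : ℂ) - Complex.I * g (E b b' Complex.I)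
  have hE : ∀ b b' (m : ℂ), g (E b b' m) = (m * Z₀ b' b).re := by
    intro b b' m
    have : E b b' m = m.re • E b b' 1 + m.im • E b b' Complex.I := by
      simp only [E, ← Pi.single_smul, ← Pi.single_add]
      congr 2
      apply Complex.ext <;> simp
    rw [this, map_add, map_smul, map_smul]
    simp [Z₀]
  have hg : ∀ M : β → β → ℂ, g M = ∑ b, ∑ b', (M b b' * Z₀ b' b).re := by
    intro M
    have : M = ∑ b, ∑ b', E b b' (M b b') := by
      funext b b'
      simp only [Finset.sum_apply, E]
      rw [Finset.sum_eq_single b (fun c _ hc => by simp [Pi.single_eq_of_ne hc.symm]) (by simp),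
        Finset.sum_eq_single b' (fun c _ hc => by simp [Pi.single_eq_of_ne hc.symm]) (by simp)]
      simp
    conv_lhs => rw [this]
    simp only [map_sum, hE]
  have hval : ∀ (Y : Matrix β β ℂ) (ξ : α × β → ℂ),
      star ξ ⬝ᵥ (((1 : Matrix α α ℂ) ⊗ₖ Y) *ᵥ ξ) =
        ∑ b, ∑ b', partialTrace (vecMulVec ξ (star ξ)) b b' * Y b' b := by
    intro Y ξ
    simp only [dotProduct, mulVec, partialTrace, vecMulVec_apply, Fintype.sum_prod_type,
      kroneckerMap_apply, Matrix.one_apply, Pi.star_apply, Finset.sum_mul, Finset.mul_sum, ite_mul,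
      one_mul, zero_mul, mul_ite, mul_zero]
    simp only [Finset.sum_ite_irrel, Finset.sum_const_zero, Finset.sum_ite_eq,
      Finset.mem_univ, if_true]
    rw [Finset.sum_comm]
    rw [Finset.sum_congr rfl fun b' _ => Finset.sum_comm]
    rw [Finset.sum_comm]
    refine Finset.sum_congr rfl fun b _ => Finset.sum_congr rfl fun b' _ =>
      Finset.sum_congr rfl fun a _ => by ring
  -- Replacing `Z₀` by its Hermitian part does not change the real part of the trace against
  -- Hermitian matrices, such as the partial traces considered here.
  refine ⟨(2⁻¹ : ℝ) • (Z₀ + Z₀ᴴ), ?_, fun ξ => ?_⟩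
  · rw [IsHermitian, conjTranspose_smul, conjTranspose_add, conjTranspose_conjTranspose,
      add_comm, star_trivial]
  · rw [hval, hg, Complex.re_sum]
    have hsym : ∀ b b', partialTrace (vecMulVec ξ (star ξ)) b' b =
        star (partialTrace (vecMulVec ξ (star ξ)) b b') := by
      intro b b'
      simp [partialTrace, vecMulVec_apply, mul_comm]
    simp only [Complex.re_sum]
    set p := partialTrace (vecMulVec ξ (star ξ))
    have h1 : ∑ b, ∑ b', (p b b' * star (Z₀ b b')).re = ∑ b, ∑ b', (p b b' * Z₀ b' b).re := by
      rw [Finset.sum_comm]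
      refine Finset.sum_congr rfl fun b _ => Finset.sum_congr rfl fun b' _ => ?_
      rw [hsym b b', ← star_mul', Complex.star_def, Complex.conj_re]
    have h2 : ∀ b b', (p b b' * ((2⁻¹ : ℝ) • (Z₀ + Z₀ᴴ)) b' b).re =
        2⁻¹ * (p b b' * Z₀ b' b).re + 2⁻¹ * (p b b' * star (Z₀ b b')).re := by
      intro b b'
      rw [Matrix.smul_apply, Matrix.add_apply, conjTranspose_apply, mul_smul_comm, Complex.smul_re,
        mul_add, Complex.add_re, smul_eq_mul, mul_add]
    simp only [h2, Finset.sum_add_distrib, ← Finset.mul_sum, h1]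
    ring

/-- Approximate strong duality for the semidefinite program of a single prover. -/
theorem exists_dual (ψ : α × β → ℂ) {Q : Matrix (α × β) (α × β) ℂ} (hQ : Q.IsHermitian) {s : ℝ}
    (h : ∀ R : Matrix (α × β) (α × β) ℂ,
      partialTrace (Rᴴ * R) = partialTrace (vecMulVec ψ (star ψ)) → (Q * (Rᴴ * R)).trace.re ≤ s)
    {ε : ℝ} (hε : 0 < ε) :
    ∃ Z : Matrix β β ℂ, ((1 : Matrix α α ℂ) ⊗ₖ Z - Q).PosSemidef ∧
      (star ψ ⬝ᵥ (((1 : Matrix α α ℂ) ⊗ₖ Z) *ᵥ ψ)).re ≤ s + ε := by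
  -- Over the marginal of `ψ`, the second coordinate in the cone is at most `s` by hypothesis; the
  -- slack `ε` puts the point outside the cone.
  have hnot : (partialTrace (vecMulVec ψ (star ψ)), s + ε) ∉ sdpCone Q := by
    rintro ⟨X, hX, h1, h2⟩
    obtain ⟨R, rfl⟩ := exists_eq_conjTranspose_mul_self_of_posSemidef hX
    have := h R h1
    simp only at h2
    linarith
  obtain ⟨f, u, hf, hu⟩ := geometric_hahn_banach_closed_point (convex_sdpCone Q)
    (isClosed_sdpCone Q) hnot
  have hsplit : ∀ (M : β → β → ℂ) (r : ℝ), f (M, r) = f (M, 0) + r * f (0, 1) := by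
    intro M r
    have : ((M, r) : (β → β → ℂ) × ℝ) = (M, 0) + r • ((0, 1) : (β → β → ℂ) × ℝ) := by simp
    rw [this, map_add, map_smul, smul_eq_mul]
  have hzero : (0 : (β → β → ℂ) × ℝ) ∈ sdpCone Q :=
    ⟨0, PosSemidef.zero, by funext b b'; simp [partialTrace], by simp⟩
  have hu0 : 0 < u := by simpa using hf 0 hzero
  -- A functional bounded above on a cone is nonpositive there: otherwise a multiple of `e` would
  -- attain the value `u`.
  have hneg : ∀ e ∈ sdpCone Q, f e ≤ 0 := by
    intro e he
    by_contra! hpos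
    have := hf ((u / f e) • e) (sdpCone_smul (by positivity) he)
    rw [map_smul, smul_eq_mul, div_mul_cancel₀ _ hpos.ne'] at this
    exact lt_irrefl _ this
  have hrank : ∀ (ξ : α × β → ℂ) (t : ℝ), t ≤ (star ξ ⬝ᵥ (Q *ᵥ ξ)).re →
      (partialTrace (vecMulVec ξ (star ξ)), t) ∈ sdpCone Q := fun ξ t ht =>
    ⟨_, posSemidef_vecMulVec_self_star ξ, rfl, by rw [trace_mul_vecMulVec_star]; exact ht⟩
  set μ := f (0, 1)
  -- The second coordinate can be lowered within the cone, so `μ ≥ 0`. If `μ = 0`, then `f` would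
  -- ignore that coordinate and take the same value at the excluded point (above `u > 0`) and at the
  -- point of the cone given by `ψ` itself (at most `0`).
  have hμ : 0 < μ := by
    have h0 : 0 ≤ μ := by
      have := hneg (0, -1) ⟨0, PosSemidef.zero, by funext b b'; simp [partialTrace], by simp⟩
      rw [hsplit, Prod.mk_zero_zero, map_zero] at this
      linarith
    refine h0.lt_of_ne fun hμ0 => ?_
    have h1 := hneg _ (hrank ψ _ le_rfl)
    rw [hsplit, ← hμ0, mul_zero, add_zero] at h1
    rw [hsplit, ← hμ0, mul_zero, add_zero] at hu
    linarith
  -- The dual variable is the separating functional on marginals, normalized by `μ` and with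
  -- opposite sign. Nonpositivity on rank-one elements of the cone becomes feasibility of `Z`, and
  -- positivity at the excluded point becomes the bound on its value.
  obtain ⟨Z, hZ, hval⟩ := exists_hermitian_of_functional (α := α)
    ((-μ⁻¹) • (f.toLinearMap ∘ₗ LinearMap.inl ℝ (β → β → ℂ) ℝ))
  have hval' : ∀ ξ : α × β → ℂ, (star ξ ⬝ᵥ (((1 : Matrix α α ℂ) ⊗ₖ Z) *ᵥ ξ)).re =
      -μ⁻¹ * f (partialTrace (vecMulVec ξ (star ξ)), 0) := fun ξ => by
    rw [hval]; simp
  refine ⟨Z, ?_, ?_⟩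
  · have hH : ((1 : Matrix α α ℂ) ⊗ₖ Z - Q).IsHermitian :=
      IsHermitian.sub (by rw [IsHermitian, conjTranspose_kronecker, conjTranspose_one, hZ.eq]) hQ
    refine PosSemidef.of_dotProduct_mulVec_nonneg hH fun ξ => ?_
    rw [Complex.nonneg_iff]
    refine ⟨?_, ?_⟩
    · rw [sub_mulVec, dotProduct_sub, Complex.sub_re, hval', sub_nonneg]
      have := hneg _ (hrank ξ _ le_rfl)
      rw [hsplit] at this
      rw [neg_mul, ← mul_neg, inv_mul_eq_div, le_div_iff₀ hμ]
      linarith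
    · exact (hH.im_star_dotProduct_mulVec_self ξ).symm
  · rw [hval', neg_mul, ← mul_neg, inv_mul_eq_div, div_le_iff₀ hμ]
    rw [hsplit] at hu
    linarith

end Duality

end ShortQuantumGames

namespace ShortQuantumGames

open Matrix
open scoped ComplexOrder Kronecker

/-! ### Unitary equivalence of purifications -/

theorem norm_sq_toEuclideanLin {ι β : Type*} [Fintype ι] [Fintype β] [DecidableEq β]
    (M : Matrix ι β ℂ) (v : EuclideanSpace ℂ β) :
    ((‖Matrix.toEuclideanLin M v‖ ^ 2 : ℝ) : ℂ) = star v.ofLp ⬝ᵥ ((Mᴴ * M) *ᵥ v.ofLp) := by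
  rw [← Matrix.mulVec_mulVec, Matrix.dotProduct_mulVec, Matrix.vecMul_conjTranspose, star_star,
    EuclideanSpace.norm_sq_eq, dotProduct]
  push_cast
  refine Finset.sum_congr rfl fun i _ => ?_
  rw [Pi.star_apply, Complex.star_def, ← Complex.normSq_eq_conj_mul_self,
    Complex.normSq_eq_norm_sq]
  simp [Matrix.toLpLin_apply]

/-- The hypothesis says that `M v ↦ N v` preserves norms. It is therefore a well-defined isometry on
the range of `M`, and an isometry from a subspace of a finite-dimensional space into that space
extends to a unitary. For purifications written as matrices, the hypothesis is equality of
marginals. -/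
theorem exists_unitary_of_conjTranspose_mul_self_eq {ι β : Type*} [Fintype ι] [DecidableEq ι]
    [Fintype β] [DecidableEq β] (M N : Matrix ι β ℂ) (h : Mᴴ * M = Nᴴ * N) :
    ∃ U ∈ Matrix.unitaryGroup ι ℂ, U * M = N := by
  let f := Matrix.toEuclideanLin M
  let g := Matrix.toEuclideanLin N
  have hnorm : ∀ v, ‖f v‖ = ‖g v‖ := fun v => by
    have := (norm_sq_toEuclideanLin M v).trans
      ((congrArg (fun X : Matrix β β ℂ => star v.ofLp ⬝ᵥ (X *ᵥ v.ofLp)) h).trans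
        (norm_sq_toEuclideanLin N v).symm)
    exact (sq_eq_sq₀ (norm_nonneg _) (norm_nonneg _)).1 (Complex.ofReal_injective this)
  have hker : LinearMap.ker f ≤ LinearMap.ker g := fun v hv => by
    rw [LinearMap.mem_ker] at hv ⊢
    rw [← norm_eq_zero, ← hnorm, hv, norm_zero]
  let L₀ : LinearMap.range f →ₗ[ℂ] EuclideanSpace ℂ ι :=
    (LinearMap.ker f).liftQ g hker ∘ₗ f.quotKerEquivRange.symm.toLinearMap
  have hL₀ : ∀ v, L₀ ⟨f v, LinearMap.mem_range_self f v⟩ = g v := fun v => by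
    have : f.quotKerEquivRange.symm ⟨f v, LinearMap.mem_range_self f v⟩ =
        Submodule.Quotient.mk v := by
      rw [LinearEquiv.symm_apply_eq]
      rfl
    simp only [L₀, LinearMap.comp_apply, LinearEquiv.coe_coe, this]
    rfl
  let L : LinearMap.range f →ₗᵢ[ℂ] EuclideanSpace ℂ ι :=
    { toLinearMap := L₀
      norm_map' := by
        rintro ⟨_, v, rfl⟩
        rw [hL₀, ← hnorm]
        rfl }
  let V := L.extend
  have hV : ∀ v, V (f v) = g v := fun v =>
    (L.extend_apply ⟨f v, LinearMap.mem_range_self f v⟩).trans (hL₀ v)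
  let U := Matrix.toEuclideanLin.symm V.toLinearMap
  have hU : Matrix.toEuclideanLin U = V.toLinearMap := LinearEquiv.apply_symm_apply _ _
  refine ⟨U, ?_, ?_⟩
  · have hiso : Uᴴ * U = 1 := by
      have hadj : (V.toLinearMap).adjoint ∘ₗ V.toLinearMap = LinearMap.id := by
        refine LinearMap.ext fun v => ext_inner_right ℂ fun w => ?_
        rw [LinearMap.comp_apply, LinearMap.adjoint_inner_left]
        exact V.inner_map_map v w
      apply Matrix.toEuclideanLin.injective
      rw [Matrix.toLpLin_mul_same, Matrix.toEuclideanLin_conjTranspose_eq_adjoint, hU, hadj,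
        Matrix.toLpLin_one]
    rw [Matrix.mem_unitaryGroup_iff', Matrix.star_eq_conjTranspose, hiso]
  · apply Matrix.toEuclideanLin.injective
    rw [Matrix.toLpLin_mul_same, hU]
    exact LinearMap.ext hV

end ShortQuantumGames

namespace ShortQuantumGames

open Matrix
open scoped ComplexOrder Kronecker

/-! ### The dual operator of a game against a single prover -/

section SingleProver

/-- The projection onto the states whose qubit `o` has the value `bit`. -/
noncomputable def outcomeProj {C : Type} [Fintype C] [DecidableEq C] (o : C) (bit : Bool) : Op C :=
  Matrix.diagonal fun x => if x o = bit then 1 else 0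

theorem outcomeProj_posSemidef {C : Type} [Fintype C] [DecidableEq C] (o : C) (bit : Bool) :
    (outcomeProj o bit).PosSemidef := by
  refine PosSemidef.diagonal fun x => ?_
  simp only [Pi.zero_apply]
  split_ifs
  · exact zero_le_one
  · exact le_rfl

theorem re_trace_diagonal_mul_mul_conjTranspose {ι κ : Type*} [Fintype ι] [DecidableEq ι]
    [Fintype κ] (d : ι → ℝ) (Y : Matrix ι κ ℂ) :
    (Matrix.trace (Matrix.diagonal (fun i => (d i : ℂ)) * (Y * Yᴴ))).re =
      ∑ i, ∑ r, d i * ‖Y i r‖ ^ 2 := by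
  rw [trace, Complex.re_sum]
  refine Finset.sum_congr rfl fun i _ => ?_
  rw [diag_apply, diagonal_mul, Complex.re_ofReal_mul, mul_apply, Complex.re_sum, Finset.mul_sum]
  refine Finset.sum_congr rfl fun r _ => ?_
  rw [conjTranspose_apply, Complex.star_def, Complex.mul_conj, Complex.normSq_eq_norm_sq,
    Complex.ofReal_re]

variable {A B C : Type} [Fintype A] [DecidableEq A] [Fintype B] [DecidableEq B]
  [Fintype C] [DecidableEq C]

/-- Assignments of `C` as pairs of assignments of two complementary sets of qubits. -/
noncomputable def splitEquiv (a : A ↪ C) (b : B ↪ C)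
    (hab : IsCompl (Set.range a) (Set.range b)) : (C → Bool) ≃ (A → Bool) × (B → Bool) where
  toFun x := (x ∘ a, x ∘ b)
  invFun u := Function.extend a u.1 (Function.extend b u.2 fun _ => false)
  left_inv x := by
    funext w
    by_cases hw : w ∈ Set.range a
    · obtain ⟨i, rfl⟩ := hw
      exact a.injective.extend_apply _ _ i
    · have hw' : w ∈ (Set.range a)ᶜ := hw
      rw [hab.compl_eq] at hw'
      obtain ⟨i, rfl⟩ := hw'
      exact (extend_off a _ _ hw).trans (b.injective.extend_apply _ _ i)
  right_inv u := by
    refine Prod.ext (extend_comp_embedding a _ _) ?_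
    funext i
    have : b i ∉ Set.range a := fun h => Set.disjoint_left.1 hab.disjoint h ⟨i, rfl⟩
    simp only [Function.comp_apply]
    rw [extend_off a _ _ this, b.injective.extend_apply]

theorem lift_eq_submatrix_kronecker (a : A ↪ C) (b : B ↪ C)
    (hab : IsCompl (Set.range a) (Set.range b)) (Z : Op B) :
    lift b Z = ((1 : Op A) ⊗ₖ Z).submatrix (splitEquiv a b hab) (splitEquiv a b hab) := by
  ext x y
  rw [submatrix_apply, kroneckerMap_apply]
  have hcov : ∀ w, w ∉ Set.range b → w ∈ Set.range a := fun w hw => by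
    have hw' : w ∈ (Set.range b)ᶜ := hw
    rwa [hab.symm.compl_eq] at hw'
  change lift b Z x y = (1 : Op A) (x ∘ a) (y ∘ a) * Z (x ∘ b) (y ∘ b)
  by_cases h : x ∘ a = y ∘ a
  · rw [h, Matrix.one_apply_eq, one_mul, lift_apply_of_eq_off]
    intro w hw
    obtain ⟨i, rfl⟩ := hcov w hw
    exact congrFun h i
  · rw [Matrix.one_apply_ne h, zero_mul, lift_apply_of_ne_off]
    intro h'
    refine h (funext fun i => h' _ fun hi => ?_)
    exact Set.disjoint_left.1 hab.disjoint ⟨i, rfl⟩ hi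

/-- The probability of the outcome `bit` on the qubit `o` of `M |0⟩`. -/
noncomputable def vacuumProb {W : Type} [Fintype W] [DecidableEq W] (o : W) (bit : Bool)
    (M : Op W) : ℝ :=
  ∑ z : W → Bool, if z o = bit then ‖M z fun _ => false‖ ^ 2 else 0

/-- No strategy of a player acting on the qubits `a` of the state `P |0⟩` makes the outcome `bit`
on the qubit `o` after the operator `T` more likely than `s`. -/
def PlayerBound (a : A ↪ C) (T P : Op C) (o : C) (bit : Bool) (s : ℝ) : Prop :=
  ∀ (p : ℕ) (U : Op (A ⊕ Fin p)), U ∈ Matrix.unitaryGroup (A ⊕ Fin p → Bool) ℂ →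
    vacuumProb (Sum.inl o) bit (lift (Function.Embedding.inl : C ↪ C ⊕ Fin p) T *
      lift (a.sumMap (Function.Embedding.refl (Fin p))) U *
        lift (Function.Embedding.inl : C ↪ C ⊕ Fin p) P) ≤ s

/-- The state is reshaped into a matrix whose rows are the qubits of the player, including the
private ones, and whose columns are the qubits out of reach. The move of the player then becomes
left multiplication, as in `exists_unitary_of_conjTranspose_mul_self_eq`. -/
theorem sumMap_apply_lift (a : A ↪ C) (b : B ↪ C)
    (hab : IsCompl (Set.range a) (Set.range b)) {p : ℕ} (U : Op (A ⊕ Fin p)) (P : Op C)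
    (z : C ⊕ Fin p → Bool) :
    (lift (a.sumMap (Function.Embedding.refl (Fin p))) U *
        lift (Function.Embedding.inl : C ↪ C ⊕ Fin p) P) z (fun _ => false) =
      (U * Matrix.of fun (u : A ⊕ Fin p → Bool) (v : B → Bool) =>
        if u ∘ Sum.inr = fun _ => false then
          P ((splitEquiv a b hab).symm (u ∘ Sum.inl, v)) (fun _ => false) else 0)
        (Sum.elim (z ∘ Sum.inl ∘ a) (z ∘ Sum.inr)) (z ∘ Sum.inl ∘ b) := by
  rw [lift_mul_apply, Matrix.mul_apply]
  refine Finset.sum_congr rfl fun u _ => ?_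
  congr 1
  · congr 1
    funext i
    rcases i with i | i <;> rfl
  · have hr : ∀ r : Fin p,
        Function.extend (a.sumMap (Function.Embedding.refl (Fin p))) u z (Sum.inr r) =
          u (Sum.inr r) := fun r =>
      (a.sumMap (Function.Embedding.refl (Fin p))).injective.extend_apply u z (Sum.inr r)
    have hl : Function.extend (a.sumMap (Function.Embedding.refl (Fin p))) u z ∘ Sum.inl =
        (splitEquiv a b hab).symm (u ∘ Sum.inl, z ∘ Sum.inl ∘ b) := by
      rw [Equiv.eq_symm_apply]
      refine Prod.ext ?_ ?_
      · funext i
        exact (a.sumMap (Function.Embedding.refl (Fin p))).injective.extend_apply u z (Sum.inl i)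
      · funext i
        refine extend_off (a.sumMap (Function.Embedding.refl (Fin p))) u z ?_
        rintro ⟨i' | i', hi⟩
        · exact Set.disjoint_left.1 hab.disjoint ⟨i', Sum.inl.inj hi⟩ ⟨i, rfl⟩
        · cases hi
    rw [Matrix.of_apply, ← hl]
    by_cases h : u ∘ Sum.inr = fun _ => false
    · rw [if_pos h, lift_apply_of_eq_off]
      · rfl
      · rintro (w | r) hw
        · exact absurd ⟨w, rfl⟩ hw
        · rw [hr]; exact congrFun h r
    · rw [if_neg h, lift_apply_of_ne_off]
      intro h'
      refine h (funext fun r => ?_)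
      rw [Function.comp_apply, ← hr]
      exact h' (Sum.inr r) (by rintro ⟨w, hw⟩; cases hw)

/-- If no strategy of a prover acting on the qubits `a` makes the outcome `bit` more likely
than `s`, then there is a dual feasible operator on the remaining qubits of almost that value. -/
theorem exists_dual_of_game (a : A ↪ C) (b : B ↪ C)
    (hab : IsCompl (Set.range a) (Set.range b)) (T P : Op C) (o : C) (bit : Bool) {s : ℝ}
    (h : PlayerBound a T P o bit s)
    {ε : ℝ} (hε : 0 < ε) :
    ∃ Z : Op B, (lift b Z - Tᴴ * outcomeProj o bit * T).PosSemidef ∧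
      ((Pᴴ * lift b Z * P) (fun _ => false) (fun _ => false)).re ≤ s + ε := by
  set Φ := splitEquiv a b hab with hΦ
  set Q : Op C := Tᴴ * outcomeProj o bit * T with hQ
  have hQpsd : Q.PosSemidef := (outcomeProj_posSemidef o bit).conjTranspose_mul_mul_same T
  let ψ : (A → Bool) × (B → Bool) → ℂ := fun u => P (Φ.symm u) fun _ => false
  have key : ∀ R : Matrix ((A → Bool) × (B → Bool)) ((A → Bool) × (B → Bool)) ℂ,
      partialTrace (Rᴴ * R) = partialTrace (vecMulVec ψ (star ψ)) →
        (Q.submatrix Φ.symm Φ.symm * (Rᴴ * R)).trace.re ≤ s := by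
    intro R hR
    -- The private qubits of the player have to index the rows of `R`, so as many of them as there
    -- are qubits in `C` suffice.
    let p := Fintype.card C
    let e : (Fin p → Bool) ≃ (A → Bool) × (B → Bool) :=
      ((Fintype.equivFin C).arrowCongr (Equiv.refl Bool)).symm.trans Φ
    -- `M` is the state before the move, with private qubits at zero. `N` is the state to be
    -- reached: a purification of `Rᴴ * R` by the private qubits.
    let M : Matrix (A ⊕ Fin p → Bool) (B → Bool) ℂ := Matrix.of fun u v =>
      if u ∘ Sum.inr = fun _ => false then ψ (u ∘ Sum.inl, v) else 0
    let N : Matrix (A ⊕ Fin p → Bool) (B → Bool) ℂ := Matrix.of fun u v =>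
      star (R (e (u ∘ Sum.inr)) (u ∘ Sum.inl, v))
    -- This is the equality of partial traces, with the two indices exchanged.
    have hMN : Mᴴ * M = Nᴴ * N := by
      ext b' b
      have hb := congrFun (congrFun hR b) b'
      rw [mul_apply, mul_apply, ← (Equiv.sumArrowEquivProdArrow A (Fin p) Bool).symm.sum_comp,
        ← (Equiv.sumArrowEquivProdArrow A (Fin p) Bool).symm.sum_comp, Fintype.sum_prod_type,
        Fintype.sum_prod_type]
      have h1 : ∀ x : (A → Bool) × (Fin p → Bool),
          ((Equiv.sumArrowEquivProdArrow A (Fin p) Bool).symm x ∘ Sum.inl : A → Bool) = x.1 :=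
        fun x => rfl
      have h2 : ∀ x : (A → Bool) × (Fin p → Bool),
          ((Equiv.sumArrowEquivProdArrow A (Fin p) Bool).symm x ∘ Sum.inr : Fin p → Bool) = x.2 :=
        fun x => rfl
      simp only [conjTranspose_apply, M, N, of_apply, h1, h2]
      have h3 : ∀ x : A → Bool, (∑ r : Fin p → Bool,
          (star (if r = fun _ => false then ψ (x, b') else 0) *
            if r = fun _ => false then ψ (x, b) else 0)) = ψ (x, b) * star (ψ (x, b')) := by
        intro x
        rw [Finset.sum_eq_single fun _ => false]
        · simp [mul_comm]
        · intro r _ hr; simp [hr]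
        · simp
      simp only [h3]
      simp only [partialTrace, vecMulVec_apply, Pi.star_apply, mul_apply, conjTranspose_apply] at hb
      rw [← hb]
      refine Finset.sum_congr rfl fun x _ => ?_
      rw [← e.sum_comp]
      refine Finset.sum_congr rfl fun r _ => ?_
      rw [star_star, mul_comm]
    obtain ⟨U, hU, hUM⟩ := exists_unitary_of_conjTranspose_mul_self_eq M N hMN
    refine le_of_eq_of_le ?_ (h p U hU)
    -- The amplitudes of `N` regrouped, with all of `C` as rows and the private qubits as columns,
    -- so that `Ξ * Ξᴴ` is `Rᴴ * R` up to relabelling.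
    let Ξ : Matrix (C → Bool) (Fin p → Bool) ℂ := Matrix.of fun y r => star (R (e r) (Φ y))
    have hamp : ∀ z : C ⊕ Fin p → Bool,
        (lift (Function.Embedding.inl : C ↪ C ⊕ Fin p) T *
          lift (a.sumMap (Function.Embedding.refl (Fin p))) U *
          lift (Function.Embedding.inl : C ↪ C ⊕ Fin p) P) z (fun _ => false) =
        (T * Ξ) (z ∘ Sum.inl) (z ∘ Sum.inr) := by
      intro z
      rw [mul_assoc, lift_mul_apply, Matrix.mul_apply]
      refine Finset.sum_congr rfl fun y _ => ?_
      congr 1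
      rw [sumMap_apply_lift a b hab]
      have : (Function.extend (Function.Embedding.inl : C ↪ C ⊕ Fin p) y z) = Sum.elim y (z ∘ Sum.inr) := by
        funext w
        rcases w with w | w
        · exact (Function.Embedding.inl : C ↪ C ⊕ Fin p).injective.extend_apply y z w
        · exact extend_off (Function.Embedding.inl : C ↪ C ⊕ Fin p) y z (by rintro ⟨i, hi⟩; cases hi)
      rw [this]
      exact congrFun (congrFun hUM _) _
    have hR' : Q.submatrix Φ.symm Φ.symm * (Rᴴ * R) =
        (Q * (Ξ * Ξᴴ)).submatrix Φ.symm Φ.symm := by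
      rw [submatrix_mul_equiv (e₂ := Φ.symm) (M := Q) (N := Ξ * Ξᴴ) Φ.symm Φ.symm |>.symm]
      congr 1
      ext u v
      rw [submatrix_apply, mul_apply, mul_apply, ← e.sum_comp]
      simp [Ξ, conjTranspose_apply]
    rw [hR']
    have htr : ((Q * (Ξ * Ξᴴ)).submatrix Φ.symm Φ.symm).trace =
        (outcomeProj o bit * ((T * Ξ) * (T * Ξ)ᴴ)).trace := by
      have h1 : ((Q * (Ξ * Ξᴴ)).submatrix Φ.symm Φ.symm).trace = (Q * (Ξ * Ξᴴ)).trace :=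
        Φ.symm.sum_comp fun x => (Q * (Ξ * Ξᴴ)) x x
      rw [h1, hQ, conjTranspose_mul, mul_assoc, mul_assoc, trace_mul_comm]
      simp only [Matrix.mul_assoc]
    rw [htr]
    have hd := re_trace_diagonal_mul_mul_conjTranspose
      (fun x : C → Bool => if x o = bit then (1 : ℝ) else 0) (T * Ξ)
    have hd' : (outcomeProj o bit : Op C) =
        Matrix.diagonal (fun x : C → Bool => ((if x o = bit then (1 : ℝ) else 0 : ℝ) : ℂ)) := by
      unfold outcomeProj
      congr 1
      funext x
      split_ifs <;> simp
    rw [hd', hd, vacuumProb, ← (Equiv.sumArrowEquivProdArrow C (Fin p) Bool).symm.sum_comp,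
      Fintype.sum_prod_type]
    refine Finset.sum_congr rfl fun x _ => Finset.sum_congr rfl fun r _ => ?_
    rw [hamp, ite_mul, one_mul, zero_mul]
    rfl
  have hQ' : (Q.submatrix Φ.symm Φ.symm).IsHermitian := hQpsd.isHermitian.submatrix _
  obtain ⟨Z, hZ, hval⟩ := exists_dual ψ hQ' key hε
  refine ⟨Z, ?_, ?_⟩
  · have := hZ.submatrix Φ
    rw [submatrix_sub] at this
    rw [lift_eq_submatrix_kronecker a b hab]
    simpa using this
  · refine le_of_eq_of_le ?_ hval
    congr 1
    rw [lift_eq_submatrix_kronecker a b hab, mul_assoc, mul_apply, dotProduct, ← Φ.symm.sum_comp]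
    refine Finset.sum_congr rfl fun u _ => ?_
    rw [conjTranspose_apply, mul_apply, mulVec, dotProduct, ← Φ.symm.sum_comp]
    simp [ψ, hΦ]

end SingleProver

end ShortQuantumGames

namespace ShortQuantumGames

open Matrix
open scoped ComplexOrder

/-! ### Repeated games -/

section Repetition

variable {ι A B C W : Type} [Fintype A] [DecidableEq A] [Fintype B] [DecidableEq B]
  [Fintype C] [DecidableEq C] [Fintype W] [DecidableEq W]

/-- The outcome is prescribed only in the copies of `S`. Since the operator is diagonal, its
expectation is the probability that all these copies show the outcome. -/
theorem tens_outcomeProj (l : List ι) (c : ι → C ↪ W) (S : ι → Prop) [DecidablePred S] (o : C)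
    (bit : Bool) :
    tens l c (fun i => if S i then outcomeProj o bit else 1) =
      Matrix.diagonal fun z => if ∀ i ∈ l, S i → z (c i o) = bit then (1 : ℂ) else 0 := by
  induction l with
  | nil => simp [tens_nil]
  | cons i l ih =>
    have h1 : lift (c i) (if S i then outcomeProj o bit else 1) =
        Matrix.diagonal fun z => if S i → z (c i o) = bit then (1 : ℂ) else 0 := by
      split_ifs with hS
      · rw [outcomeProj, lift_diagonal]
        simp [hS]
      · simp [hS, lift_one]
    rw [tens_cons, ih, h1, diagonal_mul_diagonal]
    congr 1
    funext z
    simp only [List.forall_mem_cons]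
    split_ifs <;> simp_all

theorem conjTranspose_mul_diagonal_mul_apply {κ : Type*} [Fintype κ] [DecidableEq κ]
    (M : Matrix κ κ ℂ) (p : κ → Prop) [DecidablePred p] (i : κ) :
    (Mᴴ * Matrix.diagonal (fun z => if p z then (1 : ℂ) else 0) * M) i i =
      ((∑ z, if p z then ‖M z i‖ ^ 2 else 0 : ℝ) : ℂ) := by
  rw [Matrix.mul_apply]
  push_cast
  refine Finset.sum_congr rfl fun z _ => ?_
  rw [mul_diagonal, conjTranspose_apply]
  split_ifs
  · rw [mul_one, Complex.star_def, ← Complex.normSq_eq_conj_mul_self, Complex.normSq_eq_norm_sq]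
  · simp

/-- Nonnegativity in `ℂ` includes a vanishing imaginary part, so bounds on real parts are bounds in
the complex order and can be multiplied. -/
theorem prod_map_ite_le {l : List ι} {S : ι → Prop} [DecidablePred S] {v : ι → ℂ} {t : ℝ}
    (h0 : ∀ i, 0 ≤ v i) (h : ∀ i, (v i).re ≤ if S i then t else 1) :
    (l.map v).prod ≤ (((l.map fun i => if S i then t else 1).prod : ℝ) : ℂ) ∧
      0 ≤ (l.map v).prod := by
  induction l with
  | nil => simp
  | cons i l ih =>
    have hi : v i ≤ ((if S i then t else 1 : ℝ) : ℂ) := by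
      rw [Complex.le_def]
      refine ⟨by simpa using h i, ?_⟩
      rw [Complex.ofReal_im]
      exact (Complex.le_def.1 (h0 i)).2.symm
    rw [List.map_cons, List.map_cons, List.prod_cons, List.prod_cons, Complex.ofReal_mul]
    exact ⟨mul_le_mul hi ih.1 ih.2 ((h0 i).trans hi), mul_nonneg (h0 i) ih.2⟩

/-- Copies in `S` carry the pair of `Q = Tᴴ Π T` and its dual operator, the others the pair `(1,
1)`. The latter contribute a factor `1` because `T` and `P` are isometries. By `hUB` the joint
unitary commutes with every operator on the qubits out of reach, where the dual operators live, and
`vacuum_tens_le` applies. -/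
theorem repeated_game_le (a : A ↪ C) (b : B ↪ C) (hab : IsCompl (Set.range a) (Set.range b))
    {T P : Op C} (hT : Tᴴ * T = 1) (hP : Pᴴ * P = 1) (o : C) (bit : Bool) {s : ℝ}
    (h : PlayerBound a T P o bit s)
    {l : List ι} (hl : l.Nodup) {c : ι → C ↪ W}
    (hc : Pairwise fun i j => Disjoint (Set.range (c i)) (Set.range (c j)))
    {U : Op W} (hU : Uᴴ * U = 1) (hUB : ∀ i (X : Op B), Commute U (lift (b.trans (c i)) X))
    (S : ι → Prop) [DecidablePred S] :
    (∑ z : W → Bool, if ∀ i ∈ l, S i → z (c i o) = bit then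
        ‖(tens l c (fun _ => T) * (U * tens l c fun _ => P)) z fun _ => false‖ ^ 2 else 0) ≤
      (l.map fun i => if S i then s else 1).prod := by
  have key : ∀ ε > 0, (∑ z : W → Bool, if ∀ i ∈ l, S i → z (c i o) = bit then
        ‖(tens l c (fun _ => T) * (U * tens l c fun _ => P)) z fun _ => false‖ ^ 2 else 0) ≤
      (l.map fun i => if S i then s + ε else 1).prod := by
    intro ε hε
    obtain ⟨Z, hZ, hval⟩ := exists_dual_of_game a b hab T P o bit h hε
    have hQ : (Tᴴ * outcomeProj o bit * T).PosSemidef :=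
      (outcomeProj_posSemidef o bit).conjTranspose_mul_mul_same T
    have hZ0 : (lift b Z).PosSemidef := by simpa using hZ.add hQ
    have hmain := vacuum_tens_le hc hl
      (Q := fun i => if S i then Tᴴ * outcomeProj o bit * T else 1)
      (Z := fun i => if S i then lift b Z else 1)
      (fun i => by
        split_ifs
        · exact hQ
        · exact PosSemidef.one)
      (fun i => by
        split_ifs
        · exact hZ
        · rw [sub_self]; exact PosSemidef.zero) hU
      (fun i => by
        split_ifs
        · rw [lift_lift]; exact hUB i Z
        · rw [lift_one]; exact Commute.one_right _) (fun _ => P)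
    have hbound := (prod_map_ite_le (l := l) (S := S) (t := s + ε)
      (v := fun i => (Pᴴ * (if S i then lift b Z else 1) * P)
        (fun _ => false) (fun _ => false))
      (fun i => by
        split_ifs
        · exact (hZ0.conjTranspose_mul_mul_same P).diag_nonneg
        · exact (PosSemidef.one.conjTranspose_mul_mul_same P).diag_nonneg)
      (fun i => by
        split_ifs
        · exact hval
        · rw [mul_one, hP, Matrix.one_apply_eq, Complex.one_re])).1
    have hQT : tens l c (fun i => if S i then Tᴴ * outcomeProj o bit * T else 1) =
        (tens l c fun _ => T)ᴴ * tens l c (fun i => if S i then outcomeProj o bit else 1) *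
          tens l c fun _ => T := by
      rw [tens_conjTranspose hc hl, tens_mul hc hl, tens_mul hc hl]
      refine tens_congr fun i _ => ?_
      split_ifs
      · rfl
      · rw [mul_one, hT]
    have hre : (U * tens l c fun _ => P)ᴴ *
        tens l c (fun i => if S i then Tᴴ * outcomeProj o bit * T else 1) *
          (U * tens l c fun _ => P) =
        (tens l c (fun _ => T) * (U * tens l c fun _ => P))ᴴ *
          tens l c (fun i => if S i then outcomeProj o bit else 1) *
            (tens l c (fun _ => T) * (U * tens l c fun _ => P)) := by
      rw [hQT, conjTranspose_mul (tens l c fun _ => T)]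
      simp only [mul_assoc]
    have hfin := hmain.trans hbound
    rw [hre, tens_outcomeProj, conjTranspose_mul_diagonal_mul_apply] at hfin
    exact Complex.real_le_real.1 hfin
  -- Duality was obtained only up to `ε`; the bound for `s` itself is the limit of those for `s +
  -- ε`.
  have hcont : Filter.Tendsto (fun ε : ℝ => (l.map fun i => if S i then s + ε else 1).prod)
      (nhdsWithin 0 (Set.Ioi 0)) (nhds (l.map fun i => if S i then s else 1).prod) := by
    have : Continuous fun ε : ℝ => (l.map fun i => if S i then s + ε else 1).prod := by
      refine continuous_list_prod l fun i _ => ?_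
      split_ifs <;> fun_prop
    have h0 := (this.tendsto 0).mono_left (nhdsWithin_le_nhds (s := Set.Ioi (0 : ℝ)))
    simpa using h0
  exact ge_of_tendsto hcont (Filter.eventually_of_mem self_mem_nhdsWithin fun ε hε => key ε hε)

end Repetition

end ShortQuantumGames

namespace ShortQuantumGames

open Matrix
open scoped ComplexOrder

/-! ### Reversible classical computation -/

section Classical

variable {A W : Type} [Fintype A] [DecidableEq A] [Fintype W] [DecidableEq W]

/-- The operator `M` maps the basis state `z` to the basis state `z'`. -/
def Sends (M : Op W) (z z' : W → Bool) : Prop := ∀ x, M x z = if x = z' then 1 else 0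

theorem Sends.one (z : W → Bool) : Sends (1 : Op W) z z := fun _ => Matrix.one_apply

theorem Sends.mul {M N : Op W} {z z' z'' : W → Bool} (hN : Sends N z' z'') (hM : Sends M z z') :
    Sends (N * M) z z'' := fun x => by
  rw [Matrix.mul_apply, Finset.sum_eq_single z']
  · rw [hM, hN, if_pos rfl, mul_one]
  · intro y _ hy
    rw [hM, if_neg hy, mul_zero]
  · intro h
    exact absurd (Finset.mem_univ _) h

theorem Sends.lift (e : A ↪ W) {M : Op A} {z : W → Bool} {z' : A → Bool}
    (hM : Sends M (z ∘ e) z') : Sends (lift e M) z (Function.extend e z' z) := fun x => by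
  by_cases h : ∀ w, w ∉ Set.range e → x w = z w
  · rw [lift_apply_of_eq_off e M h, hM]
    refine if_congr ⟨fun h' => ?_, fun h' => ?_⟩ rfl rfl
    · rw [← h']
      have := eq_extend_of_eq_off e fun w hw => (h w hw).symm
      exact this
    · rw [h', extend_comp_embedding]
  · rw [lift_apply_of_ne_off e M h, if_neg]
    rintro rfl
    exact h fun w hw => extend_off e _ _ hw

/-- A unitary operator which permutes the basis states in the support of `Φ` transforms outcome
probabilities accordingly. -/
theorem sum_norm_sq_mul_of_sends {M N : Op W} (hM : Mᴴ * M = 1) (x₀ : W → Bool)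
    (g : (W → Bool) → W → Bool) (hg : ∀ z, N z x₀ ≠ 0 → Sends M z (g z))
    (p : (W → Bool) → Prop) [DecidablePred p] :
    (∑ x, if p x then ‖(M * N) x x₀‖ ^ 2 else 0) = ∑ z, if p (g z) then ‖N z x₀‖ ^ 2 else 0 := by
  classical
  let s : Finset (W → Bool) := Finset.univ.filter fun z => N z x₀ ≠ 0
  have hs : ∀ {z}, z ∈ s ↔ N z x₀ ≠ 0 := by simp [s]
  -- The columns of an isometry are orthonormal, so two basis states in the support cannot have the
  -- same image.
  have hinj : Set.InjOn g s := by
    intro z hz z' hz' h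
    by_contra hne
    have h1 := congrFun (congrFun hM z) z'
    rw [Matrix.one_apply_ne hne, Matrix.mul_apply, Finset.sum_eq_single (g z')] at h1
    · rw [conjTranspose_apply, hg z (hs.1 hz), hg z' (hs.1 hz'), if_pos rfl, if_pos h.symm] at h1
      simp at h1
    · intro x _ hx
      rw [hg z' (hs.1 hz'), if_neg hx, mul_zero]
    · intro h
      exact absurd (Finset.mem_univ _) h
  have hval : ∀ x, (M * N) x x₀ = ∑ z ∈ s, if x = g z then N z x₀ else 0 := by
    intro x
    rw [Matrix.mul_apply, ← Finset.sum_subset (Finset.subset_univ s)]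
    · refine Finset.sum_congr rfl fun z hz => ?_
      rw [hg z (hs.1 hz), ite_mul, one_mul, zero_mul]
    · intro z _ hz
      rw [hs, not_not] at hz
      rw [hz, mul_zero]
  rw [← Finset.sum_subset (Finset.subset_univ (s.image g)), Finset.sum_image hinj,
    ← Finset.sum_subset (Finset.subset_univ s)]
  · refine Finset.sum_congr rfl fun z hz => ?_
    rw [hval, Finset.sum_eq_single z, if_pos rfl]
    · intro z' hz' hne
      rw [if_neg]
      exact fun h => hne (hinj hz' hz h.symm)
    · exact fun h => absurd hz h
  · intro z _ hz
    rw [hs, not_not] at hz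
    simp [hz]
  · intro x _ hx
    rw [hval, Finset.sum_eq_zero]
    · simp
    · intro z hz
      rw [if_neg]
      rintro rfl
      exact hx (Finset.mem_image_of_mem g hz)

end Classical

/-- Circuits over `G` that implement the NOT gate and the Toffoli gate. -/
structure ClassicalGates (G : GateSet) where
  aN : ℕ
  aT : ℕ
  notC : Circuit G (Fin 1 ⊕ Fin aN)
  tofC : Circuit G (Fin 3 ⊕ Fin aT)
  not_spec : ∀ (x y : Fin 1 → Bool) (z : Fin aN → Bool),
    Circuit.op notC (Sum.elim x z) (Sum.elim y fun _ => false) =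
      if z = (fun _ => false) then notGate x y else 0
  tof_spec : ∀ (x y : Fin 3 → Bool) (z : Fin aT → Bool),
    Circuit.op tofC (Sum.elim x z) (Sum.elim y fun _ => false) =
      if z = (fun _ => false) then toffoliGate x y else 0

/-- An exact implementation is specified only on inputs whose ancillas are zero, hence the
assumption `hz`. On such inputs the column of the circuit is a basis vector, again with clean
ancillas. -/
theorem sends_of_implements {G : GateSet} {n a : ℕ} {C : Circuit G (Fin n ⊕ Fin a)}
    {f : (Fin n → Bool) → (Fin n → Bool)}
    (hC : ∀ (x y : Fin n → Bool) (z : Fin a → Bool),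
      Circuit.op C (Sum.elim x z) (Sum.elim y fun _ => false) =
        if z = (fun _ => false) then classicalOp f x y else 0)
    {W : Type} [Fintype W] [DecidableEq W] (e : Fin n ⊕ Fin a ↪ W) {z : W → Bool}
    (hz : ∀ j, z (e (Sum.inr j)) = false) :
    Sends (Circuit.op (C.rename e)) z
      (Function.extend e (Sum.elim (f (z ∘ e ∘ Sum.inl)) fun _ => false) z) := by
  rw [Circuit.op_rename]
  refine Sends.lift e fun x => ?_
  have hx : x = Sum.elim (x ∘ Sum.inl) (x ∘ Sum.inr) := (Sum.elim_comp_inl_inr x).symm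
  have hz' : z ∘ e = Sum.elim (z ∘ e ∘ Sum.inl) fun _ => false := by
    funext i
    rcases i with i | i
    · rfl
    · exact hz i
  rw [hx, hz', hC, classicalOp, Matrix.of_apply, ← ite_and]
  refine if_congr ⟨fun h => ?_, fun h => ?_⟩ rfl rfl
  · rw [h.1, h.2]
  · exact ⟨congrArg (· ∘ Sum.inr) h, congrArg (· ∘ Sum.inl) h⟩

theorem extend_sumElim_eq_update {n a : ℕ} {W : Type} [DecidableEq W] (e : Fin n ⊕ Fin a ↪ W)
    {z : W → Bool} (hz : ∀ j, z (e (Sum.inr j)) = false) (t : Fin n) (b : Bool) :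
    Function.extend e (Sum.elim (Function.update (z ∘ e ∘ Sum.inl) t b) fun _ => false) z =
      Function.update z (e (Sum.inl t)) b := by
  refine Eq.symm ((eq_extend_of_eq_off e (x := z) fun w hw => ?_).trans ?_)
  · rw [Function.update_of_ne]
    rintro rfl
    exact hw ⟨_, rfl⟩
  · congr 1
    funext i
    rcases i with i | i
    · by_cases hi : i = t
      · subst hi; simp
      · simp [hi, Function.update_of_ne]
    · simp [hz]

namespace ClassicalGates

variable {G : GateSet} (D : ClassicalGates G) {W : Type} [Fintype W] [DecidableEq W]

theorem sends_not (e : Fin 1 ⊕ Fin D.aN ↪ W) {z : W → Bool}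
    (hz : ∀ j, z (e (Sum.inr j)) = false) :
    Sends (Circuit.op (D.notC.rename e)) z
      (Function.update z (e (Sum.inl 0)) (!(z (e (Sum.inl 0))))) := by
  have h := sends_of_implements D.not_spec e hz
  have hf : (fun i => !((z ∘ e ∘ Sum.inl) i) : Fin 1 → Bool) =
      Function.update (z ∘ e ∘ Sum.inl) 0 (!(z (e (Sum.inl 0)))) := by
    funext i
    rw [Subsingleton.elim i 0]
    simp
  rw [hf, extend_sumElim_eq_update e hz] at h
  exact h

theorem sends_tof (e : Fin 3 ⊕ Fin D.aT ↪ W) {z : W → Bool}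
    (hz : ∀ j, z (e (Sum.inr j)) = false) :
    Sends (Circuit.op (D.tofC.rename e)) z
      (Function.update z (e (Sum.inl 2)) (xor (z (e (Sum.inl 2)))
        (z (e (Sum.inl 0)) && z (e (Sum.inl 1))))) := by
  have h := sends_of_implements D.tof_spec e hz
  rw [extend_sumElim_eq_update e hz] at h
  exact h

end ClassicalGates

theorem GateSet.exists_classicalGates {G : GateSet} (hN : G.Implements notGate)
    (hT : G.Implements toffoliGate) : Nonempty (ClassicalGates G) := by
  obtain ⟨aN, CN, hN⟩ := hN
  obtain ⟨aT, CT, hT⟩ := hT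
  exact ⟨⟨aN, aT, CN, CT, hN, hT⟩⟩

end ShortQuantumGames

namespace ShortQuantumGames

open Matrix
open scoped ComplexOrder

/-! ### The repeated verifier -/

/-- The copies with index below `m`, in descending order. -/
def descending {k : ℕ} : (m : ℕ) → m ≤ k → List (Fin k)
  | 0, _ => []
  | m + 1, h => ⟨m, h⟩ :: descending m (Nat.le_of_succ_le h)

theorem mem_descending {k : ℕ} : ∀ {m : ℕ} (h : m ≤ k) {i : Fin k},
    i ∈ descending m h ↔ i.1 < m
  | 0, _, i => by simp [descending]
  | m + 1, h, i => by
    rw [descending, List.mem_cons, mem_descending, Fin.ext_iff]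
    simp only
    omega

theorem nodup_descending {k : ℕ} : ∀ {m : ℕ} (h : m ≤ k), (descending m h).Nodup
  | 0, _ => List.nodup_nil
  | m + 1, h => by
    rw [descending, List.nodup_cons, mem_descending]
    exact ⟨lt_irrefl _, nodup_descending _⟩

/-- A circuit applies the head of a list first, whereas `tens` writes it leftmost. The orders can be
exchanged because distinct copies commute. -/
theorem Circuit.op_flatMap_rename {G : GateSet} {ι C W : Type} [Fintype C] [DecidableEq C]
    [Fintype W] [DecidableEq W] {l : List ι} (hl : l.Nodup) {c : ι → C ↪ W}
    (hc : Pairwise fun i j => Disjoint (Set.range (c i)) (Set.range (c j)))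
    (D : Circuit G C) :
    Circuit.op (l.flatMap fun i => D.rename (c i)) = tens l c fun _ => Circuit.op D := by
  induction l with
  | nil => rfl
  | cons i l ih =>
    rw [List.nodup_cons] at hl
    rw [List.flatMap_cons, Circuit.op_append, ih hl.2, tens_cons, Circuit.op_rename,
      (tens_commute_lift hc hl.1 _ _).eq]

theorem mul_add_lt_mul {k m : ℕ} (j : Fin m) (i : Fin k) : j.1 * k + i.1 < m * k :=
  calc j.1 * k + i.1 < j.1 * k + k := Nat.add_lt_add_left i.2 _
    _ = (j.1 + 1) * k := by ring
    _ ≤ m * k := Nat.mul_le_mul_right k j.2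

/-- The `i`-th copy of `m` qubits among `k` interleaved copies. -/
def interleave (m : ℕ) {k : ℕ} (i : Fin k) : Fin m ↪ Fin (m * k) where
  toFun j := ⟨j.1 * k + i.1, mul_add_lt_mul j i⟩
  inj' j j' h := by
    have h1 : j.1 * k + i.1 = j'.1 * k + i.1 := congrArg Fin.val h
    exact Fin.ext (Nat.eq_of_mul_eq_mul_right (Fin.pos i) (Nat.add_right_cancel h1))

theorem interleave_disjoint (m : ℕ) {k : ℕ} {i i' : Fin k} (h : i ≠ i') :
    Disjoint (Set.range (interleave m i)) (Set.range (interleave m i')) := by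
  rw [Set.disjoint_left]
  rintro _ ⟨j, rfl⟩ ⟨j', hj⟩
  have h1 : j'.1 * k + i'.1 = j.1 * k + i.1 := congrArg Fin.val hj
  refine h (Fin.ext ?_)
  have h2 := congrArg (· % k) h1
  simp only [Nat.mul_add_mod', Nat.mod_eq_of_lt i.2, Nat.mod_eq_of_lt i'.2] at h2
  exact h2.symm

section Layout

variable (a : ℕ) {mY work mN k : ℕ}

/-- The number of private qubits, except for the output qubit, of the repeated verifier. -/
def repeatedWork (work k : ℕ) : ℕ := k + a + (work + 1) * k

/-- The private qubits of the `i`-th copy of the verifier. -/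
def copyPrivate (work : ℕ) (i : Fin k) : Fin (work + 1) ↪ Fin (repeatedWork a work k + 1) where
  toFun j := ⟨a + 1 + k + (interleave (work + 1) i j).1, by
    have := (interleave (work + 1) i j).2
    unfold repeatedWork; omega⟩
  inj' j j' h := by
    have h1 : a + 1 + k + (interleave (work + 1) i j).1 =
      a + 1 + k + (interleave (work + 1) i j').1 := congrArg Fin.val h
    exact (interleave (work + 1) i).injective (Fin.ext (Nat.add_left_cancel h1))

/-- The qubits of the `i`-th copy of the verifier. -/
def copyWires (mY work mN : ℕ) (i : Fin k) :
    VWire mY work mN ↪ VWire (mY * k) (repeatedWork a work k) (mN * k) :=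
  (interleave mY i).sumMap ((copyPrivate a work i).sumMap (interleave mN i))

/-- The `t`-th auxiliary private qubit of the repeated verifier: the accumulators come first,
followed by the ancilla qubits. -/
def auxWire (mY work mN : ℕ) {k : ℕ} (t : ℕ) (ht : t < k + 1 + a) :
    VWire (mY * k) (repeatedWork a work k) (mN * k) :=
  Sum.inr (Sum.inl ⟨t, by unfold repeatedWork; omega⟩)

theorem auxWire_inj {t t' : ℕ} {ht : t < k + 1 + a} {ht' : t' < k + 1 + a} :
    auxWire a mY work mN t ht = auxWire a mY work mN t' ht' ↔ t = t' := by
  simp [auxWire]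

theorem auxWire_ne {t t' : ℕ} (ht : t < k + 1 + a) (ht' : t' < k + 1 + a) (h : t ≠ t') :
    auxWire a mY work mN t ht ≠ auxWire a mY work mN t' ht' :=
  fun h' => h ((auxWire_inj a).1 h')

theorem auxWire_ne_copyWires {t : ℕ} (ht : t < k + 1 + a) (i : Fin k) (w : VWire mY work mN) :
    auxWire a mY work mN t ht ≠ copyWires a mY work mN i w := by
  rcases w with w | w | w
  · simp [auxWire, copyWires]
  · intro h
    have h1 : t = a + 1 + k + (interleave (work + 1) i w).1 :=
      congrArg Fin.val (Sum.inl.inj (Sum.inr.inj h))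
    omega
  · simp [auxWire, copyWires]

/-- The output qubit of the `i`-th copy. -/
def copyOutput (mY work mN : ℕ) {k : ℕ} (i : Fin k) :
    VWire (mY * k) (repeatedWork a work k) (mN * k) :=
  copyWires a mY work mN i (Sum.inr (Sum.inl 0))

theorem copyOutput_ne_auxWire (i : Fin k) {t : ℕ} (ht : t < k + 1 + a) :
    copyOutput a mY work mN i ≠ auxWire a mY work mN t ht :=
  (auxWire_ne_copyWires a ht i _).symm

theorem copyWires_disjoint {i i' : Fin k} (h : i ≠ i') :
    Disjoint (Set.range (copyWires a mY work mN i)) (Set.range (copyWires a mY work mN i')) := by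
  have hd : ∀ m (j j' : Fin m), interleave m i j ≠ interleave m i' j' := fun m j j' hj =>
    Set.disjoint_left.1 (interleave_disjoint m h) ⟨j, rfl⟩ ⟨j', hj.symm⟩
  rw [Set.disjoint_left]
  rintro _ ⟨w, rfl⟩ ⟨w', hw⟩
  rcases w with w | w | w <;> rcases w' with w' | w' | w' <;>
    simp only [copyWires, Function.Embedding.coe_sumMap, Sum.map_inl, Sum.map_inr, reduceCtorEq,
      Sum.inl.injEq, Sum.inr.injEq] at hw
  · exact hd _ _ _ hw.symm
  · refine hd _ w w' (Fin.ext ?_)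
    have h1 : a + 1 + k + (interleave (work + 1) i' w').1 =
      a + 1 + k + (interleave (work + 1) i w).1 := congrArg Fin.val hw
    omega
  · exact hd _ _ _ hw.symm

theorem copyOutput_inj {i i' : Fin k} :
    copyOutput a mY work mN i = copyOutput a mY work mN i' ↔ i = i' := by
  refine ⟨fun h => ?_, fun h => by rw [h]⟩
  by_contra hne
  exact Set.disjoint_left.1 (copyWires_disjoint a hne) ⟨_, rfl⟩ ⟨_, h.symm⟩

/-- The wires of a gate implementation which uses `b` ancilla qubits. -/
def gateWires {n b : ℕ} (hb : b ≤ a) (f : Fin n ↪ VWire (mY * k) (repeatedWork a work k) (mN * k))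
    (hf : ∀ j t (h : t < a), f j ≠ auxWire a mY work mN (k + 1 + t) (by omega)) :
    Fin n ⊕ Fin b ↪ VWire (mY * k) (repeatedWork a work k) (mN * k) where
  toFun := Sum.elim f fun t => auxWire a mY work mN (k + 1 + t.1) (by omega)
  inj' := by
    rintro (j | t) (j' | t') h
    · exact congrArg Sum.inl (f.injective h)
    · exact absurd h (hf j t'.1 (by omega))
    · exact absurd h.symm (hf j' t.1 (by omega))
    · have h1 : auxWire a mY work mN (k := k) (k + 1 + t.1) (by omega) =
        auxWire a mY work mN (k := k) (k + 1 + t'.1) (by omega) := h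
      have := (auxWire_inj a).1 h1
      exact congrArg Sum.inr (Fin.ext (by omega))

end Layout

namespace ClassicalGates

variable {G : GateSet} (D : ClassicalGates G) {mY work mN k : ℕ}

/-- The number of ancilla qubits. -/
def anc : ℕ := D.aN + D.aT

/-- The qubits of the repeated verifier. -/
abbrev RWire (mY work mN k : ℕ) : Type :=
  VWire (mY * k) (repeatedWork D.anc work k) (mN * k)

/-- The wires of a NOT gate on an accumulator. -/
def notAuxWires (mY work mN : ℕ) {k : ℕ} (t : ℕ) (ht : t ≤ k) :
    Fin 1 ⊕ Fin D.aN ↪ D.RWire mY work mN k :=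
  gateWires D.anc (Nat.le_add_right _ _)
    ⟨fun _ => auxWire D.anc mY work mN t (by omega), fun _ _ _ => Subsingleton.elim _ _⟩
    fun j t' h h' => by
      have h1 : auxWire D.anc mY work mN (k := k) t (by omega) =
        auxWire D.anc mY work mN (k := k) (k + 1 + t') (by omega) := h'
      have := (auxWire_inj D.anc).1 h1
      omega

/-- The wires of a NOT gate on the output of a copy. -/
def notOutputWires (mY work mN : ℕ) {k : ℕ} (i : Fin k) :
    Fin 1 ⊕ Fin D.aN ↪ D.RWire mY work mN k :=
  gateWires D.anc (Nat.le_add_right _ _)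
    ⟨fun _ => copyOutput D.anc mY work mN i, fun _ _ _ => Subsingleton.elim _ _⟩
    fun _ _ _ => copyOutput_ne_auxWire _ _ _

/-- The wires of the Toffoli gate that processes the output of a copy. -/
def tofWires (mY work mN : ℕ) {k : ℕ} (i : Fin k) : Fin 3 ⊕ Fin D.aT ↪ D.RWire mY work mN k :=
  gateWires D.anc (Nat.le_add_left _ _)
    ⟨![copyOutput D.anc mY work mN i, auxWire D.anc mY work mN (i.1 + 1) (by omega),
      auxWire D.anc mY work mN i.1 (by omega)], by
      intro x y hxy
      fin_cases x <;> fin_cases y <;>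
        simp_all [auxWire_inj, copyOutput_ne_auxWire, (copyOutput_ne_auxWire _ _ _).symm]⟩
    fun j t h => by
      have h1 : ∀ t' (ht' : t' < k + 1), auxWire D.anc mY work mN (k := k) t' (by omega) ≠
          auxWire D.anc mY work mN (k := k) (k + 1 + t) (by omega) := fun t' ht' h' => by
        have := (auxWire_inj D.anc).1 h'
        omega
      fin_cases j
      · exact copyOutput_ne_auxWire _ _ _
      · exact h1 _ (by omega)
      · exact h1 _ (by omega)

/-- The circuit that adds the output of a copy to the accumulated conjunction. -/
def accumulate (mY work mN : ℕ) {k : ℕ} (neg : Bool) (i : Fin k) :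
    Circuit G (D.RWire mY work mN k) :=
  (if neg then D.notC.rename (D.notOutputWires mY work mN i) else []) ++
    D.tofC.rename (D.tofWires mY work mN i)

/-- The circuit that computes the conjunction (`neg = false`) or disjunction (`neg = true`) of the
outputs of all copies. -/
def combine (mY work mN k : ℕ) (neg : Bool) : Circuit G (D.RWire mY work mN k) :=
  D.notC.rename (D.notAuxWires mY work mN k le_rfl) ++
    ((if neg then D.notC.rename (D.notAuxWires mY work mN 0 (Nat.zero_le k)) else []) ++
      (descending k le_rfl).flatMap fun i => D.accumulate mY work mN neg i)

/-- The circuit `C` applied to all copies. -/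
def copies (k : ℕ) (C : Circuit G (VWire mY work mN)) : Circuit G (D.RWire mY work mN k) :=
  (descending k le_rfl).flatMap fun i => C.rename (copyWires D.anc mY work mN i)

/-- The `k`-fold parallel repetition of a verifier, which outputs the conjunction or disjunction
of the outputs of the copies. -/
def repeated (k : ℕ) (neg : Bool) (V : VerifierCircuits G) : VerifierCircuits G where
  mY := V.mY * k
  work := repeatedWork D.anc V.work k
  mN := V.mN * k
  V0 := D.copies k V.V0
  V1 := D.copies k V.V1
  V2 := D.copies k V.V2 ++ D.combine V.mY V.work V.mN k neg

/-- The gates alter only the output of copy `i` (negated if `neg`) and accumulator `i`. Nothing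
needs to be recorded about that output afterwards, since no later copy reads it. -/
theorem sends_accumulate (neg : Bool) (i : Fin k) {z : D.RWire mY work mN k → Bool}
    (hz : ∀ t (h : t < D.anc), z (auxWire D.anc mY work mN (k + 1 + t) (by omega)) = false) :
    ∃ z', Sends (Circuit.op (D.accumulate mY work mN neg i)) z z' ∧
      (∀ t (h : t < k + 1 + D.anc), t ≠ i.1 →
        z' (auxWire D.anc mY work mN t h) = z (auxWire D.anc mY work mN t h)) ∧
      (∀ j, j ≠ i → z' (copyOutput D.anc mY work mN j) = z (copyOutput D.anc mY work mN j)) ∧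
      z' (auxWire D.anc mY work mN i.1 (by omega)) =
        xor (z (auxWire D.anc mY work mN i.1 (by omega)))
          (xor (z (copyOutput D.anc mY work mN i)) neg &&
            z (auxWire D.anc mY work mN (i.1 + 1) (by omega))) := by
  have hoa : ∀ t (h : t < k + 1 + D.anc) j,
      auxWire D.anc mY work mN t h ≠ copyOutput D.anc mY work mN j :=
    fun t h j => (copyOutput_ne_auxWire D.anc j h).symm
  have hanc : ∀ j : Fin D.aT, j.1 < D.anc := fun j => Nat.lt_add_left _ j.2
  obtain ⟨z₁, hs, h1, h2, h3⟩ : ∃ z₁,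
      Sends (Circuit.op (if neg then D.notC.rename (D.notOutputWires mY work mN i) else [])) z z₁ ∧
      (∀ t (h : t < k + 1 + D.anc),
        z₁ (auxWire D.anc mY work mN t h) = z (auxWire D.anc mY work mN t h)) ∧
      (∀ j, j ≠ i → z₁ (copyOutput D.anc mY work mN j) = z (copyOutput D.anc mY work mN j)) ∧
      z₁ (copyOutput D.anc mY work mN i) = xor (z (copyOutput D.anc mY work mN i)) neg := by
    cases neg with
    | false => exact ⟨z, Sends.one z, fun _ _ => rfl, fun _ _ => rfl, by simp⟩
    | true =>
      refine ⟨_, D.sends_not (D.notOutputWires mY work mN i) fun j =>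
        hz j.1 (Nat.lt_add_right _ j.2), ?_, ?_, ?_⟩
      · intro t h
        exact Function.update_of_ne (hoa t h i) _ _
      · intro j hj
        exact Function.update_of_ne (fun h => hj ((copyOutput_inj D.anc).1 h)) _ _
      · refine (Function.update_self _ _ _).trans ?_
        rw [Bool.xor_true]
        rfl
  have hs' := D.sends_tof (D.tofWires mY work mN i) (z := z₁) fun j =>
    (h1 (k + 1 + j.1) (by have := hanc j; omega)).trans (hz j.1 (hanc j))
  have hs'' := hs'.mul hs
  rw [← Circuit.op_append] at hs''
  refine ⟨_, hs'', fun t h ht => ?_, fun j hj => ?_, ?_⟩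
  · rw [Function.update_of_ne, h1]
    exact auxWire_ne D.anc h (by omega) ht
  · rw [Function.update_of_ne, h2 j hj]
    exact (hoa i.1 (by omega) j).symm
  · refine (Function.update_self _ _ _).trans ?_
    change xor (z₁ (auxWire D.anc mY work mN i.1 (by omega)))
      (z₁ (copyOutput D.anc mY work mN i) &&
        z₁ (auxWire D.anc mY work mN (i.1 + 1) (by omega))) = _
    rw [h1, h1, h3]

/-- The conjunction is passed down from accumulator `m` to accumulator `0`, the output qubit.
Accumulator `0` starts at `neg` instead of zero, so for `neg = true` the conjunction of the negated
outcomes is negated once more and becomes their disjunction. For `m = 0` accumulator `0` already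
holds its final value, which explains `decide (m ≠ 0)`. -/
theorem sends_accumulate_descending (neg : Bool) : ∀ {m : ℕ} (hm : m ≤ k)
    {z : D.RWire mY work mN k → Bool},
    (∀ t (h : t < D.anc), z (auxWire D.anc mY work mN (k + 1 + t) (by omega)) = false) →
    (∀ t (h : t < m), z (auxWire D.anc mY work mN t (by omega)) = (decide (t = 0) && neg)) →
    ∃ z', Sends (Circuit.op ((descending m hm).flatMap fun i =>
        D.accumulate mY work mN neg i)) z z' ∧
      z' (auxWire D.anc mY work mN 0 (by omega)) = xor (decide (m ≠ 0) && neg)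
        (z (auxWire D.anc mY work mN m (by omega)) &&
          decide (∀ i : Fin k, i.1 < m → z (copyOutput D.anc mY work mN i) ≠ neg))
  | 0, _, z, _, _ => ⟨z, Sends.one z, by simp⟩
  | m + 1, hm, z, hz, hz' => by
    obtain ⟨z₁, hs, h1, h2, h3⟩ := D.sends_accumulate neg ⟨m, hm⟩ hz
    obtain ⟨z₂, hs', h4⟩ := sends_accumulate_descending neg (m := m) (by omega) (z := z₁)
      (fun t h => (h1 _ _ (by simp only; omega)).trans (hz t h))
      (fun t h => (h1 _ _ (by simp only; omega)).trans (hz' t (by omega)))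
    refine ⟨z₂, ?_, ?_⟩
    · rw [descending, List.flatMap_cons, Circuit.op_append]
      exact hs'.mul hs
    · rw [h4, h3, hz' m (by omega)]
      have hall : (∀ i : Fin k, i.1 < m + 1 → z (copyOutput D.anc mY work mN i) ≠ neg) ↔
          z (copyOutput D.anc mY work mN ⟨m, hm⟩) ≠ neg ∧
            ∀ i : Fin k, i.1 < m → z₁ (copyOutput D.anc mY work mN i) ≠ neg := by
        constructor
        · refine fun h => ⟨h _ (Nat.lt_succ_self m), fun i hi => ?_⟩
          rw [h2 i (by rintro rfl; exact lt_irrefl _ hi)]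
          exact h i (by omega)
        · rintro ⟨h, h'⟩ i hi
          by_cases him : i = ⟨m, hm⟩
          · rwa [him]
          · rw [← h2 i him]
            refine h' i ?_
            have : i.1 ≠ m := fun h => him (Fin.ext h)
            omega
      simp only [hall]
      have hP0 : m = 0 → decide (∀ i : Fin k, i.1 < m →
          z₁ (copyOutput D.anc mY work mN i) ≠ neg) = true := by
        intro h
        rw [decide_eq_true_eq]
        intro i hi
        omega
      rw [Bool.decide_and]
      generalize (decide (∀ i : Fin k, i.1 < m → z₁ (copyOutput D.anc mY work mN i) ≠ neg)) = P
        at hP0 ⊢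
      by_cases hm0 : m = 0 <;> cases neg <;> cases z (copyOutput D.anc mY work mN ⟨m, hm⟩) <;>
        cases z (auxWire D.anc mY work mN (m + 1) (by omega)) <;> simp [hm0, hP0]

/-- The effect of the final circuit of the repeated verifier on clean auxiliary qubits. -/
theorem sends_combine (neg : Bool) (hk : 0 < k) {z : D.RWire mY work mN k → Bool}
    (hz : ∀ t (h : t < k + 1 + D.anc), z (auxWire D.anc mY work mN t h) = false) :
    ∃ z', Sends (Circuit.op (D.combine mY work mN k neg)) z z' ∧
      z' (auxWire D.anc mY work mN 0 (by omega)) =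
        xor neg (decide (∀ i : Fin k, z (copyOutput D.anc mY work mN i) ≠ neg)) := by
  have hoa : ∀ t (h : t < k + 1 + D.anc) j,
      copyOutput D.anc mY work mN j ≠ auxWire D.anc mY work mN t h :=
    fun t h j => copyOutput_ne_auxWire D.anc j h
  have hanc : ∀ j : Fin D.aN, j.1 < D.anc := fun j => Nat.lt_add_right _ j.2
  have hs1 := D.sends_not (D.notAuxWires mY work mN k le_rfl) (z := z) fun j =>
    hz (k + 1 + j.1) (by have := hanc j; omega)
  set z₁ := Function.update z (D.notAuxWires mY work mN k le_rfl (Sum.inl 0))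
    (!(z (D.notAuxWires mY work mN k le_rfl (Sum.inl 0)))) with hz₁
  have h1 : ∀ t (h : t < k + 1 + D.anc), z₁ (auxWire D.anc mY work mN t h) = decide (t = k) := by
    intro t h
    by_cases ht : t = k
    · subst ht
      rw [hz₁]
      refine (Function.update_self _ _ _).trans ?_
      change (!(z (auxWire D.anc mY work mN t (by omega)))) = _
      rw [hz]
      simp
    · rw [hz₁, Function.update_of_ne, hz]
      · simp [ht]
      · exact auxWire_ne D.anc h (by omega) ht
  have h1' : ∀ i, z₁ (copyOutput D.anc mY work mN i) = z (copyOutput D.anc mY work mN i) :=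
    fun i => Function.update_of_ne (hoa k (by omega) i) _ _
  obtain ⟨z₂, hs2, h2, h2'⟩ : ∃ z₂, Sends (Circuit.op (if neg then
      D.notC.rename (D.notAuxWires mY work mN 0 (Nat.zero_le k)) else [])) z₁ z₂ ∧
      (∀ t (h : t < k + 1 + D.anc), z₂ (auxWire D.anc mY work mN t h) =
        (decide (t = k) || (decide (t = 0) && neg))) ∧
      ∀ i, z₂ (copyOutput D.anc mY work mN i) = z (copyOutput D.anc mY work mN i) := by
    cases neg with
    | false => exact ⟨z₁, Sends.one z₁, fun t h => by simp [h1], h1'⟩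
    | true =>
      refine ⟨_, D.sends_not (D.notAuxWires mY work mN 0 (Nat.zero_le k)) fun j => ?_, ?_, ?_⟩
      · refine (h1 (k + 1 + j.1) (by have := hanc j; omega)).trans ?_
        simp only [decide_eq_false_iff_not]
        omega
      · intro t h
        by_cases ht : t = 0
        · subst ht
          refine (Function.update_self _ _ _).trans ?_
          change (!(z₁ (auxWire D.anc mY work mN 0 (by omega)))) = _
          rw [h1]
          -- As `0 < k`, accumulator `0` differs from accumulator `k`, which the previous gate has
          -- set to one.
          simp [hk.ne]
        · rw [Function.update_of_ne, h1]
          · simp [ht]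
          · exact auxWire_ne D.anc h (by omega) ht
      · intro i
        rw [← h1' i]
        exact Function.update_of_ne (hoa 0 (by omega) i) _ _
  obtain ⟨z₃, hs3, h3⟩ := D.sends_accumulate_descending neg le_rfl (z := z₂)
    (fun t h => by
      rw [h2, show decide (k + 1 + t = k) = false by simp only [decide_eq_false_iff_not]; omega]
      simp)
    (fun t h => by
      rw [h2, show decide (t = k) = false by simp only [decide_eq_false_iff_not]; omega]
      simp)
  refine ⟨z₃, ?_, ?_⟩
  · rw [combine, Circuit.op_append, Circuit.op_append]
    exact (hs3.mul hs2).mul hs1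
  · rw [h3, h2]
    simp [hk.ne', h2']

end ClassicalGates

end ShortQuantumGames

namespace ShortQuantumGames

open Matrix
open scoped ComplexOrder

/-! ### Outcome probabilities of the repeated game -/

theorem conjTranspose_mul_self_of_mem_unitaryGroup {n : Type*} [Fintype n] [DecidableEq n]
    {U : Matrix n n ℂ} (hU : U ∈ Matrix.unitaryGroup n ℂ) : Uᴴ * U = 1 :=
  Matrix.mem_unitaryGroup_iff'.1 hU

/-- The operator `V₂ N₁ V₁ Y₁ V₀`. -/
noncomputable def gameOp {G : GateSet} (V : VerifierCircuits G) (y n : ℕ)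
    (Y : Op (Fin y ⊕ Fin V.mY)) (N : Op (Fin V.mN ⊕ Fin n)) :
    Op (GameWire y V.mY V.work V.mN n) :=
  lift (verifierWires y V.mY V.work V.mN n) (Circuit.op V.V2) *
    (lift (noWires y V.mY V.work V.mN n) N *
      (lift (verifierWires y V.mY V.work V.mN n) (Circuit.op V.V1) *
        (lift (yesWires y V.mY V.work V.mN n) Y *
            lift (verifierWires y V.mY V.work V.mN n) (Circuit.op V.V0))))

/-- The probability of the outcome `b` on a fixed input. -/
noncomputable def playProb {G : GateSet} (b : Bool) (V : VerifierCircuits G) (y n : ℕ)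
    (Y : Op (Fin y ⊕ Fin V.mY)) (N : Op (Fin V.mN ⊕ Fin n)) : ℝ :=
  vacuumProb (outputWire y V.mY V.work V.mN n) b (gameOp V y n Y N)

theorem outcomeProb_eq_playProb {G : GateSet} (b : Bool) (V : List Bool → VerifierCircuits G)
    (Y : YesProver V) (N : NoProver V) (x : List Bool) :
    outcomeProb b V Y N x = playProb b (V x) (Y.priv x) (N.priv x) (Y.op x) (N.op x) := by
  unfold outcomeProb playProb vacuumProb
  refine Finset.sum_congr rfl fun z _ => ?_
  have : finalState (V x) (Y.priv x) (N.priv x) (Y.op x) (N.op x) z =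
      gameOp (V x) (Y.priv x) (N.priv x) (Y.op x) (N.op x) z fun _ => false := by
    rw [finalState, mulVec_mulVec, mulVec_mulVec, mulVec_mulVec, mulVec_mulVec,
      mulVec_single_one]
    simp only [gameOp, mul_assoc]
    rfl
  rw [this]

theorem vacuumProb_lift_equiv {W W' : Type} [Fintype W] [DecidableEq W] [Fintype W']
    [DecidableEq W'] (e : W ≃ W') (o : W) (b : Bool) (M : Op W) :
    vacuumProb (e o) b (lift e.toEmbedding M) = vacuumProb o b M := by
  unfold vacuumProb
  rw [← (Equiv.arrowCongr e (Equiv.refl Bool)).sum_comp]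
  refine Finset.sum_congr rfl fun z _ => ?_
  rw [lift_equiv_apply]
  have h1 : (e.arrowCongr (Equiv.refl Bool)) z ∘ e = z := by
    funext w; simp
  rw [h1]
  simp

section Combined

variable {G : GateSet} (D : ClassicalGates G) {mY work mN k y n : ℕ}

/-- The qubits of the `i`-th copy of a game. -/
def gameCopy (mY work mN : ℕ) {k : ℕ} {y n y' n' : ℕ} (fy : Fin y ↪ Fin y')
    (fn : Fin n ↪ Fin n') (i : Fin k) :
    GameWire y mY work mN n ↪
      GameWire y' (mY * k) (repeatedWork D.anc work k) (mN * k) n' :=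
  fy.sumMap ((copyWires D.anc mY work mN i).sumMap fn)

theorem gameCopy_disjoint {y' n' : ℕ} {fy : Fin k → Fin y ↪ Fin y'} {fn : Fin k → Fin n ↪ Fin n'}
    (hy : ∀ i j, i ≠ j → Disjoint (Set.range (fy i)) (Set.range (fy j)))
    (hn : ∀ i j, i ≠ j → Disjoint (Set.range (fn i)) (Set.range (fn j))) :
    Pairwise fun i j => Disjoint (Set.range (gameCopy D mY work mN (fy i) (fn i) i))
      (Set.range (gameCopy D mY work mN (fy j) (fn j) j)) := by
  intro i j hij
  rw [Set.disjoint_left]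
  rintro _ ⟨w, rfl⟩ ⟨w', hw⟩
  rcases w with w | w | w <;> rcases w' with w' | w' | w' <;>
    simp only [gameCopy, Function.Embedding.coe_sumMap, Sum.map_inl, Sum.map_inr, reduceCtorEq,
      Sum.inl.injEq, Sum.inr.injEq] at hw
  · exact Set.disjoint_left.1 (hy i j hij) ⟨w, rfl⟩ ⟨w', hw⟩
  · exact Set.disjoint_left.1 (copyWires_disjoint D.anc hij) ⟨w, rfl⟩ ⟨w', hw⟩
  · exact Set.disjoint_left.1 (hn i j hij) ⟨w, rfl⟩ ⟨w', hw⟩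

/-- The effect of the final circuit on the outcome probabilities. -/
theorem vacuumProb_combine_mul (neg b : Bool) (hk : 0 < k) {y' n' : ℕ}
    (M : Op (GameWire y' (mY * k) (repeatedWork D.anc work k) (mN * k) n'))
    (hM : ∀ t (h : t < k + 1 + D.anc) (X : Op Unit), Commute M
      (lift ⟨fun _ => Sum.inr (Sum.inl (auxWire D.anc mY work mN t h)),
        fun _ _ _ => rfl⟩ X)) :
    vacuumProb (outputWire y' (mY * k) (repeatedWork D.anc work k) (mN * k) n') b
      (lift (verifierWires y' (mY * k) (repeatedWork D.anc work k) (mN * k) n')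
        (Circuit.op (D.combine mY work mN k neg)) * M) =
      ∑ z, if xor neg (decide (∀ i : Fin k,
          z (Sum.inr (Sum.inl (copyOutput D.anc mY work mN i))) ≠ neg)) = b then
        ‖M z fun _ => false‖ ^ 2 else 0 := by
  classical
  set v := verifierWires y' (mY * k) (repeatedWork D.anc work k) (mN * k) n' with hv
  have hclean : ∀ z, M z (fun _ => false) ≠ 0 → ∃ z',
      Sends (lift v (Circuit.op (D.combine mY work mN k neg))) z z' ∧
      z' (outputWire y' (mY * k) (repeatedWork D.anc work k) (mN * k) n') =
        xor neg (decide (∀ i : Fin k,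
          z (Sum.inr (Sum.inl (copyOutput D.anc mY work mN i))) ≠ neg)) := by
    intro z hz
    -- `M` commutes with all operators on the auxiliary qubits, so these are zero in every basis
    -- state that occurs in `M |0⟩`. Only there is the final circuit known to act classically.
    have haux : ∀ t (h : t < k + 1 + D.anc), (z ∘ v) (auxWire D.anc mY work mN t h) = false := by
      intro t h
      by_contra hne
      refine hz (apply_zero_eq_zero_of_commute _ M (hM t h) fun h' => hne ?_)
      exact congrFun h' ()
    obtain ⟨z', hs, hz'⟩ := D.sends_combine neg hk haux
    refine ⟨_, hs.lift v, ?_⟩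
    exact (v.injective.extend_apply z' z (auxWire D.anc mY work mN 0 (by omega))).trans hz'
  choose! g hg hg' using hclean
  have hU := conjTranspose_mul_self_of_mem_unitaryGroup (lift_mem_unitaryGroup v
    (Circuit.op_mem_unitaryGroup (D.combine mY work mN k neg)))
  unfold vacuumProb
  rw [sum_norm_sq_mul_of_sends hU (fun _ => false) g hg fun x =>
    x (outputWire y' (mY * k) (repeatedWork D.anc work k) (mN * k) n') = b]
  refine Finset.sum_congr rfl fun z _ => ?_
  by_cases hz : M z (fun _ => false) = 0
  · simp [hz]
  · rw [hg' z hz]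

theorem prod_map_descending (f : Fin k → ℝ) :
    ((descending k le_rfl).map f).prod = ∏ i, f i := by
  rw [← List.prod_toFinset f (nodup_descending _)]
  congr 1
  ext i
  simp [mem_descending]

/-- Bounds on the outcomes of a repeated game from bounds on sets of copies. -/
theorem combined_sum_le {Ω : Type*} [Fintype Ω] (w : Ω → ℝ) (hw : ∀ z, 0 ≤ w z)
    (r : Fin k → Ω → Bool) (neg b : Bool) {s : ℝ}
    (h : ∀ (S : Fin k → Prop) [DecidablePred S],
      (∑ z, if ∀ i ∈ descending k le_rfl, S i → r i z = b then w z else 0) ≤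
        ((descending k le_rfl).map fun i => if S i then s else 1).prod) :
    (b = !neg → (∑ z, if xor neg (decide (∀ i : Fin k, r i z ≠ neg)) = b then w z else 0) ≤
      s ^ k) ∧
    (b = neg → (∑ z, if xor neg (decide (∀ i : Fin k, r i z ≠ neg)) = b then w z else 0) ≤
      k * s) := by
  constructor
  · intro hb
    -- The combined output equals `!neg` exactly when every copy shows `!neg`.
    have h1 := h fun _ => True
    rw [prod_map_descending] at h1
    simp only [if_true, Finset.prod_const, Finset.card_univ, Fintype.card_fin] at h1
    refine le_of_eq_of_le (Finset.sum_congr rfl fun z _ => if_congr ?_ rfl rfl) h1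
    subst hb
    have : ∀ i : Fin k, r i z = (!neg) ↔ r i z ≠ neg := fun i => by
      cases neg <;> simp
    simp only [mem_descending, Fin.is_lt, true_imp_iff, this]
    cases neg <;> simp
  · intro hb
    -- The combined output equals `neg` exactly when some copy shows `neg`; the union bound requires
    -- only the probabilities for single copies.
    have hi : ∀ i : Fin k, (∑ z, if r i z = b then w z else 0) ≤ s := by
      intro i
      have h1 := h fun j => j = i
      rw [prod_map_descending] at h1
      simp only [Finset.prod_ite_eq', Finset.mem_univ, if_true] at h1
      refine le_of_eq_of_le (Finset.sum_congr rfl fun z _ => if_congr ?_ rfl rfl) h1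
      simp [mem_descending]
    calc _ ≤ ∑ z, ∑ i : Fin k, if r i z = b then w z else 0 := by
          refine Finset.sum_le_sum fun z _ => ?_
          have hnn : ∀ i ∈ (Finset.univ : Finset (Fin k)), 0 ≤ if r i z = b then w z else 0 := by
            intro i _
            split_ifs
            · exact hw z
            · exact le_rfl
          by_cases hall : ∀ i : Fin k, r i z ≠ neg
          · rw [if_neg]
            · exact Finset.sum_nonneg hnn
            · subst hb
              cases b <;> simp [hall]
          · push Not at hall
            obtain ⟨i, hi⟩ := hall
            have h2 := Finset.single_le_sum hnn (Finset.mem_univ i)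
            rw [if_pos (hi.trans hb.symm)] at h2
            refine le_trans ?_ h2
            split_ifs
            · exact le_rfl
            · exact hw z
      _ = ∑ i : Fin k, ∑ z, if r i z = b then w z else 0 := Finset.sum_comm
      _ ≤ ∑ _i : Fin k, s := Finset.sum_le_sum fun i _ => hi i
      _ = k * s := by simp

/-- The outcome probabilities of a repeated game in which all but one player act on the copies
independently. -/
theorem combined_game_le {A B : Type} [Fintype A] [DecidableEq A] [Fintype B] [DecidableEq B]
    (a : A ↪ GameWire y mY work mN n) (β : B ↪ GameWire y mY work mN n)
    (hab : IsCompl (Set.range a) (Set.range β))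
    {T P : Op (GameWire y mY work mN n)} (hT : Tᴴ * T = 1) (hP : Pᴴ * P = 1) (neg b : Bool)
    {s : ℝ}
    (h : PlayerBound a T P (outputWire y mY work mN n) b s)
    (hk : 0 < k) {y' n' : ℕ} {fy : Fin k → Fin y ↪ Fin y'} {fn : Fin k → Fin n ↪ Fin n'}
    (hy : ∀ i j, i ≠ j → Disjoint (Set.range (fy i)) (Set.range (fy j)))
    (hn : ∀ i j, i ≠ j → Disjoint (Set.range (fn i)) (Set.range (fn j)))
    {U : Op (GameWire y' (mY * k) (repeatedWork D.anc work k) (mN * k) n')} (hU : Uᴴ * U = 1)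
    (hUB : ∀ i (X : Op B),
      Commute U (lift (β.trans (gameCopy D mY work mN (fy i) (fn i) i)) X))
    (hUaux : ∀ t (h : t < k + 1 + D.anc) (X : Op Unit), Commute U
      (lift ⟨fun _ => Sum.inr (Sum.inl (auxWire D.anc mY work mN t h)),
        fun _ _ _ => rfl⟩ X)) :
    let pr := vacuumProb (outputWire y' (mY * k) (repeatedWork D.anc work k) (mN * k) n') b
      (lift (verifierWires y' (mY * k) (repeatedWork D.anc work k) (mN * k) n')
        (Circuit.op (D.combine mY work mN k neg)) *
          (tens (descending k le_rfl) (fun i => gameCopy D mY work mN (fy i) (fn i) i)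
            (fun _ => T) * (U *
          tens (descending k le_rfl) (fun i => gameCopy D mY work mN (fy i) (fn i) i)
            fun _ => P)))
    (b = !neg → pr ≤ s ^ k) ∧ (b = neg → pr ≤ k * s) := by
  intro pr
  have htens : ∀ (Q : Op (GameWire y mY work mN n)) t (h : t < k + 1 + D.anc) (X : Op Unit),
      Commute (tens (descending k le_rfl) (fun i => gameCopy D mY work mN (fy i) (fn i) i)
        fun _ => Q) (lift ⟨fun _ => Sum.inr (Sum.inl (auxWire D.anc mY work mN t h)),
          fun _ _ _ => rfl⟩ X) := by
    intro Q t h X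
    refine (commute_tens fun i _ => lift_commute _ _ ?_ _ _).symm
    rw [Set.disjoint_left]
    rintro _ ⟨_, rfl⟩ ⟨w, hw⟩
    rcases w with w | w | w
    · cases hw
    · exact auxWire_ne_copyWires D.anc h i w (Sum.inl.inj (Sum.inr.inj hw)).symm
    · cases Sum.inr.inj hw
  -- Neither the copies nor the joint unitary touch the accumulators and ancillas, so the whole
  -- operator before the final circuit commutes with all operators there.
  have hpr : pr = _ := vacuumProb_combine_mul D neg b hk _ fun t h X =>
    (htens T t h X).mul_left ((hUaux t h X).mul_left (htens P t h X))
  rw [hpr]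
  refine combined_sum_le _ (fun z => sq_nonneg _)
    (fun i (z : GameWire y' (mY * k) (repeatedWork D.anc work k) (mN * k) n' → Bool) => z (Sum.inr (Sum.inl (copyOutput D.anc mY work mN i)))) neg b fun S _ => ?_
  have hrep := repeated_game_le a β hab hT hP (outputWire y mY work mN n) b h
    (nodup_descending le_rfl) (gameCopy_disjoint D hy hn) hU hUB S
  convert hrep
  rfl

end Combined

end ShortQuantumGames

namespace ShortQuantumGames

open Matrix

/-! ### Optimal strategies in the repeated game -/

section Strategies

variable {G : GateSet} (D : ClassicalGates G) (V : VerifierCircuits G) {k : ℕ}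

/-- The yes-prover that plays all copies independently. -/
noncomputable def repeatedYes (k : ℕ) {mY y : ℕ} (Y : Op (Fin y ⊕ Fin mY)) :
    Op (Fin (y * k) ⊕ Fin (mY * k)) :=
  tens (descending k le_rfl) (fun i => (interleave y i).sumMap (interleave mY i)) fun _ => Y

/-- The no-prover that plays all copies independently. -/
noncomputable def repeatedNo (k : ℕ) {mN n : ℕ} (N : Op (Fin mN ⊕ Fin n)) :
    Op (Fin (mN * k) ⊕ Fin (n * k)) :=
  tens (descending k le_rfl) (fun i => (interleave mN i).sumMap (interleave n i)) fun _ => N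

theorem tens_mem_unitaryGroup {ι C W : Type} [Fintype C] [DecidableEq C] [Fintype W]
    [DecidableEq W] (l : List ι) (c : ι → C ↪ W) {X : ι → Op C}
    (hX : ∀ i, X i ∈ Matrix.unitaryGroup (C → Bool) ℂ) :
    tens l c X ∈ Matrix.unitaryGroup (W → Bool) ℂ := by
  refine list_prod_mem fun M hM => ?_
  obtain ⟨i, -, rfl⟩ := List.mem_map.1 hM
  exact lift_mem_unitaryGroup _ (hX i)

/-- Whatever acts copy by copy is a tensor product over copies of whole games; the next two lemmas
do the same for the independent provers. The embeddings `fy` and `fn` are arbitrary, so a deviating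
prover can be given an empty private register in each copy. -/
theorem lift_copies (y n : ℕ) {y' n' : ℕ} {mY work mN : ℕ} (fy : Fin k → Fin y ↪ Fin y')
    (fn : Fin k → Fin n ↪ Fin n') (C : Circuit G (VWire mY work mN)) :
    lift (verifierWires y' (mY * k) (repeatedWork D.anc work k) (mN * k) n')
        (Circuit.op (D.copies k C)) =
      tens (descending k le_rfl) (fun i => gameCopy D mY work mN (fy i) (fn i) i)
        fun _ => lift (verifierWires y mY work mN n) (Circuit.op C) := by
  rw [ClassicalGates.copies, Circuit.op_flatMap_rename (nodup_descending _)
    (fun i j hij => copyWires_disjoint D.anc hij), lift_tens, tens_lift]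
  rfl

theorem lift_repeatedYes (y n : ℕ) {n' : ℕ} {mY : ℕ} (work mN : ℕ)
    (fn : Fin k → Fin n ↪ Fin n') (Y : Op (Fin y ⊕ Fin mY)) :
    lift (yesWires (y * k) (mY * k) (repeatedWork D.anc work k) (mN * k) n')
        (repeatedYes k Y) =
      tens (descending k le_rfl) (fun i => gameCopy D mY work mN (interleave y i) (fn i) i)
        fun _ => lift (yesWires y mY work mN n) Y := by
  rw [repeatedYes, lift_tens, tens_lift]
  congr 1
  funext i
  ext w
  rcases w with w | w <;> rfl

theorem lift_repeatedNo (y n : ℕ) {y' : ℕ} {mN : ℕ} (mY work : ℕ)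
    (fy : Fin k → Fin y ↪ Fin y') (N : Op (Fin mN ⊕ Fin n)) :
    lift (noWires y' (mY * k) (repeatedWork D.anc work k) (mN * k) (n * k))
        (repeatedNo k N) =
      tens (descending k le_rfl) (fun i => gameCopy D mY work mN (fy i) (interleave n i) i)
        fun _ => lift (noWires y mY work mN n) N := by
  rw [repeatedNo, lift_tens, tens_lift]
  congr 1
  funext i
  ext w
  rcases w with w | w <;> rfl

/-- The qubits of a game with `p` private qubits of the yes-prover. -/
def yesSplit (mY work mN n p : ℕ) :
    GameWire 0 mY work mN n ⊕ Fin p ≃ GameWire p mY work mN n where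
  toFun
    | Sum.inl (Sum.inl i) => i.elim0
    | Sum.inl (Sum.inr w) => Sum.inr w
    | Sum.inr r => Sum.inl r
  invFun
    | Sum.inl r => Sum.inr r
    | Sum.inr w => Sum.inl (Sum.inr w)
  left_inv := by
    rintro ((i | w) | r)
    · exact i.elim0
    · rfl
    · rfl
  right_inv := by rintro (r | w) <;> rfl

/-- The qubits of a game with `p` private qubits of the no-prover. -/
def noSplit (y mY work mN p : ℕ) :
    GameWire y mY work mN 0 ⊕ Fin p ≃ GameWire y mY work mN p where
  toFun
    | Sum.inl (Sum.inl i) => Sum.inl i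
    | Sum.inl (Sum.inr (Sum.inl w)) => Sum.inr (Sum.inl w)
    | Sum.inl (Sum.inr (Sum.inr i)) => i.elim0
    | Sum.inr r => Sum.inr (Sum.inr r)
  invFun
    | Sum.inl i => Sum.inl (Sum.inl i)
    | Sum.inr (Sum.inl w) => Sum.inl (Sum.inr (Sum.inl w))
    | Sum.inr (Sum.inr r) => Sum.inr r
  left_inv := by
    rintro ((i | w | i) | r)
    · rfl
    · rfl
    · exact i.elim0
    · rfl
  right_inv := by rintro (r | w | r) <;> rfl

/-- The message qubits of the yes-prover. -/
def yesMessage (mY work mN n : ℕ) : Fin mY ↪ GameWire 0 mY work mN n :=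
  Function.Embedding.inl.trans (Function.Embedding.inl.trans Function.Embedding.inr)

/-- The qubits out of reach for the yes-prover. -/
def yesRest (mY work mN n : ℕ) :
    Fin (work + 1) ⊕ Fin mN ⊕ Fin n ↪ GameWire 0 mY work mN n where
  toFun
    | Sum.inl i => Sum.inr (Sum.inl (Sum.inr (Sum.inl i)))
    | Sum.inr (Sum.inl i) => Sum.inr (Sum.inl (Sum.inr (Sum.inr i)))
    | Sum.inr (Sum.inr i) => Sum.inr (Sum.inr i)
  inj' := by rintro (a | a | a) (b | b | b) h <;> simp_all

/-- The message qubits of the no-prover. -/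
def noMessage (y mY work mN : ℕ) : Fin mN ↪ GameWire y mY work mN 0 :=
  Function.Embedding.inr.trans (Function.Embedding.inr.trans
    (Function.Embedding.inl.trans Function.Embedding.inr))

/-- The qubits out of reach for the no-prover. -/
def noRest (y mY work mN : ℕ) :
    Fin y ⊕ Fin mY ⊕ Fin (work + 1) ↪ GameWire y mY work mN 0 where
  toFun
    | Sum.inl i => Sum.inl i
    | Sum.inr (Sum.inl i) => Sum.inr (Sum.inl (Sum.inl i))
    | Sum.inr (Sum.inr i) => Sum.inr (Sum.inl (Sum.inr (Sum.inl i)))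
  inj' := by rintro (a | a | a) (b | b | b) h <;> simp_all

theorem isCompl_yesMessage (mY work mN n : ℕ) :
    IsCompl (Set.range (yesMessage mY work mN n)) (Set.range (yesRest mY work mN n)) := by
  refine ⟨Set.disjoint_left.2 ?_, codisjoint_iff_le_sup.2 fun w _ => ?_⟩
  · rintro _ ⟨i, rfl⟩ ⟨j | j | j, h⟩ <;> cases h
  · rcases w with i | ((i | i | i) | i)
    · exact i.elim0
    · exact Or.inl ⟨i, rfl⟩
    · exact Or.inr ⟨Sum.inl i, rfl⟩
    · exact Or.inr ⟨Sum.inr (Sum.inl i), rfl⟩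
    · exact Or.inr ⟨Sum.inr (Sum.inr i), rfl⟩

theorem isCompl_noMessage (y mY work mN : ℕ) :
    IsCompl (Set.range (noMessage y mY work mN)) (Set.range (noRest y mY work mN)) := by
  refine ⟨Set.disjoint_left.2 ?_, codisjoint_iff_le_sup.2 fun w _ => ?_⟩
  · rintro _ ⟨i, rfl⟩ ⟨j | j | j, h⟩ <;> cases h
  · rcases w with i | ((i | i | i) | i)
    · exact Or.inr ⟨Sum.inl i, rfl⟩
    · exact Or.inr ⟨Sum.inr (Sum.inl i), rfl⟩
    · exact Or.inr ⟨Sum.inr (Sum.inr i), rfl⟩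
    · exact Or.inl ⟨i, rfl⟩
    · exact i.elim0

/-- The circuits before the yes-prover is consulted. -/
noncomputable def opBeforeYes (n : ℕ) : Op (GameWire 0 V.mY V.work V.mN n) :=
  lift (verifierWires 0 V.mY V.work V.mN n) (Circuit.op V.V0)

/-- The operators after the yes-prover is consulted. -/
noncomputable def opAfterYes (n : ℕ) (N : Op (Fin V.mN ⊕ Fin n)) :
    Op (GameWire 0 V.mY V.work V.mN n) :=
  lift (verifierWires 0 V.mY V.work V.mN n) (Circuit.op V.V2) *
    (lift (noWires 0 V.mY V.work V.mN n) N *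
      lift (verifierWires 0 V.mY V.work V.mN n) (Circuit.op V.V1))

/-- The operators before the no-prover is consulted. -/
noncomputable def opBeforeNo (y : ℕ) (Y : Op (Fin y ⊕ Fin V.mY)) :
    Op (GameWire y V.mY V.work V.mN 0) :=
  lift (verifierWires y V.mY V.work V.mN 0) (Circuit.op V.V1) *
    (lift (yesWires y V.mY V.work V.mN 0) Y *
      lift (verifierWires y V.mY V.work V.mN 0) (Circuit.op V.V0))

/-- The circuit after the no-prover is consulted. -/
noncomputable def opAfterNo (y : ℕ) : Op (GameWire y V.mY V.work V.mN 0) :=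
  lift (verifierWires y V.mY V.work V.mN 0) (Circuit.op V.V2)

/-- A copy of the game is modelled without private qubits of the deviating prover. The additional
qubits in `PlayerBound` take their place through `yesSplit`. -/
theorem playerBound_yes {b : Bool} {n : ℕ} {N : Op (Fin V.mN ⊕ Fin n)} {s : ℝ}
    (h : ∀ y (Y : Op (Fin y ⊕ Fin V.mY)), Y ∈ Matrix.unitaryGroup (Fin y ⊕ Fin V.mY → Bool) ℂ →
      playProb b V y n Y N ≤ s) :
    PlayerBound (yesMessage V.mY V.work V.mN n) (opAfterYes V n N) (opBeforeYes V n)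
      (outputWire 0 V.mY V.work V.mN n) b s := by
  intro p U hU
  -- The yes-prover lists its private qubits before the message qubits, `PlayerBound` after them.
  refine le_of_eq_of_le ?_ (h p (lift (Equiv.sumComm _ _).toEmbedding U)
    (lift_mem_unitaryGroup _ hU))
  rw [← vacuumProb_lift_equiv (yesSplit V.mY V.work V.mN n p), playProb]
  congr 1
  rw [lift_mul, lift_mul, lift_lift, lift_lift, lift_lift, opAfterYes, opBeforeYes, lift_mul,
    lift_mul, lift_lift, lift_lift, lift_lift, lift_lift, gameOp, lift_lift]
  have h1 : (verifierWires 0 V.mY V.work V.mN n).trans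
      (Function.Embedding.inl.trans (yesSplit V.mY V.work V.mN n p).toEmbedding) =
      verifierWires p V.mY V.work V.mN n := by
    ext w; rfl
  have h2 : (noWires 0 V.mY V.work V.mN n).trans
      (Function.Embedding.inl.trans (yesSplit V.mY V.work V.mN n p).toEmbedding) =
      noWires p V.mY V.work V.mN n := by
    ext w; rcases w with w | w <;> rfl
  have h3 : ((yesMessage V.mY V.work V.mN n).sumMap (Function.Embedding.refl (Fin p))).trans
      (yesSplit V.mY V.work V.mN n p).toEmbedding =
      (Equiv.sumComm _ _).toEmbedding.trans (yesWires p V.mY V.work V.mN n) := by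
    ext w; rcases w with w | w <;> rfl
  rw [h1, h2, h3]
  simp only [mul_assoc]

theorem playerBound_no {b : Bool} {y : ℕ} {Y : Op (Fin y ⊕ Fin V.mY)} {s : ℝ}
    (h : ∀ n (N : Op (Fin V.mN ⊕ Fin n)), N ∈ Matrix.unitaryGroup (Fin V.mN ⊕ Fin n → Bool) ℂ →
      playProb b V y n Y N ≤ s) :
    PlayerBound (noMessage y V.mY V.work V.mN) (opAfterNo V y) (opBeforeNo V y Y)
      (outputWire y V.mY V.work V.mN 0) b s := by
  intro p U hU
  refine le_of_eq_of_le ?_ (h p U hU)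
  rw [← vacuumProb_lift_equiv (noSplit y V.mY V.work V.mN p), playProb]
  congr 1
  rw [lift_mul, lift_mul, lift_lift, lift_lift, lift_lift, opAfterNo, opBeforeNo, lift_mul,
    lift_mul, lift_lift, lift_lift, lift_lift, lift_lift, gameOp]
  have h1 : (verifierWires y V.mY V.work V.mN 0).trans
      (Function.Embedding.inl.trans (noSplit y V.mY V.work V.mN p).toEmbedding) =
      verifierWires y V.mY V.work V.mN p := by
    ext w; rfl
  have h2 : (yesWires y V.mY V.work V.mN 0).trans
      (Function.Embedding.inl.trans (noSplit y V.mY V.work V.mN p).toEmbedding) =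
      yesWires y V.mY V.work V.mN p := by
    ext w; rcases w with w | w <;> rfl
  have h3 : ((noMessage y V.mY V.work V.mN).sumMap (Function.Embedding.refl (Fin p))).trans
      (noSplit y V.mY V.work V.mN p).toEmbedding = noWires y V.mY V.work V.mN p := by
    ext w; rcases w with w | w <;> rfl
  rw [h1, h2, h3]
  simp only [mul_assoc]

theorem not_mem_range_of_isEmpty {X : Type*} (f : Fin 0 → X) (x : X) : x ∉ Set.range f :=
  fun ⟨i, _⟩ => i.elim0

/-- The repeated game against an arbitrary yes-prover, if the no-prover plays independently. -/
theorem playProb_repeated_yes (neg b : Bool) (hk : 0 < k) {n : ℕ} {N : Op (Fin V.mN ⊕ Fin n)}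
    (hN : N ∈ Matrix.unitaryGroup (Fin V.mN ⊕ Fin n → Bool) ℂ) {s : ℝ}
    (h : ∀ y (Y : Op (Fin y ⊕ Fin V.mY)), Y ∈ Matrix.unitaryGroup (Fin y ⊕ Fin V.mY → Bool) ℂ →
      playProb b V y n Y N ≤ s) {y' : ℕ} {Y' : Op (Fin y' ⊕ Fin (D.repeated k neg V).mY)}
    (hY' : Y' ∈ Matrix.unitaryGroup (Fin y' ⊕ Fin (D.repeated k neg V).mY → Bool) ℂ) :
    (b = !neg → playProb b (D.repeated k neg V) y' (n * k) Y' (repeatedNo k N) ≤ s ^ k) ∧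
    (b = neg → playProb b (D.repeated k neg V) y' (n * k) Y' (repeatedNo k N) ≤ k * s) := by
  -- The private qubits of the deviating yes-prover belong to no copy.
  let fy : Fin k → Fin 0 ↪ Fin y' := fun _ => ⟨Fin.elim0, fun i => i.elim0⟩
  have hT : (opAfterYes V n N)ᴴ * opAfterYes V n N = 1 :=
    conjTranspose_mul_self_of_mem_unitaryGroup (mul_mem
      (lift_mem_unitaryGroup _ (Circuit.op_mem_unitaryGroup _)) (mul_mem
        (lift_mem_unitaryGroup _ hN)
        (lift_mem_unitaryGroup _ (Circuit.op_mem_unitaryGroup _))))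
  have hP : (opBeforeYes V n)ᴴ * opBeforeYes V n = 1 :=
    conjTranspose_mul_self_of_mem_unitaryGroup
      (lift_mem_unitaryGroup _ (Circuit.op_mem_unitaryGroup _))
  have key := combined_game_le D (yesMessage V.mY V.work V.mN n) (yesRest V.mY V.work V.mN n)
    (isCompl_yesMessage _ _ _ _) hT hP neg b (playerBound_yes V h) hk (fy := fy)
    (fn := fun i => interleave n i)
    (fun i j _ => by rw [Set.disjoint_left]; exact fun x hx => absurd hx (not_mem_range_of_isEmpty _ x))
    (fun i j hij => interleave_disjoint n hij)
    (U := lift (yesWires y' (V.mY * k) (repeatedWork D.anc V.work k) (V.mN * k) (n * k)) Y')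
    (conjTranspose_mul_self_of_mem_unitaryGroup (lift_mem_unitaryGroup _ hY'))
    (fun i X => lift_commute _ _ (by
      rw [Set.disjoint_left]
      rintro _ ⟨w | w, rfl⟩ ⟨w' | w' | w', hw⟩ <;> cases hw) _ _)
    (fun t ht X => lift_commute _ _ (by
      rw [Set.disjoint_left]
      rintro _ ⟨w | w, rfl⟩ ⟨w', hw⟩ <;> cases hw) _ _)
  have hc := gameCopy_disjoint D (mY := V.mY) (work := V.work) (mN := V.mN) (fy := fy)
    (fn := fun i : Fin k => interleave n i)
    (fun i j _ => by rw [Set.disjoint_left]; exact fun x hx => absurd hx (not_mem_range_of_isEmpty _ x))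
    (fun i j hij => interleave_disjoint n hij)
  -- With the no-prover independent, `V₂ N₁ V₁` is a tensor product of copies after the joint move
  -- of the yes-prover, and `V₀` is one before it. Only the combining circuit is not of this form.
  have hop : gameOp (D.repeated k neg V) y' (n * k) Y' (repeatedNo k N) =
      lift (verifierWires y' (V.mY * k) (repeatedWork D.anc V.work k) (V.mN * k) (n * k))
        (Circuit.op (D.combine V.mY V.work V.mN k neg)) *
        (tens (descending k le_rfl)
          (fun i => gameCopy D V.mY V.work V.mN (fy i) (interleave n i) i)
          (fun _ => opAfterYes V n N) *
        (lift (yesWires y' (V.mY * k) (repeatedWork D.anc V.work k) (V.mN * k) (n * k)) Y' *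
          tens (descending k le_rfl)
          (fun i => gameCopy D V.mY V.work V.mN (fy i) (interleave n i) i)
          fun _ => opBeforeYes V n)) := by
    simp only [opAfterYes, opBeforeYes]
    rw [← tens_mul hc (nodup_descending _), ← tens_mul hc (nodup_descending _),
      ← lift_copies D 0 n fy fun i => interleave n i, ← lift_copies D 0 n fy fun i => interleave n i,
      ← lift_copies D 0 n fy fun i => interleave n i, ← lift_repeatedNo D 0 n V.mY V.work fy]
    unfold gameOp
    rw [show Circuit.op (D.repeated k neg V).V2 =
      Circuit.op (D.combine V.mY V.work V.mN k neg) * Circuit.op (D.copies k V.V2) from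
      Circuit.op_append _ _]
    erw [lift_mul]
    simp only [mul_assoc]
    rfl
  unfold playProb
  rw [hop]
  exact key

/-- The repeated game against an arbitrary no-prover, if the yes-prover plays independently. -/
theorem playProb_repeated_no (neg b : Bool) (hk : 0 < k) {y : ℕ} {Y : Op (Fin y ⊕ Fin V.mY)}
    (hY : Y ∈ Matrix.unitaryGroup (Fin y ⊕ Fin V.mY → Bool) ℂ) {s : ℝ}
    (h : ∀ n (N : Op (Fin V.mN ⊕ Fin n)), N ∈ Matrix.unitaryGroup (Fin V.mN ⊕ Fin n → Bool) ℂ →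
      playProb b V y n Y N ≤ s) {n' : ℕ} {N' : Op (Fin (D.repeated k neg V).mN ⊕ Fin n')}
    (hN' : N' ∈ Matrix.unitaryGroup (Fin (D.repeated k neg V).mN ⊕ Fin n' → Bool) ℂ) :
    (b = !neg → playProb b (D.repeated k neg V) (y * k) n' (repeatedYes k Y) N' ≤ s ^ k) ∧
    (b = neg → playProb b (D.repeated k neg V) (y * k) n' (repeatedYes k Y) N' ≤ k * s) := by
  let fn : Fin k → Fin 0 ↪ Fin n' := fun _ => ⟨Fin.elim0, fun i => i.elim0⟩
  have hT : (opAfterNo V y)ᴴ * opAfterNo V y = 1 :=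
    conjTranspose_mul_self_of_mem_unitaryGroup
      (lift_mem_unitaryGroup _ (Circuit.op_mem_unitaryGroup _))
  have hP : (opBeforeNo V y Y)ᴴ * opBeforeNo V y Y = 1 :=
    conjTranspose_mul_self_of_mem_unitaryGroup (mul_mem
      (lift_mem_unitaryGroup _ (Circuit.op_mem_unitaryGroup _)) (mul_mem
        (lift_mem_unitaryGroup _ hY)
        (lift_mem_unitaryGroup _ (Circuit.op_mem_unitaryGroup _))))
  have hfn : ∀ i j, i ≠ j → Disjoint (Set.range (fn i)) (Set.range (fn j)) := fun i j _ => by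
    rw [Set.disjoint_left]
    exact fun x hx => absurd hx (not_mem_range_of_isEmpty _ x)
  have key := combined_game_le D (noMessage y V.mY V.work V.mN) (noRest y V.mY V.work V.mN)
    (isCompl_noMessage _ _ _ _) hT hP neg b (playerBound_no V h) hk
    (fy := fun i => interleave y i) (fn := fn) (fun i j hij => interleave_disjoint y hij) hfn
    (U := lift (noWires (y * k) (V.mY * k) (repeatedWork D.anc V.work k) (V.mN * k) n') N')
    (conjTranspose_mul_self_of_mem_unitaryGroup (lift_mem_unitaryGroup _ hN'))
    (fun i X => lift_commute _ _ (by
      rw [Set.disjoint_left]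
      rintro _ ⟨w | w, rfl⟩ ⟨w' | w' | w', hw⟩ <;> cases hw) _ _)
    (fun t ht X => lift_commute _ _ (by
      rw [Set.disjoint_left]
      rintro _ ⟨w | w, rfl⟩ ⟨w', hw⟩ <;> cases hw) _ _)
  have hc := gameCopy_disjoint D (mY := V.mY) (work := V.work) (mN := V.mN)
    (fy := fun i : Fin k => interleave y i) (fn := fn)
    (fun i j hij => interleave_disjoint y hij) hfn
  -- Here `V₁ Y₁ V₀` precedes the joint move and the copies of `V₂` follow it.
  have hop : gameOp (D.repeated k neg V) (y * k) n' (repeatedYes k Y) N' =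
      lift (verifierWires (y * k) (V.mY * k) (repeatedWork D.anc V.work k) (V.mN * k) n')
        (Circuit.op (D.combine V.mY V.work V.mN k neg)) *
        (tens (descending k le_rfl)
          (fun i => gameCopy D V.mY V.work V.mN (interleave y i) (fn i) i)
          (fun _ => opAfterNo V y) *
        (lift (noWires (y * k) (V.mY * k) (repeatedWork D.anc V.work k) (V.mN * k) n') N' *
          tens (descending k le_rfl)
          (fun i => gameCopy D V.mY V.work V.mN (interleave y i) (fn i) i)
          fun _ => opBeforeNo V y Y)) := by
    simp only [opAfterNo, opBeforeNo]
    rw [← tens_mul hc (nodup_descending _), ← tens_mul hc (nodup_descending _),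
      ← lift_copies D y 0 (fun i => interleave y i) fn,
      ← lift_copies D y 0 (fun i => interleave y i) fn,
      ← lift_copies D y 0 (fun i => interleave y i) fn,
      ← lift_repeatedYes D y 0 V.work V.mN fn]
    unfold gameOp
    rw [show Circuit.op (D.repeated k neg V).V2 =
      Circuit.op (D.combine V.mY V.work V.mN k neg) * Circuit.op (D.copies k V.V2) from
      Circuit.op_append _ _]
    erw [lift_mul]
    simp only [mul_assoc]
    rfl
  unfold playProb
  rw [hop]
  exact key

end Strategies

end ShortQuantumGames

namespace ShortQuantumGames

open Matrix

/-! ### From single inputs to languages -/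

section Repetition

variable {G : GateSet} (D : ClassicalGates G)

/-- A prover fixes a unitary for every input at once. To test one unitary at the input `x`, a
trivial prover is changed at `x` only; the number of private qubits and the unitary change as a
pair, since the type of the latter depends on the former. -/
theorem playProb_le_of_forall_noProver {V : List Bool → VerifierCircuits G} {b : Bool}
    {Y : YesProver V} {x : List Bool} {s : ℝ} (h : ∀ N : NoProver V, outcomeProb b V Y N x ≤ s)
    (n : ℕ) (N : Op (Fin (V x).mN ⊕ Fin n))
    (hN : N ∈ Matrix.unitaryGroup (Fin (V x).mN ⊕ Fin n → Bool) ℂ) :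
    playProb b (V x) (Y.priv x) n (Y.op x) N ≤ s := by
  let F : ∀ x, Σ n, Matrix.unitaryGroup (Fin (V x).mN ⊕ Fin n → Bool) ℂ :=
    Function.update (fun _ => ⟨0, 1⟩) x ⟨n, N, hN⟩
  have hF : F x = ⟨n, N, hN⟩ := Function.update_self _ _ _
  have key := h ⟨fun x => (F x).1, fun x => (F x).2⟩
  rw [outcomeProb_eq_playProb] at key
  change (fun q : Σ n, Matrix.unitaryGroup (Fin (V x).mN ⊕ Fin n → Bool) ℂ =>
    playProb b (V x) (Y.priv x) q.1 (Y.op x) q.2) (F x) ≤ s at key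
  rwa [hF] at key

theorem playProb_le_of_forall_yesProver {V : List Bool → VerifierCircuits G} {b : Bool}
    {N : NoProver V} {x : List Bool} {s : ℝ} (h : ∀ Y : YesProver V, outcomeProb b V Y N x ≤ s)
    (y : ℕ) (Y : Op (Fin y ⊕ Fin (V x).mY))
    (hY : Y ∈ Matrix.unitaryGroup (Fin y ⊕ Fin (V x).mY → Bool) ℂ) :
    playProb b (V x) y (N.priv x) Y (N.op x) ≤ s := by
  let F : ∀ x, Σ y, Matrix.unitaryGroup (Fin y ⊕ Fin (V x).mY → Bool) ℂ :=
    Function.update (fun _ => ⟨0, 1⟩) x ⟨y, Y, hY⟩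
  have hF : F x = ⟨y, Y, hY⟩ := Function.update_self _ _ _
  have key := h ⟨fun x => (F x).1, fun x => (F x).2⟩
  rw [outcomeProb_eq_playProb] at key
  change (fun q : Σ y, Matrix.unitaryGroup (Fin y ⊕ Fin (V x).mY → Bool) ℂ =>
    playProb b (V x) q.1 (N.priv x) q.2 (N.op x)) (F x) ≤ s at key
  rwa [hF] at key

/-- The verifier that plays `k |x|` copies of the game on input `x`. -/
def repeatedVerifier (k : ℕ → ℕ) (neg : Bool) (V : List Bool → VerifierCircuits G)
    (x : List Bool) : VerifierCircuits G :=
  D.repeated (k x.length) neg (V x)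

theorem repeatedVerifier_V0 (k : ℕ → ℕ) (neg : Bool) {V : List Bool → VerifierCircuits G}
    {x : List Bool} (h : (V x).V0 = []) : (repeatedVerifier D k neg V x).V0 = [] := by
  change D.copies (k x.length) (V x).V0 = []
  rw [h, ClassicalGates.copies, List.flatMap_eq_nil_iff]
  exact fun _ _ => rfl

variable {k : ℕ → ℕ} (hk : ∀ n, 0 < k n) {V : List Bool → VerifierCircuits G}
  {L : Set (List Bool)} {c s : ℕ → ℝ}
include hk

/-- Rejection is the outcome `false`. It equals `neg` for the conjunction, where one rejecting copy
suffices, and `!neg` for the disjunction, where all copies must reject. -/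
theorem repeated_completeness (neg : Bool)
    (h : ∃ Y : YesProver V, ∀ N : NoProver V, ∀ x ∈ L, rejectProb V Y N x ≤ c x.length) :
    ∃ Y : YesProver (repeatedVerifier D k neg V), ∀ N : NoProver (repeatedVerifier D k neg V),
      ∀ x ∈ L, (neg = true → rejectProb (repeatedVerifier D k neg V) Y N x ≤
        c x.length ^ k x.length) ∧
        (neg = false → rejectProb (repeatedVerifier D k neg V) Y N x ≤
          k x.length * c x.length) := by
  obtain ⟨Y, hY⟩ := h
  refine ⟨⟨fun x => Y.priv x * k x.length, fun x => ⟨repeatedYes (k x.length) (Y.op x),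
    tens_mem_unitaryGroup _ _ fun _ => (Y.op x).2⟩⟩, fun N x hx => ?_⟩
  unfold rejectProb
  rw [outcomeProb_eq_playProb]
  have := playProb_repeated_no D (V x) neg false (hk x.length) (Y.op x).2
    (playProb_le_of_forall_noProver fun N => hY N x hx) (N.op x).2
  exact ⟨fun h => this.1 (by rw [h]; rfl), fun h => this.2 h.symm⟩

theorem repeated_soundness (neg : Bool)
    (h : ∃ N : NoProver V, ∀ Y : YesProver V, ∀ x ∉ L, acceptProb V Y N x ≤ s x.length) :
    ∃ N : NoProver (repeatedVerifier D k neg V), ∀ Y : YesProver (repeatedVerifier D k neg V),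
      ∀ x ∉ L, (neg = false → acceptProb (repeatedVerifier D k neg V) Y N x ≤
        s x.length ^ k x.length) ∧
        (neg = true → acceptProb (repeatedVerifier D k neg V) Y N x ≤
          k x.length * s x.length) := by
  obtain ⟨N, hN⟩ := h
  refine ⟨⟨fun x => N.priv x * k x.length, fun x => ⟨repeatedNo (k x.length) (N.op x),
    tens_mem_unitaryGroup _ _ fun _ => (N.op x).2⟩⟩, fun Y x hx => ?_⟩
  unfold acceptProb
  rw [outcomeProb_eq_playProb]
  have := playProb_repeated_yes D (V x) neg true (hk x.length) (N.op x).2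
    (playProb_le_of_forall_yesProver fun Y => hN Y x hx) (Y.op x).2
  exact ⟨fun h => this.1 (by rw [h]; rfl), fun h => this.2 h.symm⟩

theorem Decides.repeated_and (h : Decides V L c s) :
    Decides (repeatedVerifier D k false V) L (fun n => k n * c n) fun n => s n ^ k n := by
  obtain ⟨Y, hY⟩ := repeated_completeness D hk false h.1
  obtain ⟨N, hN⟩ := repeated_soundness D hk false h.2
  exact ⟨⟨Y, fun N x hx => (hY N x hx).2 rfl⟩, ⟨N, fun Y x hx => (hN Y x hx).1 rfl⟩⟩

theorem Decides.repeated_or (h : Decides V L c s) :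
    Decides (repeatedVerifier D k true V) L (fun n => c n ^ k n) fun n => k n * s n := by
  obtain ⟨Y, hY⟩ := repeated_completeness D hk true h.1
  obtain ⟨N, hN⟩ := repeated_soundness D hk true h.2
  exact ⟨⟨Y, fun N x hx => (hY N x hx).1 rfl⟩, ⟨N, fun Y x hx => (hN Y x hx).2 rfl⟩⟩

end Repetition

end ShortQuantumGames

/-! ### Polynomial-time computation of the description of the repeated verifier -/

namespace ShortQuantumGames

open Turing Function

/-! ### Stack programs -/

/-- The deterministic transition function `f` leads from `a` to `b` in at most `t` steps. -/
def RunsIn {α : Type} (f : α → Option α) (t : ℕ) (a b : α) : Prop :=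
  ∃ n ≤ t, (flip bind f)^[n] (some a) = some b

namespace RunsIn

variable {α : Type} {f : α → Option α} {a b c : α} {s t : ℕ}

theorem refl (a : α) : RunsIn f 0 a a := ⟨0, le_rfl, rfl⟩

theorem single (h : f a = some b) : RunsIn f 1 a b := ⟨1, le_rfl, h⟩

theorem trans (h : RunsIn f s a b) (h' : RunsIn f t b c) : RunsIn f (s + t) a c := by
  obtain ⟨n, hn, h⟩ := h
  obtain ⟨m, hm, h'⟩ := h'
  refine ⟨n + m, add_le_add hn hm, ?_⟩
  rw [Nat.add_comm n m, iterate_add_apply, h, h']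

end RunsIn

theorem iterate_bind_none {α : Type} (f : α → Option α) (n : ℕ) :
    (flip bind f)^[n] none = none := by
  induction n with
  | zero => rfl
  | succ n ih => rw [iterate_succ_apply]; exact ih

section Programs

variable {W : Type} (ΓW : W → Type) {ι : Type} (tm : ι → FinTM2) (B : Type)

/-- The stacks of a program: work stacks and the stacks of the machines it may call. -/
abbrev StackIx (W : Type) {ι : Type} (tm : ι → FinTM2) : Type := W ⊕ Σ i, (tm i).K

/-- The alphabets of the stacks. -/
abbrev StackAlphabet : StackIx W tm → Type
  | Sum.inl w => ΓW w
  | Sum.inr p => (tm p.1).Γ p.2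

/-- The internal states of a program: one symbol that was read, and the states of the machines. -/
abbrev ProgState {ι : Type} (tm : ι → FinTM2) (B : Type) : Type := Option B × ∀ i, (tm i).σ

/-- Structured programs on stacks. The program `loop j f body` pops symbols `a` from the stack `j`
and executes `body b` as long as `f a = some b`. The program `call i` runs the machine `tm i`. -/
inductive Prog
  | skip
  | push (j : StackIx W tm) (a : StackAlphabet ΓW tm j)
  | seq (p q : Prog)
  | loop (j : StackIx W tm) (f : StackAlphabet ΓW tm j → Option B) (body : B → Prog)
  | call (i : ι)

variable [DecidableEq W] [DecidableEq ι]

/-- The execution of a program with an exact number of steps. -/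
inductive Exec : Prog ΓW tm B → (∀ j, List (StackAlphabet ΓW tm j)) →
    (∀ j, List (StackAlphabet ΓW tm j)) → ℕ → Prop
  | skip (S) : Exec .skip S S 1
  | push (S) (j) (a) : Exec (.push j a) S (update S j (a :: S j)) 1
  | seq {p q S S₁ S₂ t₁ t₂} : Exec p S S₁ t₁ → Exec q S₁ S₂ t₂ → Exec (.seq p q) S S₂ (t₁ + t₂)
  | loop_nil {j f body S} : S j = [] → Exec (.loop j f body) S S 1
  | loop_exit {j f body S a l} : S j = a :: l → f a = none →
      Exec (.loop j f body) S (update S j l) 1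
  | loop_step {j f body S a l b S₁ S₂ t₁ t₂} : S j = a :: l → f a = some b →
      Exec (body b) (update S j l) S₁ t₁ → Exec (.loop j f body) S₁ S₂ t₂ →
      Exec (.loop j f body) S S₂ (1 + t₁ + t₂)
  | call {i S S' l l' n} : (flip bind (tm i).step)^[n] (some (initList (tm i) l)) =
        some (haltList (tm i) l') → (∀ k, S (Sum.inr ⟨i, k⟩) = (initList (tm i) l).stk k) →
      (∀ k, S' (Sum.inr ⟨i, k⟩) = (haltList (tm i) l').stk k) →
      (∀ j, (∀ k, j ≠ Sum.inr ⟨i, k⟩) → S' j = S j) → Exec (.call i) S S' (1 + n)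

variable {ΓW tm B}

/-- The translation of a statement of the machine `tm i`. -/
def embedStmt (i : ι) {Λ' : Type} (e : (tm i).Λ → Λ') (x : Λ') :
    TM2.Stmt (tm i).Γ (tm i).Λ (tm i).σ → TM2.Stmt (StackAlphabet ΓW tm) Λ' (ProgState tm B)
  | .push k f q => .push (Sum.inr ⟨i, k⟩) (fun v => f (v.2 i)) (embedStmt i e x q)
  | .peek k f q => .peek (Sum.inr ⟨i, k⟩) (fun v o => (v.1, update v.2 i (f (v.2 i) o)))
      (embedStmt i e x q)
  | .pop k f q => .pop (Sum.inr ⟨i, k⟩) (fun v o => (v.1, update v.2 i (f (v.2 i) o)))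
      (embedStmt i e x q)
  | .load f q => .load (fun v => (v.1, update v.2 i (f (v.2 i)))) (embedStmt i e x q)
  | .branch f q q' => .branch (fun v => f (v.2 i)) (embedStmt i e x q) (embedStmt i e x q')
  | .goto f => .goto fun v => e (f (v.2 i))
  | .halt => .goto fun _ => x

/-- A configuration of a program that represents a configuration of `tm i`. -/
structure Represents (i : ι) {Λ' : Type} (e : (tm i).Λ → Λ') (x : Λ')
    (S₀ : ∀ j, List (StackAlphabet ΓW tm j)) (c : (tm i).Cfg)
    (d : TM2.Cfg (StackAlphabet ΓW tm) Λ' (ProgState tm B)) : Prop where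
  label : d.l = some (c.l.elim x e)
  var : d.var.2 i = c.var
  stk : ∀ k, d.stk (Sum.inr ⟨i, k⟩) = c.stk k
  rest : ∀ j, (∀ k, j ≠ Sum.inr ⟨i, k⟩) → d.stk j = S₀ j

/-- Translated statements act as the original ones on the stacks and the state of machine `i` and
leave all other stacks alone. Halting becomes a jump to `x`, so the simulation takes no additional
step. -/
theorem represents_stepAux (i : ι) {Λ' : Type} (e : (tm i).Λ → Λ') (x : Λ')
    (S₀ : ∀ j, List (StackAlphabet ΓW tm j)) (q : TM2.Stmt (tm i).Γ (tm i).Λ (tm i).σ)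
    {v : (tm i).σ} {T : ∀ k, List ((tm i).Γ k)} {v' : ProgState tm B}
    {S : ∀ j, List (StackAlphabet ΓW tm j)} (hv : v'.2 i = v)
    (hT : ∀ k, S (Sum.inr ⟨i, k⟩) = T k)
    (hS : ∀ j, (∀ k, j ≠ Sum.inr ⟨i, k⟩) → S j = S₀ j) :
    Represents i e x S₀ (TM2.stepAux q v T) (TM2.stepAux (embedStmt i e x q) v' S) := by
  have hup : ∀ {S : ∀ j, List (StackAlphabet ΓW tm j)} {T : ∀ k, List ((tm i).Γ k)}
      (k : (tm i).K) (l : List ((tm i).Γ k)), (∀ k, S (Sum.inr ⟨i, k⟩) = T k) →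
      ∀ k', update S (Sum.inr ⟨i, k⟩) l (Sum.inr ⟨i, k'⟩) = update T k l k' := by
    intro S T k l hT k'
    by_cases h : k' = k
    · subst h
      rw [update_self, update_self]
    · rw [update_of_ne h, update_of_ne (by simpa using h), hT]
  have hre : ∀ {S : ∀ j, List (StackAlphabet ΓW tm j)} (k : (tm i).K) (l : List ((tm i).Γ k)),
      (∀ j, (∀ k, j ≠ Sum.inr ⟨i, k⟩) → S j = S₀ j) →
      ∀ j, (∀ k, j ≠ Sum.inr ⟨i, k⟩) → update S (Sum.inr ⟨i, k⟩) l j = S₀ j :=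
    fun k l h j hj => by rw [update_of_ne (hj k), h j hj]
  induction q generalizing v T v' S with
  | push k f q ih =>
    simp only [embedStmt, TM2.stepAux]
    rw [hv, hT]
    exact ih hv (hup k _ hT) (hre k _ hS)
  | peek k f q ih =>
    simp only [embedStmt, TM2.stepAux]
    exact ih (by simp [hv, hT]) hT hS
  | pop k f q ih =>
    simp only [embedStmt, TM2.stepAux]
    refine ih (by simp [hv, hT]) ?_ (hre k _ hS)
    rw [hT]
    exact hup k _ hT
  | load f q ih =>
    simp only [embedStmt, TM2.stepAux]
    exact ih (by simp [hv]) hT hS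
  | branch f q q' ih ih' =>
    simp only [embedStmt, TM2.stepAux, hv]
    cases f v
    · exact ih' hv hT hS
    · exact ih hv hT hS
  | goto f => exact ⟨by simp [embedStmt, hv], hv, hT, hS⟩
  | halt => exact ⟨rfl, hv, hT, hS⟩

theorem represents_iterate (i : ι) {Λ' : Type} (e : (tm i).Λ → Λ') (x : Λ')
    (S₀ : ∀ j, List (StackAlphabet ΓW tm j))
    {M : Λ' → TM2.Stmt (StackAlphabet ΓW tm) Λ' (ProgState tm B)}
    (hM : ∀ l, M (e l) = embedStmt i e x ((tm i).m l)) {n : ℕ} {c c' : (tm i).Cfg}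
    (h : (flip bind (tm i).step)^[n] (some c) = some c')
    {d : TM2.Cfg (StackAlphabet ΓW tm) Λ' (ProgState tm B)} (hd : Represents i e x S₀ c d) :
    ∃ d', RunsIn (TM2.step M) n d d' ∧ Represents i e x S₀ c' d' := by
  induction n generalizing c d with
  | zero =>
    obtain rfl : c = c' := Option.some.inj h
    exact ⟨d, RunsIn.refl d, hd⟩
  | succ n ih =>
    rw [iterate_succ_apply] at h
    obtain ⟨l, v, T⟩ := c
    obtain ⟨l', v', S⟩ := d
    obtain ⟨h1, h2, h3, h4⟩ := hd
    cases l with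
    | none => exact absurd ((iterate_bind_none _ n).symm.trans h) (by simp)
    | some l =>
      simp only at h1 h2 h3 h4
      subst h1
      obtain ⟨d', hd', hr⟩ := ih h (represents_stepAux i e x S₀ ((tm i).m l) h2 h3 h4)
      refine ⟨d', ?_, hr⟩
      rw [Nat.add_comm]
      refine RunsIn.trans (RunsIn.single ?_) hd'
      simp [hM]

/-- A program is implemented by a fragment of a machine: a set of labels with code that can be
placed into any machine `M` by means of `e`, and continues with the label `x`. -/
def Implemented [Fintype ι] (p : Prog ΓW tm B) : Prop :=
  ∃ (Λ : Type) (_ : Fintype Λ) (start : Λ) (m : ∀ Λ' : Type, (Λ → Λ') → Λ' → Λ →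
      TM2.Stmt (StackAlphabet ΓW tm) Λ' (ProgState tm B)),
    ∀ (Λ' : Type) (M : Λ' → TM2.Stmt (StackAlphabet ΓW tm) Λ' (ProgState tm B)) (e : Λ → Λ')
      (x : Λ'), (∀ l, M (e l) = m Λ' e x l) → ∀ S S' t, Exec ΓW tm B p S S' t → ∀ v,
        ∃ v', RunsIn (TM2.step M) t ⟨some (e start), v, S⟩ ⟨some x, v', S'⟩

/-- Every construct joins the labels of its parts, with some of its own where needed. As a fragment
is written for an arbitrary target label type, embedding and exit label, it can be placed inside a
larger fragment unchanged. -/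
theorem Prog.implemented [Fintype ι] [Fintype B] (p : Prog ΓW tm B) : Implemented p := by
  induction p with
  | skip =>
    refine ⟨Unit, inferInstance, (), fun Λ' e x _ => .goto fun _ => x, ?_⟩
    intro Λ' M e x hM S S' t h v
    cases h
    exact ⟨v, RunsIn.single (by simp [hM])⟩
  | push j a =>
    refine ⟨Unit, inferInstance, (), fun Λ' e x _ => .push j (fun _ => a) (.goto fun _ => x), ?_⟩
    intro Λ' M e x hM S S' t h v
    cases h
    exact ⟨v, RunsIn.single (by simp [hM])⟩
  | seq p q hp hq =>
    obtain ⟨Λ₁, _, s₁, m₁, h₁⟩ := hp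
    obtain ⟨Λ₂, _, s₂, m₂, h₂⟩ := hq
    refine ⟨Λ₁ ⊕ Λ₂, inferInstance, Sum.inl s₁, fun Λ' e x => Sum.elim
      (m₁ Λ' (e ∘ Sum.inl) (e (Sum.inr s₂))) (m₂ Λ' (e ∘ Sum.inr) x), ?_⟩
    intro Λ' M e x hM S S' t h v
    cases h with
    | seq hp hq =>
      obtain ⟨v₁, r₁⟩ := h₁ Λ' M (e ∘ Sum.inl) (e (Sum.inr s₂)) (fun l => hM (Sum.inl l)) _ _ _ hp v
      obtain ⟨v₂, r₂⟩ := h₂ Λ' M (e ∘ Sum.inr) x (fun l => hM (Sum.inr l)) _ _ _ hq v₁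
      exact ⟨v₂, r₁.trans r₂⟩
  | loop j f body hb =>
    choose Λb fb sb mb hb using hb
    -- The label `none` is the head of the loop, which pops a symbol and branches. There is a
    -- separate copy of the body for each letter `b`, so the letter is remembered by the label and
    -- the body may overwrite the state.
    refine ⟨Option (Σ b, Λb b), inferInstance, none, fun Λ' e x l => l.elim
      (.pop j (fun v o => (o.bind f, v.2)) (.goto fun v => v.1.elim x fun b => e (some ⟨b, sb b⟩)))
      fun l => mb l.1 Λ' (fun l' => e (some ⟨l.1, l'⟩)) (e none) l.2, ?_⟩
    intro Λ' M e x hM S S' t h v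
    have hhead : ∀ S v, TM2.step M ⟨some (e none), v, S⟩ = some ⟨some
        (((S j).head?.bind f).elim x fun b => e (some ⟨b, sb b⟩)), ((S j).head?.bind f, v.2),
        update S j (S j).tail⟩ := by
      intro S v
      simp [hM]
    generalize hp : Prog.loop j f body = p at h
    induction h generalizing v with
    | skip => cases hp
    | push => cases hp
    | seq => cases hp
    | call => cases hp
    | loop_nil h =>
      cases hp
      refine ⟨(none, v.2), RunsIn.single ((hhead _ _).trans ?_)⟩
      rw [h, show (List.tail [] : List (StackAlphabet ΓW tm j)) = [] from rfl, ← h,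
        update_eq_self]
      simp [h]
    | loop_exit h h' =>
      cases hp
      refine ⟨(none, v.2), RunsIn.single ((hhead _ _).trans ?_)⟩
      simp [h, h']
    | @loop_step _ _ _ S a l b S₁ S₂ t₁ t₂ h h' hbody hloop _ ih =>
      cases hp
      obtain ⟨v₁, r₁⟩ := hb b Λ' M (fun l' => e (some ⟨b, l'⟩)) (e none)
        (fun l' => hM (some ⟨b, l'⟩)) _ _ _ hbody (some b, v.2)
      obtain ⟨v₂, r₂⟩ := ih v₁ rfl
      refine ⟨v₂, RunsIn.trans (RunsIn.trans (RunsIn.single ((hhead _ _).trans ?_)) r₁) r₂⟩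
      simp [h, h']
  | call i =>
    -- The label `none` resets the internal state of the called machine; this is the extra step in
    -- `1 + n`.
    refine ⟨Option (tm i).Λ, @instFintypeOption _ (tm i).ΛFin, none, fun Λ' e x l => l.elim
      (.load (fun v => (v.1, update v.2 i (tm i).initialState))
        (.goto fun _ => e (some (tm i).main)))
      fun l => embedStmt i (fun l => e (some l)) x ((tm i).m l), ?_⟩
    intro Λ' M e x hM S S' t h v
    cases h with
    | @call _ _ _ l l' n h hS hS' hr =>
      obtain ⟨⟨d1, d2, d3⟩, r, hd⟩ := represents_iterate i (fun l => e (some l)) x S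
        (fun l => hM (some l)) h
        (d := ⟨some (e (some (tm i).main)), (v.1, update v.2 i (tm i).initialState), S⟩)
        ⟨rfl, update_self _ _ _, hS, fun _ _ => rfl⟩
      have h1 : d1 = some x := hd.label
      have h3 : d3 = S' := by
        funext j
        by_cases hj : ∃ k, j = Sum.inr ⟨i, k⟩
        · obtain ⟨k, rfl⟩ := hj
          rw [hS']
          exact hd.stk k
        · push Not at hj
          rw [hr j hj]
          exact hd.rest j hj
      subst h1 h3
      exact ⟨_, RunsIn.trans (RunsIn.single (by simp [hM])) r⟩

end Programs

end ShortQuantumGames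

namespace ShortQuantumGames

open Turing Function

/-! ### Machines and programs -/

/-- The number of push operations in a statement. -/
def pushCount {K : Type} {Γ : K → Type} {Λ σ : Type} : TM2.Stmt Γ Λ σ → ℕ
  | .push _ _ q => pushCount q + 1
  | .peek _ _ q => pushCount q
  | .pop _ _ q => pushCount q
  | .load _ q => pushCount q
  | .branch _ q q' => pushCount q + pushCount q'
  | .goto _ => 0
  | .halt => 0

theorem length_stepAux_le {K : Type} [DecidableEq K] {Γ : K → Type} {Λ σ : Type}
    (q : TM2.Stmt Γ Λ σ) (v : σ) (S : ∀ k, List (Γ k)) (k : K) :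
    ((TM2.stepAux q v S).stk k).length ≤ (S k).length + pushCount q := by
  induction q generalizing v S with
  | push k' f q ih =>
    refine (ih _ _).trans ?_
    by_cases h : k = k'
    · subst h
      rw [update_self, List.length_cons, pushCount]
      omega
    · rw [update_of_ne h, pushCount]
      omega
  | peek k' f q ih => exact ih _ _
  | pop k' f q ih =>
    refine (ih _ _).trans ?_
    by_cases h : k = k'
    · subst h
      rw [update_self, List.length_tail, pushCount]
      omega
    · rw [update_of_ne h, pushCount]
  | load f q ih => exact ih _ _
  | branch f q q' ih ih' =>
    rw [TM2.stepAux, pushCount]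
    cases f v
    · exact (ih' v S).trans (by omega)
    · exact (ih v S).trans (by omega)
  | goto f => exact le_rfl
  | halt => exact le_rfl

theorem initList_stk (tm : FinTM2) (l : List (tm.Γ tm.k₀)) :
    (initList tm l).stk = update (fun _ => []) tm.k₀ l := by
  funext k
  by_cases h : k = tm.k₀
  · subst h
    simp [initList]
  · simp [initList, h]

theorem haltList_stk (tm : FinTM2) (l : List (tm.Γ tm.k₁)) :
    (haltList tm l).stk = update (fun _ => []) tm.k₁ l := by
  funext k
  by_cases h : k = tm.k₁
  · subst h
    simp [haltList]
  · simp [haltList, h]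

/-- The output of a machine is at most as long as its input and a multiple of its running time. -/
theorem exists_length_output_le (tm : FinTM2) : ∃ D : ℕ, ∀ (l : List (tm.Γ tm.k₀))
    (l' : List (tm.Γ tm.k₁)) (n : ℕ), (flip bind tm.step)^[n] (some (initList tm l)) =
      some (haltList tm l') → l'.length ≤ l.length + n * D := by
  let := tm.ΛFin
  -- One step executes a single statement of the machine, so it pushes at most as many symbols as
  -- occur in its whole code.
  refine ⟨∑ q : tm.Λ, pushCount (tm.m q), fun l l' n h => ?_⟩
  have key : ∀ (n : ℕ) (c c' : tm.Cfg), (flip bind tm.step)^[n] (some c) = some c' → ∀ k,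
      (c'.stk k).length ≤ (c.stk k).length + n * ∑ q : tm.Λ, pushCount (tm.m q) := by
    intro n
    induction n with
    | zero =>
      intro c c' h k
      obtain rfl : c = c' := Option.some.inj h
      omega
    | succ n ih =>
      intro c c' h k
      rw [iterate_succ_apply] at h
      obtain ⟨q, v, S⟩ := c
      cases q with
      | none => exact absurd ((iterate_bind_none _ n).symm.trans h) (by simp)
      | some q =>
        have h1 := ih _ _ h k
        have h2 := length_stepAux_le (tm.m q) v S k
        have h3 : pushCount (tm.m q) ≤ ∑ q : tm.Λ, pushCount (tm.m q) :=
          Finset.single_le_sum (f := fun q => pushCount (tm.m q)) (fun _ _ => Nat.zero_le _)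
            (Finset.mem_univ q)
        rw [Nat.succ_mul]
        simp only at h1 h2 ⊢
        omega
  have h1 := key n _ _ h tm.k₁
  rw [initList_stk, haltList_stk, update_self] at h1
  refine h1.trans (Nat.add_le_add_right ?_ _)
  -- The output stack is initially empty unless it is also the input stack, in which case it holds
  -- the input.
  by_cases hk : tm.k₁ = tm.k₀
  · have : ∀ (k : tm.K) (hk : k = tm.k₀),
        (update (fun _ => []) tm.k₀ l k : List (tm.Γ k)).length ≤ l.length := by
      rintro _ rfl
      rw [update_self]
    exact this _ hk
  · rw [update_of_ne hk]
    exact Nat.zero_le _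

/-- A function that is computed by a program in polynomial time is computable in polynomial
time. -/
theorem nonempty_tm2ComputableInPolyTime {W : Type} [DecidableEq W] [Fintype W] {ΓW : W → Type}
    {ι : Type} [DecidableEq ι] [Fintype ι] {tm : ι → FinTM2} {B : Type} [Fintype B]
    (p : Prog ΓW tm B) {w₀ w₁ : W} [Fintype (ΓW w₀)] {α β : Type} {ea : α → List (ΓW w₀)}
    {eb : β → List (ΓW w₁)} {f : α → β} (T : Polynomial ℕ)
    (h : ∀ a, ∃ t ≤ T.eval (ea a).length, Exec ΓW tm B p (update (fun _ => []) (Sum.inl w₀) (ea a))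
      (update (fun _ => []) (Sum.inl w₁) (eb (f a))) t) :
    Nonempty (TM2ComputableInPolyTime ea eb f) := by
  obtain ⟨Λ, _, start, m, hm⟩ := p.implemented
  let : ∀ i, Fintype (tm i).K := fun i => (tm i).kFin
  let : ∀ i, Fintype (tm i).σ := fun i => (tm i).σFin
  -- The exit label restores the initial state demanded by `haltList` and halts, which costs the
  -- additional step in `T + 1`.
  let M : Option Λ → TM2.Stmt (StackAlphabet ΓW tm) (Option Λ) (ProgState tm B) := fun l =>
    l.elim (.load (fun _ => (none, fun i => (tm i).initialState)) .halt) (m _ some none)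
  let big : FinTM2 :=
    { K := StackIx W tm
      k₀ := Sum.inl w₀
      k₁ := Sum.inl w₁
      Γ := StackAlphabet ΓW tm
      Λ := Option Λ
      main := some start
      σ := ProgState tm B
      initialState := (none, fun i => (tm i).initialState)
      Γk₀Fin := inferInstanceAs (Fintype (ΓW w₀))
      m := M }
  refine ⟨{ tm := big
            inputAlphabet := Equiv.refl _
            outputAlphabet := Equiv.refl _
            time := T + 1
            outputsFun := fun a => ?_ }⟩
  have key : ∃ n ≤ (T + 1).eval (ea a).length, (flip bind big.step)^[n]
      (some (initList big (ea a))) = some (haltList big (eb (f a))) := by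
    obtain ⟨t, ht, hE⟩ := h a
    obtain ⟨v, hv⟩ := hm (Option Λ) M some none (fun _ => rfl) _ _ _ hE big.initialState
    have h1 := hv.trans (RunsIn.single (f := TM2.step M) (b := ⟨none, big.initialState,
      update (fun _ => []) (Sum.inl w₁) (eb (f a))⟩) rfl)
    obtain ⟨n, hn, h1⟩ := h1
    refine ⟨n, ?_, ?_⟩
    · rw [Polynomial.eval_add, Polynomial.eval_one]
      omega
    · have e1 : initList big (ea a) = ⟨some (some start), big.initialState,
          update (fun _ => []) (Sum.inl w₀) (ea a)⟩ := by
        rw [← initList_stk big (ea a)]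
        rfl
      have e2 : haltList big (eb (f a)) = ⟨none, big.initialState,
          update (fun _ => []) (Sum.inl w₁) (eb (f a))⟩ := by
        rw [← haltList_stk big (eb (f a))]
        rfl
      rw [e1, e2]
      exact h1
  have hl : List.map (Equiv.refl (ΓW w₀)).invFun (ea a) = ea a := List.map_id _
  have hl' : List.map (Equiv.refl (ΓW w₁)).invFun (eb (f a)) = eb (f a) := List.map_id _
  refine ⟨⟨key.choose, ?_⟩, key.choose_spec.1⟩
  refine Eq.trans ?_ (key.choose_spec.2.trans ?_)
  · exact congrArg (fun l => (flip bind big.step)^[key.choose] (some (initList big l))) hl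
  · exact congrArg (fun l => some (haltList big l)) hl'.symm

end ShortQuantumGames

namespace ShortQuantumGames

open Turing Function

/-! ### Memory of the repetition program -/

open Classical in
noncomputable instance (G : GateSet) : Fintype (Sym G) :=
  Fintype.ofSurjective (fun s : Fin G.card ⊕ Fin 3 ⊕ Bool => match s with
    | Sum.inl g => Sym.gate g
    | Sum.inr (Sum.inl r) => Sym.reg r
    | Sum.inr (Sum.inr true) => Sym.tick
    | Sum.inr (Sum.inr false) => Sym.sep) fun s => by
      cases s with
      | gate g => exact ⟨Sum.inl g, rfl⟩
      | reg r => exact ⟨Sum.inr (Sum.inl r), rfl⟩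
      | tick => exact ⟨Sum.inr (Sum.inr true), rfl⟩
      | sep => exact ⟨Sum.inr (Sum.inr false), rfl⟩

/-- The work stacks of the program that describes a repeated verifier. -/
inductive Work
  | inp | tmp | bits | cnt | cnt' | idx | idx' | desc | store | store' | rev | out
  deriving DecidableEq

instance : Fintype Work :=
  ⟨{.inp, .tmp, .bits, .cnt, .cnt', .idx, .idx', .desc, .store, .store', .rev, .out},
    fun w => by cases w <;> decide⟩

/-- The alphabets of the work stacks. -/
abbrev WorkAlphabet (G : GateSet) : Work → Type
  | .inp | .tmp | .bits => Bool
  | .cnt | .cnt' | .idx | .idx' => Unit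
  | .desc | .store | .store' | .rev | .out => Sym G

/-- Programs over the work stacks. -/
abbrev WProg (G : GateSet) (tm : Bool → FinTM2) : Type :=
  Prog (WorkAlphabet G) tm (Sym G ⊕ Bool)

/-- The contents of all stacks. -/
structure Mem (G : GateSet) (tm : Bool → FinTM2) where
  inp : List Bool
  tmp : List Bool
  bits : List Bool
  cnt : ℕ
  cnt' : ℕ
  idx : ℕ
  idx' : ℕ
  desc : List (Sym G)
  store : List (Sym G)
  store' : List (Sym G)
  rev : List (Sym G)
  out : List (Sym G)
  called : ∀ p : Σ i, (tm i).K, List ((tm p.1).Γ p.2)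

variable {G : GateSet} {tm : Bool → FinTM2}

namespace Mem

/-- The stacks, with counters in unary. -/
def stk (m : Mem G tm) : ∀ j, List (StackAlphabet (WorkAlphabet G) tm j)
  | Sum.inl .inp => m.inp
  | Sum.inl .tmp => m.tmp
  | Sum.inl .bits => m.bits
  | Sum.inl .cnt => List.replicate m.cnt ()
  | Sum.inl .cnt' => List.replicate m.cnt' ()
  | Sum.inl .idx => List.replicate m.idx ()
  | Sum.inl .idx' => List.replicate m.idx' ()
  | Sum.inl .desc => m.desc
  | Sum.inl .store => m.store
  | Sum.inl .store' => m.store'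
  | Sum.inl .rev => m.rev
  | Sum.inl .out => m.out
  | Sum.inr p => m.called p

variable (m : Mem G tm)

/-- It expresses a change of one stack as a change of one field of the record, so that programs can
be executed symbolically on records. -/
theorem update_stk_work (w : Work) (l : List (WorkAlphabet G w)) {m' : Mem G tm}
    (h : m'.stk (Sum.inl w) = l) (h' : ∀ w', w' ≠ w → m'.stk (Sum.inl w') = m.stk (Sum.inl w'))
    (h'' : m'.called = m.called) : update m.stk (Sum.inl w) l = m'.stk := by
  funext j
  rcases j with w' | p
  · by_cases hw : w' = w
    · subst hw
      rw [update_self, h]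
    · rw [update_of_ne (by simpa using hw), h' _ hw]
  · rw [update_of_ne (by simp)]
    exact (congrFun h'' p).symm

theorem update_stk_inp (l : List Bool) :
    update m.stk (Sum.inl .inp) l = { m with inp := l }.stk :=
  update_stk_work _ _ _ rfl (by rintro (_ | _) h <;> first | rfl | exact absurd rfl h) rfl

theorem update_stk_tmp (l : List Bool) :
    update m.stk (Sum.inl .tmp) l = { m with tmp := l }.stk :=
  update_stk_work _ _ _ rfl (by rintro (_ | _) h <;> first | rfl | exact absurd rfl h) rfl

theorem update_stk_bits (l : List Bool) :
    update m.stk (Sum.inl .bits) l = { m with bits := l }.stk :=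
  update_stk_work _ _ _ rfl (by rintro (_ | _) h <;> first | rfl | exact absurd rfl h) rfl

theorem update_stk_cnt (n : ℕ) :
    update m.stk (Sum.inl .cnt) (List.replicate n ()) = { m with cnt := n }.stk :=
  update_stk_work _ _ _ rfl (by rintro (_ | _) h <;> first | rfl | exact absurd rfl h) rfl

theorem update_stk_cnt' (n : ℕ) :
    update m.stk (Sum.inl .cnt') (List.replicate n ()) = { m with cnt' := n }.stk :=
  update_stk_work _ _ _ rfl (by rintro (_ | _) h <;> first | rfl | exact absurd rfl h) rfl

theorem update_stk_idx (n : ℕ) :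
    update m.stk (Sum.inl .idx) (List.replicate n ()) = { m with idx := n }.stk :=
  update_stk_work _ _ _ rfl (by rintro (_ | _) h <;> first | rfl | exact absurd rfl h) rfl

theorem update_stk_idx' (n : ℕ) :
    update m.stk (Sum.inl .idx') (List.replicate n ()) = { m with idx' := n }.stk :=
  update_stk_work _ _ _ rfl (by rintro (_ | _) h <;> first | rfl | exact absurd rfl h) rfl

theorem update_stk_desc (l : List (Sym G)) :
    update m.stk (Sum.inl .desc) l = { m with desc := l }.stk :=
  update_stk_work _ _ _ rfl (by rintro (_ | _) h <;> first | rfl | exact absurd rfl h) rfl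

theorem update_stk_store (l : List (Sym G)) :
    update m.stk (Sum.inl .store) l = { m with store := l }.stk :=
  update_stk_work _ _ _ rfl (by rintro (_ | _) h <;> first | rfl | exact absurd rfl h) rfl

theorem update_stk_store' (l : List (Sym G)) :
    update m.stk (Sum.inl .store') l = { m with store' := l }.stk :=
  update_stk_work _ _ _ rfl (by rintro (_ | _) h <;> first | rfl | exact absurd rfl h) rfl

theorem update_stk_rev (l : List (Sym G)) :
    update m.stk (Sum.inl .rev) l = { m with rev := l }.stk :=
  update_stk_work _ _ _ rfl (by rintro (_ | _) h <;> first | rfl | exact absurd rfl h) rfl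

theorem update_stk_out (l : List (Sym G)) :
    update m.stk (Sum.inl .out) l = { m with out := l }.stk :=
  update_stk_work _ _ _ rfl (by rintro (_ | _) h <;> first | rfl | exact absurd rfl h) rfl

theorem update_stk_called (p : Σ i, (tm i).K) (l : List ((tm p.1).Γ p.2)) :
    update m.stk (Sum.inr p) l = { m with called := update m.called p l }.stk := by
  funext j
  rcases j with w | q
  · rw [update_of_ne (by simp)]
    cases w <;> rfl
  · by_cases h : q = p
    · subst h
      rw [update_self]
      change l = update m.called q l q
      rw [update_self]
    · rw [update_of_ne (by simpa using h)]
      change m.called q = update m.called p l q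
      rw [update_of_ne h]

end Mem

/-- The program `p` leads from `m` to `m'` in at most `t` steps. -/
def Runs (p : WProg G tm) (m m' : Mem G tm) (t : ℕ) : Prop :=
  ∃ t' ≤ t, Exec (WorkAlphabet G) tm (Sym G ⊕ Bool) p m.stk m'.stk t'

namespace Runs

variable {p q : WProg G tm} {m m₁ m₂ : Mem G tm} {s t : ℕ}

theorem mono (h : Runs p m m₁ s) (hst : s ≤ t) : Runs p m m₁ t :=
  ⟨h.choose, h.choose_spec.1.trans hst, h.choose_spec.2⟩

theorem skip : Runs (.skip : WProg G tm) m m 1 := ⟨1, le_rfl, .skip _⟩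

theorem push {j : StackIx Work tm} {a : StackAlphabet (WorkAlphabet G) tm j}
    (h : update m.stk j (a :: m.stk j) = m₁.stk) : Runs (.push j a) m m₁ 1 :=
  ⟨1, le_rfl, h ▸ .push _ _ _⟩

theorem seq (h : Runs p m m₁ s) (h' : Runs q m₁ m₂ t) : Runs (.seq p q) m m₂ (s + t) := by
  obtain ⟨s', hs, h⟩ := h
  obtain ⟨t', ht, h'⟩ := h'
  exact ⟨s' + t', add_le_add hs ht, h.seq h'⟩

variable {j : StackIx Work tm} {f : StackAlphabet (WorkAlphabet G) tm j → Option (Sym G ⊕ Bool)}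
  {body : Sym G ⊕ Bool → WProg G tm} {a : StackAlphabet (WorkAlphabet G) tm j}
  {l : List (StackAlphabet (WorkAlphabet G) tm j)} {b : Sym G ⊕ Bool}

theorem loop_nil (h : m.stk j = []) : Runs (.loop j f body) m m 1 :=
  ⟨1, le_rfl, .loop_nil h⟩

theorem loop_exit (h : m.stk j = a :: l) (hf : f a = none) (hm : update m.stk j l = m₁.stk) :
    Runs (.loop j f body) m m₁ 1 :=
  ⟨1, le_rfl, hm ▸ .loop_exit h hf⟩

theorem loop_step {m₃ : Mem G tm} (h : m.stk j = a :: l) (hf : f a = some b)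
    (hm : update m.stk j l = m₁.stk)
    (hb : Runs (body b) m₁ m₂ s) (hl : Runs (.loop j f body) m₂ m₃ t) :
    Runs (.loop j f body) m m₃ (1 + s + t) := by
  obtain ⟨s', hs, hb⟩ := hb
  obtain ⟨t', ht, hl⟩ := hl
  exact ⟨1 + s' + t', by omega, .loop_step h hf (hm.symm ▸ hb) hl⟩

/-- Contents of the stacks of the machines where only one stack may be nonempty. -/
def only (p : Σ i, (tm i).K) (l : List ((tm p.1).Γ p.2)) :
    ∀ p : Σ i, (tm i).K, List ((tm p.1).Γ p.2) :=
  update (fun _ => []) p l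

/-- `initList` and `haltList` require all stacks of the called machine except one to be empty;
`only` guarantees this for the stacks of both machines. -/
theorem call {i : Bool} {l : List ((tm i).Γ (tm i).k₀)} {l' : List ((tm i).Γ (tm i).k₁)} {n : ℕ}
    (h : (flip bind (tm i).step)^[n] (some (initList (tm i) l)) = some (haltList (tm i) l')) :
    Runs (.call i) { m with called := only ⟨i, (tm i).k₀⟩ l }
      { m with called := only ⟨i, (tm i).k₁⟩ l' } (1 + n) := by
  have key : ∀ (k₀ k : (tm i).K) (l : List ((tm i).Γ k₀)),
      only ⟨i, k₀⟩ l ⟨i, k⟩ = update (fun _ => []) k₀ l k := by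
    intro k₀ k l
    by_cases hk : k = k₀
    · subst hk
      rw [only, update_self, update_self]
    · rw [only, update_of_ne hk, update_of_ne (by simpa using hk)]
  refine ⟨1 + n, le_rfl, .call h (fun k => ?_) (fun k => ?_) fun j hj => ?_⟩
  · rw [initList_stk]
    exact key _ _ _
  · rw [haltList_stk]
    exact key _ _ _
  · rcases j with w | ⟨i', k⟩
    · cases w <;> rfl
    · have hi : i' ≠ i := by
        rintro rfl
        exact hj k rfl
      change only ⟨i, (tm i).k₁⟩ l' ⟨i', k⟩ = only ⟨i, (tm i).k₀⟩ l ⟨i', k⟩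
      rw [only, only, update_of_ne, update_of_ne]
      · exact fun h => hi (congrArg Sigma.fst h)
      · exact fun h => hi (congrArg Sigma.fst h)

end Runs

end ShortQuantumGames

namespace ShortQuantumGames

open Turing Function

/-! ### Programs that write -/

variable {G : GateSet} {tm : Bool → FinTM2}

/-- The letter by which bodies of loops over counters are called. -/
def unitCode {G : GateSet} : Unit → Option (Sym G ⊕ Bool) := fun _ => some (Sum.inr true)

/-- Moves the counter `cnt'` back to `cnt`. -/
def restoreCnt : WProg G tm :=
  .loop (Sum.inl .cnt') unitCode fun _ => .push (Sum.inl .cnt) ()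

/-- Moves the counter `idx'` back to `idx`. -/
def restoreIdx : WProg G tm :=
  .loop (Sum.inl .idx') unitCode fun _ => .push (Sum.inl .idx) ()

theorem runs_restoreCnt (m : Mem G tm) (a n : ℕ) :
    Runs restoreCnt { m with cnt := a, cnt' := n } { m with cnt := a + n, cnt' := 0 }
      (2 * n + 1) := by
  induction n generalizing a with
  | zero => exact Runs.loop_nil rfl
  | succ n ih =>
    have h := ih (a + 1)
    rw [show a + 1 + n = a + (n + 1) by omega] at h
    exact Runs.mono (Runs.loop_step rfl rfl (Mem.update_stk_cnt' _ n)
      (Runs.push (Mem.update_stk_cnt _ (a + 1))) h) (by omega)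

theorem runs_restoreIdx (m : Mem G tm) (a n : ℕ) :
    Runs restoreIdx { m with idx := a, idx' := n } { m with idx := a + n, idx' := 0 }
      (2 * n + 1) := by
  induction n generalizing a with
  | zero => exact Runs.loop_nil rfl
  | succ n ih =>
    have h := ih (a + 1)
    rw [show a + 1 + n = a + (n + 1) by omega] at h
    exact Runs.mono (Runs.loop_step rfl rfl (Mem.update_stk_idx' _ n)
      (Runs.push (Mem.update_stk_idx _ (a + 1))) h) (by omega)

/-- Writes as many ticks as the counter `cnt` says. -/
def ticksCnt : WProg G tm :=
  .seq (.loop (Sum.inl .cnt) unitCode fun _ =>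
    .seq (.push (Sum.inl .rev) .tick) (.push (Sum.inl .cnt') ())) restoreCnt

/-- Writes as many ticks as the counter `idx` says. -/
def ticksIdx : WProg G tm :=
  .seq (.loop (Sum.inl .idx) unitCode fun _ =>
    .seq (.push (Sum.inl .rev) .tick) (.push (Sum.inl .idx') ())) restoreIdx

theorem replicate_succ_append {α : Type} (n : ℕ) (a : α) (l : List α) :
    List.replicate (n + 1) a ++ l = List.replicate n a ++ a :: l := by
  rw [List.replicate_succ', List.append_assoc]
  rfl

theorem runs_ticksCnt (m : Mem G tm) (k : ℕ) (ρ : List (Sym G)) :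
    Runs ticksCnt { m with cnt := k, cnt' := 0, rev := ρ }
      { m with cnt := k, cnt' := 0, rev := List.replicate k .tick ++ ρ } (5 * k + 2) := by
  have key : ∀ (n a : ℕ) (ρ : List (Sym G)), Runs (.loop (Sum.inl .cnt) unitCode fun _ =>
      .seq (.push (Sum.inl .rev) .tick) (.push (Sum.inl .cnt') ()))
      { m with cnt := n, cnt' := a, rev := ρ }
      { m with cnt := 0, cnt' := a + n, rev := List.replicate n .tick ++ ρ } (3 * n + 1) := by
    intro n
    induction n with
    | zero => exact fun a ρ => Runs.loop_nil rfl
    | succ n ih =>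
      intro a ρ
      have h := ih (a + 1) (.tick :: ρ)
      rw [show a + 1 + n = a + (n + 1) by omega, ← replicate_succ_append] at h
      exact Runs.mono (Runs.loop_step rfl rfl (Mem.update_stk_cnt _ n)
        (Runs.seq (Runs.push (Mem.update_stk_rev _ (.tick :: ρ)))
          (Runs.push (Mem.update_stk_cnt' _ (a + 1)))) h) (by omega)
  refine ((key k 0 ρ).seq ?_).mono (show 3 * k + 1 + (2 * k + 1) ≤ _ by omega)
  have h := runs_restoreCnt { m with rev := List.replicate k .tick ++ ρ } 0 k
  rw [Nat.zero_add] at h ⊢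
  exact h

theorem runs_ticksIdx (m : Mem G tm) (k : ℕ) (ρ : List (Sym G)) :
    Runs ticksIdx { m with idx := k, idx' := 0, rev := ρ }
      { m with idx := k, idx' := 0, rev := List.replicate k .tick ++ ρ } (5 * k + 2) := by
  have key : ∀ (n a : ℕ) (ρ : List (Sym G)), Runs (.loop (Sum.inl .idx) unitCode fun _ =>
      .seq (.push (Sum.inl .rev) .tick) (.push (Sum.inl .idx') ()))
      { m with idx := n, idx' := a, rev := ρ }
      { m with idx := 0, idx' := a + n, rev := List.replicate n .tick ++ ρ } (3 * n + 1) := by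
    intro n
    induction n with
    | zero => exact fun a ρ => Runs.loop_nil rfl
    | succ n ih =>
      intro a ρ
      have h := ih (a + 1) (.tick :: ρ)
      rw [show a + 1 + n = a + (n + 1) by omega, ← replicate_succ_append] at h
      exact Runs.mono (Runs.loop_step rfl rfl (Mem.update_stk_idx _ n)
        (Runs.seq (Runs.push (Mem.update_stk_rev _ (.tick :: ρ)))
          (Runs.push (Mem.update_stk_idx' _ (a + 1)))) h) (by omega)
  refine ((key k 0 ρ).seq ?_).mono (show 3 * k + 1 + (2 * k + 1) ≤ _ by omega)
  have h := runs_restoreIdx { m with rev := List.replicate k .tick ++ ρ } 0 k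
  rw [Nat.zero_add] at h ⊢
  exact h

/-- The memory while the output is written in reverse order. -/
def Mem.writing (m : Mem G tm) (k i : ℕ) (ρ : List (Sym G)) : Mem G tm :=
  { m with cnt := k, cnt' := 0, idx := i, idx' := 0, rev := ρ }

/-- The program `p` writes the string `w k i` if the counters are `k` and `i`. -/
def Emits (p : WProg G tm) (w : ℕ → ℕ → List (Sym G)) : Prop :=
  ∃ c, ∀ (m : Mem G tm) (k i : ℕ) (ρ : List (Sym G)), i ≤ k →
    Runs p (m.writing k i ρ) (m.writing k i ((w k i).reverse ++ ρ)) (c * (k + 1))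

namespace Emits

theorem skip : Emits (.skip : WProg G tm) fun _ _ => [] :=
  ⟨1, fun _ _ _ _ _ => Runs.skip.mono (by omega)⟩

theorem push (a : Sym G) : Emits (.push (Sum.inl .rev) a : WProg G tm) fun _ _ => [a] :=
  ⟨1, fun _ _ _ _ _ => (Runs.push (Mem.update_stk_rev _ _)).mono (by omega)⟩

theorem seq {p q : WProg G tm} {w w' : ℕ → ℕ → List (Sym G)} (h : Emits p w) (h' : Emits q w') :
    Emits (.seq p q) fun k i => w k i ++ w' k i := by
  obtain ⟨c, h⟩ := h
  obtain ⟨c', h'⟩ := h'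
  refine ⟨c + c', fun m k i ρ hi => ?_⟩
  have := (h m k i ρ hi).seq (h' m k i _ hi)
  rwa [← List.append_assoc, ← List.reverse_append, ← add_mul] at this

theorem congr {p : WProg G tm} {w w' : ℕ → ℕ → List (Sym G)} (h : Emits p w)
    (hw : ∀ k i, i ≤ k → w k i = w' k i) : Emits p w' := by
  obtain ⟨c, h⟩ := h
  exact ⟨c, fun m k i ρ hi => hw k i hi ▸ h m k i ρ hi⟩

theorem ticksCnt : Emits (ticksCnt : WProg G tm) fun k _ => List.replicate k .tick :=
  ⟨5, fun m k i ρ _ => by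
    rw [List.reverse_replicate]
    exact (runs_ticksCnt { m with idx := i, idx' := 0 } k ρ).mono (by omega)⟩

theorem ticksIdx : Emits (ticksIdx : WProg G tm) fun _ i => List.replicate i .tick :=
  ⟨5, fun m k i ρ _ => by
    rw [List.reverse_replicate]
    exact (runs_ticksIdx { m with cnt := k, cnt' := 0 } i ρ).mono (by omega)⟩

end Emits

/-- The programs of a list, one after the other. -/
def seqList {α : Type} (P : α → WProg G tm) : List α → WProg G tm
  | [] => .skip
  | a :: l => .seq (P a) (seqList P l)

theorem Emits.seqList {α : Type} {P : α → WProg G tm} {w : α → ℕ → ℕ → List (Sym G)}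
    {l : List α} (h : ∀ a ∈ l, Emits (P a) (w a)) :
    Emits (seqList P l) fun k i => l.flatMap fun a => w a k i := by
  induction l with
  | nil => exact Emits.skip
  | cons a l ih =>
    simp only [List.flatMap_cons]
    exact (h a List.mem_cons_self).seq (ih fun b hb => h b (List.mem_cons_of_mem _ hb))

/-- Writes `n` ticks. -/
def ticksConst (n : ℕ) : WProg G tm :=
  seqList (fun _ => .push (Sum.inl .rev) .tick) (List.replicate n ())

theorem Emits.ticksConst (n : ℕ) :
    Emits (ticksConst n : WProg G tm) fun _ _ => List.replicate n .tick := by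
  refine (Emits.seqList (w := fun _ _ _ => [.tick]) fun _ _ => Emits.push .tick).congr
    fun k i _ => ?_
  induction n with
  | zero => rfl
  | succ n ih => rw [List.replicate_succ, List.flatMap_cons, ih]; rfl

/-- The number of times that `body` is repeated is stored in `cnt`; `idx` counts down. -/
def forIdx (body : WProg G tm) : WProg G tm :=
  .seq (.loop (Sum.inl .cnt) unitCode fun _ =>
    .seq (.push (Sum.inl .cnt') ()) (.push (Sum.inl .idx) ()))
    (.seq restoreCnt (.loop (Sum.inl .idx) unitCode fun _ => body))

/-- The concatenation of `w i` for `i = n - 1, …, 0`. -/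
def countdown {α : Type} (w : ℕ → List α) : ℕ → List α
  | 0 => []
  | n + 1 => w n ++ countdown w n

theorem descending_flatMap {k : ℕ} {α : Type} (w : ℕ → List α) : ∀ {n : ℕ} (h : n ≤ k),
    (descending n h).flatMap (fun i => w i.1) = countdown w n
  | 0, _ => rfl
  | n + 1, h => by rw [descending, List.flatMap_cons, descending_flatMap, countdown]

/-- The loop pops `idx` before it executes the body, so the body sees the values `k - 1, …, 0`,
which is the order of `descending`. The body must leave both counters as it found them. -/
theorem runs_forIdx {body : WProg G tm} (m : Mem G tm) (k t : ℕ) (w : ℕ → List (Sym G))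
    (h : ∀ i < k, ∀ ρ, Runs body (m.writing k i ρ) (m.writing k i ((w i).reverse ++ ρ)) t)
    (ρ : List (Sym G)) :
    Runs (forIdx body) (m.writing k 0 ρ) (m.writing k 0 ((countdown w k).reverse ++ ρ))
      (k * (t + 6) + 3) := by
  -- Reading a counter destroys it, so `cnt` is copied to `idx` and `cnt'` simultaneously and then
  -- restored from `cnt'`.
  have h1 : ∀ n a : ℕ, Runs (.loop (Sum.inl .cnt) unitCode fun _ =>
      .seq (.push (Sum.inl .cnt') ()) (.push (Sum.inl .idx) ()))
      { m with cnt := n, cnt' := a, idx := a, idx' := 0, rev := ρ }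
      { m with cnt := 0, cnt' := a + n, idx := a + n, idx' := 0, rev := ρ } (3 * n + 1) := by
    intro n
    induction n with
    | zero => exact fun a => Runs.loop_nil rfl
    | succ n ih =>
      intro a
      have h := ih (a + 1)
      rw [show a + 1 + n = a + (n + 1) by omega] at h
      exact Runs.mono (Runs.loop_step rfl rfl (Mem.update_stk_cnt _ n)
        (Runs.seq (Runs.push (Mem.update_stk_cnt' _ (a + 1)))
          (Runs.push (Mem.update_stk_idx _ (a + 1)))) h) (by omega)
  have h2 : ∀ n ≤ k, ∀ ρ, Runs (.loop (Sum.inl .idx) unitCode fun _ => body)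
      (m.writing k n ρ) (m.writing k 0 ((countdown w n).reverse ++ ρ)) (n * (t + 1) + 1) := by
    intro n
    induction n with
    | zero => exact fun _ ρ => (Runs.loop_nil rfl).mono (by omega)
    | succ n ih =>
      intro hn ρ
      have h' := ih (by omega) ((w n).reverse ++ ρ)
      rw [← List.append_assoc, ← List.reverse_append] at h'
      exact Runs.mono (Runs.loop_step rfl rfl (Mem.update_stk_idx (m.writing k (n + 1) ρ) n)
        (h n hn ρ) h') (by rw [Nat.succ_mul]; omega)
  have h3 := runs_restoreCnt { m with idx := k, idx' := 0, rev := ρ } 0 k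
  have h4 := h1 k 0
  rw [Nat.zero_add] at h3 h4
  refine (h4.seq (h3.seq (h2 k le_rfl ρ))).mono ?_
  have : k * (t + 6) = k * (t + 1) + 5 * k := by ring
  omega

end ShortQuantumGames

namespace ShortQuantumGames

open Turing Function

/-! ### Writing the copies of a circuit -/

variable {G : GateSet} {tm : Bool → FinTM2}

/-- The description of the `i`-th of `k` copies of a symbol, where `a + 1 + k` private qubits are
put in front of the copies. -/
def copySym (a k i : ℕ) : Sym G → List (Sym G)
  | .gate g => [.gate g]
  | .reg r => .reg r :: ((if r = 1 then List.replicate (a + 1) .tick ++ List.replicate k .tick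
      else []) ++ List.replicate i .tick)
  | .tick => List.replicate k .tick
  | .sep => []

/-- Writes the copy of a symbol. -/
def writeSym (a : ℕ) : Sym G → WProg G tm
  | .gate g => .push (Sum.inl .rev) (.gate g)
  | .reg r => .seq (.push (Sum.inl .rev) (.reg r))
      (.seq (if r = 1 then .seq (ticksConst (a + 1)) ticksCnt else .skip) ticksIdx)
  | .tick => ticksCnt
  | .sep => .skip

theorem emits_writeSym (a : ℕ) (s : Sym G) :
    Emits (writeSym a s : WProg G tm) fun k i => copySym a k i s := by
  cases s with
  | gate g => exact Emits.push _
  | reg r =>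
    have h : Emits (if r = 1 then .seq (ticksConst (a + 1)) ticksCnt else .skip :
        WProg G tm) fun k _ => if r = 1 then
          List.replicate (a + 1) .tick ++ List.replicate k .tick else [] := by
      by_cases hr : r = 1
      · simp only [if_pos hr]
        exact (Emits.ticksConst (a + 1)).seq Emits.ticksCnt
      · simp only [if_neg hr]
        exact Emits.skip
    exact (Emits.push (.reg r)).seq (h.seq Emits.ticksIdx)
  | tick => exact Emits.ticksCnt
  | sep => exact Emits.skip

/-- The letter by which bodies of loops over strings are called. -/
def symCode (s : Sym G) : Option (Sym G ⊕ Bool) := some (Sum.inl s)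

/-- The letter by which bodies of loops over strings that end at a separator are called. -/
def symStop : Sym G → Option (Sym G ⊕ Bool)
  | .sep => none
  | s => some (Sum.inl s)

theorem symStop_of_ne {s : Sym G} (h : s ≠ .sep) : symStop s = some (Sum.inl s) := by
  cases s <;> first | rfl | exact absurd rfl h

/-- The body of a loop over a string. -/
def onSym (P : Sym G → WProg G tm) : Sym G ⊕ Bool → WProg G tm := Sum.elim P fun _ => .skip

/-- Writes the copy of the string in `store`. -/
def writeCopy (a : ℕ) : WProg G tm :=
  .seq (.loop (Sum.inl .store) symCode (onSym fun s => .push (Sum.inl .store') s))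
    (.loop (Sum.inl .store') symCode
      (onSym fun s => .seq (.push (Sum.inl .store) s) (writeSym a s)))

/-- The string is moved to `store'` and back, and its copy is written on the way back; it is then
available for the next copy. The sum over the finite alphabet bounds the cost of any symbol. -/
theorem runs_writeCopy (a : ℕ) : ∃ c, ∀ (m : Mem G tm) (k i : ℕ) (ρ l : List (Sym G)), i ≤ k →
    Runs (writeCopy a) (({ m with store := l.reverse, store' := [] } : Mem G tm).writing k i ρ)
      (({ m with store := l.reverse, store' := [] } : Mem G tm).writing k i
        ((l.flatMap (copySym a k i)).reverse ++ ρ)) (c * (l.length + 1) * (k + 1)) := by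
  choose c hc using fun s : Sym G => emits_writeSym (tm := tm) a s
  refine ⟨∑ s, c s + 5, fun m k i ρ l hi => ?_⟩
  have h1 : ∀ (l l' : List (Sym G)), Runs (.loop (Sum.inl .store) symCode
      (onSym fun s => .push (Sum.inl .store') s))
      (({ m with store := l, store' := l' } : Mem G tm).writing k i ρ)
      (({ m with store := [], store' := l.reverse ++ l' } : Mem G tm).writing k i ρ)
      (2 * l.length + 1) := by
    intro l
    induction l with
    | nil => exact fun l' => Runs.loop_nil rfl
    | cons s l ih =>
      intro l'
      have h := ih (s :: l')
      rw [show l.reverse ++ s :: l' = (s :: l).reverse ++ l' by simp] at h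
      exact Runs.mono (Runs.loop_step rfl rfl (Mem.update_stk_store _ l)
        (Runs.push (Mem.update_stk_store' _ (s :: l'))) h) (by rw [List.length_cons]; omega)
  have h2 : ∀ (l l' ρ : List (Sym G)), Runs (.loop (Sum.inl .store') symCode
      (onSym fun s => .seq (.push (Sum.inl .store) s) (writeSym a s)))
      (({ m with store := l', store' := l } : Mem G tm).writing k i ρ)
      (({ m with store := l.reverse ++ l', store' := [] } : Mem G tm).writing k i
        ((l.flatMap (copySym a k i)).reverse ++ ρ))
      (l.length * ((∑ s, c s) * (k + 1) + 2) + 1) := by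
    intro l
    induction l with
    | nil => exact fun l' ρ => Runs.mono (Runs.loop_nil rfl) (by omega)
    | cons s l ih =>
      intro l' ρ
      have h := ih (s :: l') ((copySym a k i s).reverse ++ ρ)
      rw [show l.reverse ++ s :: l' = (s :: l).reverse ++ l' by simp,
        ← List.append_assoc, ← List.reverse_append, ← List.flatMap_cons] at h
      have hs : c s * (k + 1) ≤ (∑ s, c s) * (k + 1) := Nat.mul_le_mul_right _
        (Finset.single_le_sum (f := c) (fun _ _ => Nat.zero_le _) (Finset.mem_univ s))
      exact Runs.mono (Runs.loop_step rfl rfl (Mem.update_stk_store' _ l)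
        (Runs.seq (Runs.push (Mem.update_stk_store _ (s :: l')))
          (hc s ({ m with store := s :: l', store' := l } : Mem G tm) k i ρ hi)) h)
        (by rw [List.length_cons, Nat.succ_mul]; omega)
  have h3 := h1 l.reverse []
  rw [List.reverse_reverse, List.append_nil, List.length_reverse] at h3
  have h4 := h2 l [] ρ
  rw [List.append_nil] at h4
  refine (h3.seq h4).mono ?_
  have e1 : (∑ s, c s + 5) * (l.length + 1) * (k + 1) =
    l.length * ((∑ s, c s) * (k + 1)) + (∑ s, c s) * (k + 1) + 5 * (l.length * k) +
      5 * l.length + 5 * k + 5 := by ring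
  rw [e1, mul_add]
  omega

/-- Reads a string up to the next separator. -/
def readStore : WProg G tm :=
  .loop (Sum.inl .desc) symStop (onSym fun s => .push (Sum.inl .store) s)

/-- The string `d` starts with `l`, and `r` remains when `l` and a separator are removed. -/
def Splits (d l r : List (Sym G)) : Prop := Sym.sep ∉ l ∧ (d = l ++ .sep :: r ∨ d = l ∧ r = [])

/-- The last circuit of a description is terminated by the end of the string rather than a
separator, which is the second case of `Splits`. -/
theorem runs_readStore (m : Mem G tm) {d l r : List (Sym G)} (h : Splits d l r)
    (l' : List (Sym G)) :
    Runs readStore { m with desc := d, store := l' }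
      { m with desc := r, store := l.reverse ++ l' } (2 * l.length + 1) := by
  obtain ⟨hl, h⟩ := h
  induction l generalizing d l' with
  | nil =>
    rcases h with rfl | ⟨rfl, rfl⟩
    · exact Runs.loop_exit rfl rfl (Mem.update_stk_desc _ r)
    · exact Runs.loop_nil rfl
  | cons s l ih =>
    rw [List.mem_cons, not_or] at hl
    have hs := symStop_of_ne fun h => hl.1 h.symm
    obtain ⟨d, rfl⟩ : ∃ d', d = s :: d' := by
      rcases h with rfl | ⟨rfl, -⟩ <;> exact ⟨_, rfl⟩
    have h' := ih (d := d) (s :: l') hl.2 (by simpa using h)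
    rw [show l.reverse ++ s :: l' = (s :: l).reverse ++ l' by simp] at h'
    exact Runs.mono (Runs.loop_step rfl hs (Mem.update_stk_desc _ d)
      (Runs.push (Mem.update_stk_store _ (s :: l'))) h') (by rw [List.length_cons]; omega)

/-- Empties `store`. -/
def clearStore : WProg G tm := .loop (Sum.inl .store) symCode (onSym fun _ => .skip)

theorem runs_clearStore (m : Mem G tm) (l : List (Sym G)) :
    Runs clearStore { m with store := l } { m with store := [] } (2 * l.length + 1) := by
  induction l with
  | nil => exact Runs.loop_nil rfl
  | cons s l ih =>
    exact Runs.mono (Runs.loop_step rfl rfl (Mem.update_stk_store _ l) Runs.skip ih)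
      (by rw [List.length_cons]; omega)

/-- Writes all copies of the next circuit. -/
def writeCopies (a : ℕ) : WProg G tm := .seq readStore (.seq (forIdx (writeCopy a)) clearStore)

theorem runs_writeCopies (a : ℕ) : ∃ c, ∀ (m : Mem G tm) (k : ℕ) (ρ : List (Sym G))
    (d l r : List (Sym G)), Splits d l r →
    Runs (writeCopies a) (({ m with desc := d, store := [], store' := [] } : Mem G tm).writing k 0 ρ)
      (({ m with desc := r, store := [], store' := [] } : Mem G tm).writing k 0
        ((countdown (fun i => l.flatMap (copySym a k i)) k).reverse ++ ρ))
      (c * (l.length + 1) * (k + 1) ^ 2) := by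
  obtain ⟨c, hc⟩ := runs_writeCopy (G := G) (tm := tm) a
  refine ⟨c + 12, fun m k ρ d l r h => ?_⟩
  have h1 := runs_readStore (({ m with store' := [] } : Mem G tm).writing k 0 ρ) h []
  rw [List.append_nil] at h1
  have h2 := runs_forIdx ({ m with desc := r, store := l.reverse, store' := [] } : Mem G tm) k _
    (fun i => l.flatMap (copySym a k i))
    (fun i hi ρ => hc ({ m with desc := r } : Mem G tm) k i ρ l hi.le) ρ
  have h3 := runs_clearStore (({ m with desc := r, store' := [] } : Mem G tm).writing k 0
    ((countdown (fun i => l.flatMap (copySym a k i)) k).reverse ++ ρ)) l.reverse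
  rw [List.length_reverse] at h3
  refine (h1.seq (h2.seq h3)).mono ?_
  have e1 : (c + 12) * (l.length + 1) * (k + 1) ^ 2 = k * (c * (l.length + 1) * (k + 1)) +
    c * (l.length + 1) * (k + 1) + 12 * (l.length * k ^ 2) + 24 * (l.length * k) +
      12 * l.length + 12 * k ^ 2 + 24 * k + 12 := by ring
  rw [e1, mul_add]
  omega

/-- Executes `q` for all symbols up to the next separator. -/
def writeSize (q : WProg G tm) : WProg G tm := .loop (Sum.inl .desc) symStop (onSym fun _ => q)

theorem runs_writeSize {q : WProg G tm} {w : ℕ → ℕ → List (Sym G)} (hq : Emits q w) :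
    ∃ c, ∀ (m : Mem G tm) (k : ℕ) (ρ : List (Sym G)) (n : ℕ) (r : List (Sym G)),
      Runs (writeSize q)
        (({ m with desc := List.replicate n .tick ++ .sep :: r } : Mem G tm).writing k 0 ρ)
        (({ m with desc := r } : Mem G tm).writing k 0
          ((List.replicate n (w k 0)).flatten.reverse ++ ρ)) (c * (n + 1) * (k + 1)) := by
  obtain ⟨c, hc⟩ := hq
  refine ⟨c + 1, fun m k ρ n r => ?_⟩
  have key : Runs (writeSize q)
        (({ m with desc := List.replicate n .tick ++ .sep :: r } : Mem G tm).writing k 0 ρ)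
        (({ m with desc := r } : Mem G tm).writing k 0
          ((List.replicate n (w k 0)).flatten.reverse ++ ρ)) (n * (c * (k + 1) + 1) + 1) := by
    induction n generalizing ρ with
    | zero => exact Runs.mono (Runs.loop_exit rfl rfl (Mem.update_stk_desc _ r)) (by omega)
    | succ n ih =>
      have h := ih ((w k 0).reverse ++ ρ)
      rw [← List.append_assoc, ← List.reverse_append, ← List.flatten_cons,
        ← List.replicate_succ] at h
      exact Runs.mono (Runs.loop_step rfl rfl
        (Mem.update_stk_desc _ (List.replicate n .tick ++ .sep :: r))
        (hc ({ m with desc := List.replicate n .tick ++ .sep :: r } : Mem G tm) k 0 ρ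
          (Nat.zero_le _)) h) (by rw [Nat.succ_mul]; omega)
  refine key.mono ?_
  have e1 : (c + 1) * (n + 1) * (k + 1) =
    n * (c * (k + 1)) + c * (k + 1) + n * k + n + k + 1 := by ring
  rw [e1, mul_add]
  omega

/-! ### Writing the final circuit -/

/-- Writes the description of a circuit if `P` writes the description of a qubit. -/
def writeCircuit {β : Type} (P : β → WProg G tm) (C : Circuit G β) : WProg G tm :=
  seqList (fun I : Instr G β => .seq (.push (Sum.inl .rev) (.gate I.gate))
    (seqList P (List.ofFn fun j => I.wires j))) C

theorem emits_writeCircuit {β : Type} {P : β → WProg G tm} {w : β → ℕ → ℕ → List (Sym G)}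
    (h : ∀ b, Emits (P b) (w b)) (C : Circuit G β) :
    Emits (writeCircuit P C) fun k i => C.flatMap fun I : Instr G β =>
      .gate I.gate :: (List.ofFn fun j => I.wires j).flatMap fun b => w b k i :=
  Emits.seqList fun I _ => (Emits.push (.gate I.gate)).seq (Emits.seqList fun b _ => h b)

theorem encodeCircuit_rename {β : Type} {mY work mN : ℕ} (C : Circuit G β)
    (e : β ↪ VWire mY work mN) {w : β → List (Sym G)} (h : ∀ b, encodeWire G (e b) = w b) :
    encodeCircuit (C.rename e) = C.flatMap fun I : Instr G β =>
      .gate I.gate :: (List.ofFn fun j => I.wires j).flatMap w := by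
  rw [encodeCircuit, Circuit.rename, List.flatMap_map]
  refine List.flatMap_congr fun I _ => ?_
  rw [List.flatMap_def, List.map_ofFn]
  congr 3
  funext j
  exact h (I.wires j)

/-- Writes a private qubit. -/
def writeWire (n : ℕ) (useCnt useIdx : Bool) : WProg G tm :=
  .seq (.push (Sum.inl .rev) (.reg 1)) (.seq (ticksConst n)
    (.seq (if useCnt then ticksCnt else .skip) (if useIdx then ticksIdx else .skip)))

theorem emits_writeWire (n : ℕ) (useCnt useIdx : Bool) :
    Emits (writeWire n useCnt useIdx : WProg G tm) fun k i => .reg 1 ::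
      List.replicate (n + ((if useCnt then k else 0) + if useIdx then i else 0)) .tick := by
  have h1 : Emits (if useCnt then ticksCnt else .skip : WProg G tm) fun k _ =>
      List.replicate (if useCnt then k else 0) .tick := by
    cases useCnt
    · exact Emits.skip
    · exact Emits.ticksCnt
  have h2 : Emits (if useIdx then ticksIdx else .skip : WProg G tm) fun _ i =>
      List.replicate (if useIdx then i else 0) .tick := by
    cases useIdx
    · exact Emits.skip
    · exact Emits.ticksIdx
  refine ((Emits.push (.reg 1)).seq ((Emits.ticksConst n).seq (h1.seq h2))).congr fun k i _ => ?_
  rw [List.replicate_add, List.replicate_add]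
  rfl

end ShortQuantumGames

namespace ShortQuantumGames

open Turing Function

variable {G : GateSet} {tm : Bool → FinTM2}

/-! ### The description of the repeated verifier -/

theorem flatMap_copySym_replicate (a k i n : ℕ) :
    (List.replicate n (Sym.tick : Sym G)).flatMap (copySym a k i) =
      List.replicate (n * k) .tick := by
  induction n with
  | zero => rw [Nat.zero_mul]; rfl
  | succ n ih =>
    rw [List.replicate_succ, List.flatMap_cons, ih, copySym, ← List.replicate_add]
    congr 1
    ring

theorem flatten_replicate_ticks (n k : ℕ) :
    (List.replicate n (List.replicate k (Sym.tick : Sym G))).flatten =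
      List.replicate (n * k) .tick := by
  rw [List.flatten_replicate_replicate]

/-- This is the purpose of interleaving the copies. The index `j` becomes `j * k + i` plus an offset
for private qubits, so in unary every tick turns into `k` ticks, while the offset and `i` are
written together with the register. A circuit is copied by substitution, without arithmetic on
indices. -/
theorem encodeWire_copyWires (a : ℕ) {mY work mN k : ℕ} (i : Fin k) (w : VWire mY work mN) :
    encodeWire G (copyWires a mY work mN i w) = (encodeWire G w).flatMap (copySym a k i.1) := by
  rcases w with j | j | j
  · change Sym.reg 0 :: List.replicate (j.1 * k + i.1) Sym.tick = _
    rw [encodeWire, List.flatMap_cons, flatMap_copySym_replicate, copySym, if_neg (by decide),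
      List.nil_append, List.cons_append, ← List.replicate_add, add_comm]
  · change Sym.reg 1 :: List.replicate (a + 1 + k + (j.1 * k + i.1)) Sym.tick = _
    rw [encodeWire, List.flatMap_cons, flatMap_copySym_replicate, copySym, if_pos rfl,
      List.cons_append, ← List.replicate_add, ← List.replicate_add, ← List.replicate_add]
    congr 2
    ring
  · change Sym.reg 2 :: List.replicate (j.1 * k + i.1) Sym.tick = _
    rw [encodeWire, List.flatMap_cons, flatMap_copySym_replicate, copySym, if_neg (by decide),
      List.nil_append, List.cons_append, ← List.replicate_add, add_comm]

theorem encodeCircuit_append {mY work mN : ℕ} (C C' : Circuit G (VWire mY work mN)) :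
    encodeCircuit (C ++ C') = encodeCircuit C ++ encodeCircuit C' :=
  List.flatMap_append

theorem encodeCircuit_rename_copyWires (a : ℕ) {mY work mN k : ℕ} (i : Fin k)
    (C : Circuit G (VWire mY work mN)) :
    encodeCircuit (C.rename (copyWires a mY work mN i)) =
      (encodeCircuit C).flatMap (copySym a k i.1) := by
  rw [encodeCircuit_rename C _ (encodeWire_copyWires a i), encodeCircuit, List.flatMap_assoc]
  refine List.flatMap_congr fun I _ => ?_
  rw [List.flatMap_cons, copySym, ← List.flatMap_assoc, List.flatMap_def (f := encodeWire G),
    List.map_ofFn]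
  rfl

theorem encodeCircuit_flatMap_descending {mY work mN k : ℕ}
    (C : Fin k → Circuit G (VWire mY work mN)) (w : ℕ → List (Sym G))
    (h : ∀ i, encodeCircuit (C i) = w i.1) :
    encodeCircuit ((descending k le_rfl).flatMap C) = countdown w k := by
  rw [encodeCircuit, List.flatMap_assoc, ← descending_flatMap w le_rfl]
  exact List.flatMap_congr fun i _ => h i

theorem sep_notMem_encodeCircuit {mY work mN : ℕ} (C : Circuit G (VWire mY work mN)) :
    Sym.sep ∉ encodeCircuit C := by
  intro h
  obtain ⟨I, -, h⟩ := List.mem_flatMap.1 h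
  simp only [List.mem_cons, reduceCtorEq, List.mem_flatten, List.mem_ofFn, false_or] at h
  obtain ⟨_, ⟨j, rfl⟩, h⟩ := h
  revert h
  rcases I.wires j with w | w | w <;> simp [encodeWire, List.mem_replicate]

/-! ### The program that describes the repeated verifier -/

section Describe

variable (D : ClassicalGates G)

/-- Writes an ancilla qubit. -/
def writeAnc (t : ℕ) : WProg G tm := writeWire (1 + t) true false

/-- Writes a NOT gate. -/
def writeNot (target : WProg G tm) : WProg G tm :=
  writeCircuit (Sum.elim (fun _ => target) fun t => writeAnc t.1) D.notC

/-- Writes the circuit that adds the output of a copy to the accumulated conjunction. -/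
def writeAccumulate (neg : Bool) : WProg G tm :=
  .seq (if neg then writeNot D (writeWire (D.anc + 1) true true) else .skip)
    (writeCircuit (Sum.elim ![writeWire (D.anc + 1) true true, writeWire 1 false true,
      writeWire 0 false true] fun t => writeAnc t.1) D.tofC)

/-- Writes the final circuit of the repeated verifier. -/
def writeCombine (neg : Bool) : WProg G tm :=
  .seq (writeNot D (writeWire 0 true false))
    (.seq (if neg then writeNot D (writeWire 0 false false) else .skip)
      (forIdx (writeAccumulate D neg)))

/-- The description of a private qubit. -/
def privateWord (n : ℕ) : List (Sym G) := .reg 1 :: List.replicate n .tick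

/-- The description of a circuit, given the descriptions of its qubits. -/
def circuitWord {β : Type} (w : β → List (Sym G)) (C : Circuit G β) : List (Sym G) :=
  C.flatMap fun I : Instr G β => .gate I.gate :: (List.ofFn fun j => I.wires j).flatMap w

/-- The description of a NOT gate. -/
def notWord (k n : ℕ) : List (Sym G) :=
  circuitWord (Sum.elim (fun _ => privateWord n) fun t => privateWord (k + 1 + t.1)) D.notC

/-- The description of the circuit that processes the output of a copy. -/
def accumulateWord (neg : Bool) (k i : ℕ) : List (Sym G) :=
  (if neg then notWord D k (D.anc + 1 + k + i) else []) ++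
    circuitWord (Sum.elim ![privateWord (D.anc + 1 + k + i), privateWord (i + 1), privateWord i]
      fun t => privateWord (k + 1 + t.1)) D.tofC

theorem emits_writeWire_privateWord {n : ℕ} {useCnt useIdx : Bool} {f : ℕ → ℕ → ℕ}
    (h : ∀ k i, n + ((if useCnt then k else 0) + if useIdx then i else 0) = f k i) :
    Emits (writeWire n useCnt useIdx : WProg G tm) fun k i => privateWord (f k i) :=
  (emits_writeWire n useCnt useIdx).congr fun k i _ => by rw [h]; rfl

theorem emits_writeAnc (t : ℕ) :
    Emits (writeAnc t : WProg G tm) fun k _ => privateWord (k + 1 + t) :=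
  emits_writeWire_privateWord fun k i => by simp; omega

theorem emits_writeNot {target : WProg G tm} {f : ℕ → ℕ → ℕ}
    (h : Emits target fun k i => privateWord (f k i)) :
    Emits (writeNot D target) fun k i => notWord D k (f k i) :=
  (emits_writeCircuit (w := Sum.elim (fun _ k i => privateWord (f k i))
    fun t k _ => privateWord (k + 1 + t.1)) (by
      rintro (b | t)
      · exact h
      · exact emits_writeAnc t.1) D.notC).congr fun k i _ => by
    rw [notWord, circuitWord]
    congr 2
    funext I
    congr 2
    funext b
    rcases b with b | t <;> rfl

theorem emits_ite_writeNot (neg : Bool) {target : WProg G tm} {f : ℕ → ℕ → ℕ}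
    (h : Emits target fun k i => privateWord (f k i)) :
    Emits (if neg then writeNot D target else .skip) fun k i =>
      if neg then notWord D k (f k i) else [] := by
  cases neg
  · exact Emits.skip
  · exact emits_writeNot D h

theorem emits_writeAccumulate (neg : Bool) :
    Emits (writeAccumulate D neg : WProg G tm) (accumulateWord D neg) := by
  have ho : Emits (writeWire (D.anc + 1) true true : WProg G tm) fun k i =>
      privateWord (D.anc + 1 + k + i) := emits_writeWire_privateWord fun k i => by simp; omega
  refine (emits_ite_writeNot D neg ho).seq ((emits_writeCircuit
    (w := Sum.elim ![fun k i => privateWord (D.anc + 1 + k + i), fun _ i => privateWord (i + 1),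
      fun _ i => privateWord i] fun t k _ => privateWord (k + 1 + t.1)) ?_ D.tofC).congr
        fun k i _ => ?_)
  · rintro (b | t)
    · fin_cases b
      · exact ho
      · exact emits_writeWire_privateWord (f := fun _ i => i + 1) fun k i => by simp; omega
      · exact emits_writeWire_privateWord (f := fun _ i => i) fun k i => by simp
    · exact emits_writeAnc t.1
  · rw [circuitWord]
    congr 2
    funext I
    congr 2
    funext b
    rcases b with b | t
    · fin_cases b <;> rfl
    · rfl

variable {mY work mN k : ℕ}

theorem encodeCircuit_notC_rename {e : Fin 1 ⊕ Fin D.aN ↪ D.RWire mY work mN k} {n : ℕ}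
    (h : encodeWire G (e (Sum.inl 0)) = privateWord n)
    (h' : ∀ t, encodeWire G (e (Sum.inr t)) = privateWord (k + 1 + t.1)) :
    encodeCircuit (D.notC.rename e) = notWord D k n :=
  encodeCircuit_rename _ _ (by
    rintro (b | t)
    · rw [Subsingleton.elim b 0, h]; rfl
    · exact h' t)

theorem encodeWire_copyOutput (a : ℕ) (i : Fin k) :
    encodeWire G (copyOutput a mY work mN i) = privateWord (a + 1 + k + i.1) := by
  change privateWord (a + 1 + k + (0 * k + i.1)) = _
  rw [Nat.zero_mul, Nat.zero_add]

theorem encodeCircuit_accumulate (neg : Bool) (i : Fin k) :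
    encodeCircuit (D.accumulate mY work mN neg i) = accumulateWord D neg k i.1 := by
  rw [ClassicalGates.accumulate, encodeCircuit_append, accumulateWord]
  congr 1
  · cases neg
    · rfl
    · exact encodeCircuit_notC_rename D (encodeWire_copyOutput _ _) fun _ => rfl
  · refine encodeCircuit_rename _ _ ?_
    rintro (b | t)
    · fin_cases b
      · exact encodeWire_copyOutput _ _
      · rfl
      · rfl
    · rfl

/-- The description of the final circuit of the repeated verifier. -/
def combineWord (neg : Bool) (k : ℕ) : List (Sym G) :=
  notWord D k k ++ ((if neg then notWord D k 0 else []) ++ countdown (accumulateWord D neg k) k)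

theorem encodeCircuit_combine (neg : Bool) :
    encodeCircuit (D.combine mY work mN k neg) = combineWord D neg k := by
  rw [ClassicalGates.combine, encodeCircuit_append, encodeCircuit_append, combineWord,
    encodeCircuit_notC_rename D (n := k) rfl fun _ => rfl,
    encodeCircuit_flatMap_descending _ _ fun i => encodeCircuit_accumulate D neg i]
  congr 2
  cases neg
  · rfl
  · exact encodeCircuit_notC_rename D rfl fun _ => rfl

/-- While the stack `desc` changes from `d` to `r`, the program `p` writes `w`. -/
def Writes (p : WProg G tm) (k : ℕ) (d r w : List (Sym G)) (t : ℕ) : Prop :=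
  ∀ (m : Mem G tm) (ρ : List (Sym G)),
    Runs p (({ m with desc := d, store := [], store' := [] } : Mem G tm).writing k 0 ρ)
      (({ m with desc := r, store := [], store' := [] } : Mem G tm).writing k 0 (w.reverse ++ ρ)) t

theorem Writes.seq {p q : WProg G tm} {k : ℕ} {d r r' w w' : List (Sym G)} {s t : ℕ}
    (h : Writes p k d r w s) (h' : Writes q k r r' w' t) :
    Writes (.seq p q) k d r' (w ++ w') (s + t) := fun m ρ => by
  rw [List.reverse_append, List.append_assoc]
  exact (h m ρ).seq (h' m _)

theorem Writes.mono {p : WProg G tm} {k : ℕ} {d r w : List (Sym G)} {s t : ℕ}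
    (h : Writes p k d r w s) (hst : s ≤ t) : Writes p k d r w t := fun m ρ => (h m ρ).mono hst

theorem Emits.writes {p : WProg G tm} {w : ℕ → ℕ → List (Sym G)} (h : Emits p w) :
    ∃ c, ∀ k d, Writes p k d d (w k 0) (c * (k + 1)) := by
  obtain ⟨c, h⟩ := h
  exact ⟨c, fun k d m ρ => h _ k 0 ρ (Nat.zero_le k)⟩

theorem writes_push (a : Sym G) (k : ℕ) (d : List (Sym G)) :
    Writes (.push (Sum.inl .rev) a : WProg G tm) k d d [a] 1 :=
  fun _ _ => Runs.push (Mem.update_stk_rev _ _)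

theorem writes_writeCombine (neg : Bool) : ∃ c, ∀ k d,
    Writes (writeCombine D neg : WProg G tm) k d d (combineWord D neg k) (c * (k + 1) ^ 2) := by
  obtain ⟨c₁, h₁⟩ := (emits_writeNot D (tm := tm) (f := fun k _ => k)
    (emits_writeWire_privateWord (n := 0) (useCnt := true) (useIdx := false)
      fun k i => by simp)).writes
  obtain ⟨c₂, h₂⟩ := (emits_ite_writeNot D neg (tm := tm) (f := fun _ _ => 0)
    (emits_writeWire_privateWord (n := 0) (useCnt := false) (useIdx := false)
      fun k i => by simp)).writes
  obtain ⟨c₃, h₃⟩ := emits_writeAccumulate D (tm := tm) neg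
  refine ⟨c₁ + c₂ + c₃ + 9, fun k d => ?_⟩
  refine ((h₁ k d).seq ((h₂ k d).seq (w' := countdown (accumulateWord D neg k) k)
    fun m ρ => runs_forIdx _ k _ _ (fun i hi ρ => h₃ _ k i ρ hi.le) ρ)).mono ?_
  have e : (c₁ + c₂ + c₃ + 9) * (k + 1) ^ 2 = c₁ * (k + 1) + (c₂ * (k + 1) +
      (k * (c₃ * (k + 1) + 6) + 3)) + (c₁ + c₂) * (k * (k + 1)) + c₃ * (k + 1) +
      9 * k ^ 2 + 12 * k + 6 := by ring
  rw [e]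
  omega

/-- Writes the description of the repeated verifier. -/
def describe (neg : Bool) : WProg G tm :=
  .seq (writeSize ticksCnt) <| .seq (.push (Sum.inl .rev) .sep) <|
  .seq (.seq (ticksConst D.anc) (.seq ticksCnt ticksCnt)) <| .seq (writeSize ticksCnt) <|
  .seq (.push (Sum.inl .rev) .sep) <| .seq (writeSize ticksCnt) <|
  .seq (.push (Sum.inl .rev) .sep) <| .seq (writeCopies D.anc) <|
  .seq (.push (Sum.inl .rev) .sep) <| .seq (writeCopies D.anc) <|
  .seq (.push (Sum.inl .rev) .sep) <| .seq (writeCopies D.anc) (writeCombine D neg)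

/-- The pieces appear in the order in which `describe` writes them. The size of the private register
is split as `anc + k + k + work * k`; only the last summand is obtained from the old description. -/
theorem encode_repeated (k : ℕ) (neg : Bool) (V : VerifierCircuits G) :
    (D.repeated k neg V).encode =
      List.replicate (V.mY * k) .tick ++ ([.sep] ++ ((List.replicate D.anc .tick ++
        (List.replicate k .tick ++ List.replicate k .tick)) ++
        (List.replicate (V.work * k) .tick ++ ([.sep] ++ (List.replicate (V.mN * k) .tick ++
        ([.sep] ++ (countdown (fun i => (encodeCircuit V.V0).flatMap (copySym D.anc k i)) k ++
        ([.sep] ++ (countdown (fun i => (encodeCircuit V.V1).flatMap (copySym D.anc k i)) k ++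
        ([.sep] ++ (countdown (fun i => (encodeCircuit V.V2).flatMap (copySym D.anc k i)) k ++
          combineWord D neg k))))))))))) := by
  have hc : ∀ C : Circuit G (VWire V.mY V.work V.mN), encodeCircuit (D.copies k C) =
      countdown (fun i => (encodeCircuit C).flatMap (copySym D.anc k i)) k := fun C =>
    encodeCircuit_flatMap_descending _ _ fun i => encodeCircuit_rename_copyWires _ _ _
  have hw : List.replicate D.anc (Sym.tick : Sym G) ++ (List.replicate k .tick ++
      List.replicate k .tick) ++ List.replicate (V.work * k) .tick =
      List.replicate (repeatedWork D.anc V.work k) .tick := by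
    rw [← List.replicate_add, ← List.replicate_add, ← List.replicate_add, repeatedWork]
    congr 1
    ring
  have h2 : encodeCircuit (D.repeated k neg V).V2 =
      countdown (fun i => (encodeCircuit V.V2).flatMap (copySym D.anc k i)) k ++
        combineWord D neg k := by
    change encodeCircuit (D.copies k V.V2 ++ D.combine V.mY V.work V.mN k neg) = _
    rw [encodeCircuit_append, hc, encodeCircuit_combine]
  rw [VerifierCircuits.encode, h2]
  change List.replicate (V.mY * k) Sym.tick ++ Sym.sep ::
    (List.replicate (repeatedWork D.anc V.work k) Sym.tick ++ Sym.sep ::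
      (List.replicate (V.mN * k) Sym.tick ++ Sym.sep :: (encodeCircuit (D.copies k V.V0) ++
        Sym.sep :: (encodeCircuit (D.copies k V.V1) ++ Sym.sep :: _)))) = _
  rw [hc, hc, ← hw]
  simp only [List.append_assoc, List.cons_append, List.nil_append]

/-- The dominant cost is that of the copied circuits: `k` passes over at most `V.encode.length`
symbols, each of which costs a multiple of `k + 1`. -/
theorem writes_describe (neg : Bool) : ∃ c, ∀ (k : ℕ) (V : VerifierCircuits G),
    Writes (describe D neg : WProg G tm) k V.encode [] (D.repeated k neg V).encode
      (c * (V.encode.length + 1) * (k + 1) ^ 2) := by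
  obtain ⟨c₁, h₁⟩ := runs_writeSize (tm := tm) (G := G) Emits.ticksCnt
  obtain ⟨c₂, h₂⟩ := ((Emits.ticksConst D.anc).seq
    (Emits.ticksCnt.seq Emits.ticksCnt) : Emits (_ : WProg G tm) _).writes
  obtain ⟨c₃, h₃⟩ := runs_writeCopies (tm := tm) (G := G) D.anc
  obtain ⟨c₄, h₄⟩ := writes_writeCombine (tm := tm) D neg
  have hs : ∀ k n r, Writes (writeSize ticksCnt : WProg G tm) k
      (List.replicate n .tick ++ .sep :: r) r (List.replicate (n * k) .tick)
      (c₁ * (n + 1) * (k + 1)) := fun k n r m ρ => by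
    rw [← flatten_replicate_ticks]
    exact h₁ { m with store := [], store' := [] } k ρ n r
  have hv : ∀ k d l r, Splits d l r → Writes (writeCopies D.anc : WProg G tm) k d r
      (countdown (fun i => l.flatMap (copySym D.anc k i)) k)
      (c₃ * (l.length + 1) * (k + 1) ^ 2) := fun k d l r h m ρ => h₃ m k ρ d l r h
  refine ⟨3 * c₁ + c₂ + 3 * c₃ + c₄ + 5, fun k V => ?_⟩
  rw [encode_repeated]
  have hsp : ∀ (C : Circuit G (VWire V.mY V.work V.mN)) r,
      Splits (encodeCircuit C ++ .sep :: r) (encodeCircuit C) r :=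
    fun C r => ⟨sep_notMem_encodeCircuit C, Or.inl rfl⟩
  refine Writes.mono (Writes.seq (hs k V.mY _) <| Writes.seq (writes_push _ _ _) <|
    Writes.seq (h₂ k _) <| Writes.seq (hs k V.work _) <| Writes.seq (writes_push _ _ _) <|
    Writes.seq (hs k V.mN _) <| Writes.seq (writes_push _ _ _) <|
    Writes.seq (hv k _ _ _ (hsp V.V0 _)) <| Writes.seq (writes_push _ _ _) <|
    Writes.seq (hv k _ _ _ (hsp V.V1 _)) <| Writes.seq (writes_push _ _ _) <|
    Writes.seq (hv k _ _ [] ⟨sep_notMem_encodeCircuit V.V2, Or.inr ⟨rfl, rfl⟩⟩) (h₄ k [])) ?_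
  have hN : V.mY ≤ V.encode.length ∧ V.work ≤ V.encode.length ∧ V.mN ≤ V.encode.length ∧
      (encodeCircuit V.V0).length ≤ V.encode.length ∧
      (encodeCircuit V.V1).length ≤ V.encode.length ∧
      (encodeCircuit V.V2).length ≤ V.encode.length := by
    simp only [VerifierCircuits.encode, List.length_append, List.length_cons,
      List.length_replicate]
    omega
  generalize V.encode.length = N at hN ⊢
  obtain ⟨n1, n2, n3, n4, n5, n6⟩ := hN
  have b1 : ∀ n ≤ N, c₁ * (n + 1) * (k + 1) ≤ c₁ * (N + 1) * (k + 1) ^ 2 := fun n hn => by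
    rw [pow_two, ← mul_assoc]
    refine (Nat.mul_le_mul_right _ (Nat.mul_le_mul_left _ (Nat.succ_le_succ hn))).trans ?_
    exact Nat.le_mul_of_pos_right _ (Nat.succ_pos k)
  have b3 : ∀ n ≤ N, c₃ * (n + 1) * (k + 1) ^ 2 ≤ c₃ * (N + 1) * (k + 1) ^ 2 := fun n hn =>
    Nat.mul_le_mul_right _ (Nat.mul_le_mul_left _ (Nat.succ_le_succ hn))
  have b2 : c₂ * (k + 1) ≤ c₂ * (N + 1) * (k + 1) ^ 2 := by
    rw [pow_two, ← mul_assoc]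
    refine (Nat.mul_le_mul_right _ (Nat.le_mul_of_pos_right c₂ (Nat.succ_pos N))).trans ?_
    exact Nat.le_mul_of_pos_right _ (Nat.succ_pos k)
  have b4 : c₄ * (k + 1) ^ 2 ≤ c₄ * (N + 1) * (k + 1) ^ 2 :=
    Nat.mul_le_mul_right _ (Nat.le_mul_of_pos_right c₄ (Nat.succ_pos N))
  have b5 : 1 ≤ (N + 1) * (k + 1) ^ 2 := Nat.mul_pos (Nat.succ_pos N) (by positivity)
  have e : (3 * c₁ + c₂ + 3 * c₃ + c₄ + 5) * (N + 1) * (k + 1) ^ 2 =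
      3 * (c₁ * (N + 1) * (k + 1) ^ 2) + c₂ * (N + 1) * (k + 1) ^ 2 +
      3 * (c₃ * (N + 1) * (k + 1) ^ 2) + c₄ * (N + 1) * (k + 1) ^ 2 +
      5 * ((N + 1) * (k + 1) ^ 2) := by ring
  have := b1 _ n1
  have := b1 _ n2
  have := b1 _ n3
  have := b3 _ n4
  have := b3 _ n5
  have := b3 _ n6
  rw [e]
  omega

end Describe

end ShortQuantumGames

namespace ShortQuantumGames

open Turing Function

variable {G : GateSet} {tm : Bool → FinTM2}

/-! ### Reading a number in binary -/

/-- The body of a loop over bits. -/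
def onBit (P : Bool → WProg G tm) : Sym G ⊕ Bool → WProg G tm := Sum.elim (fun _ => .skip) P

/-- The letter by which bodies of loops over bits are called. -/
def bitCode {G : GateSet} (b : Bool) : Option (Sym G ⊕ Bool) := some (Sum.inr b)

/-- Doubles the counter and adds a bit. -/
def doubleAdd (b : Bool) : WProg G tm :=
  .seq (.loop (Sum.inl .cnt) unitCode fun _ =>
    .seq (.push (Sum.inl .cnt') ()) (.push (Sum.inl .cnt') ()))
    (.seq restoreCnt (if b then .push (Sum.inl .cnt) () else .skip))

theorem runs_doubleAdd (b : Bool) (m : Mem G tm) (v : ℕ) :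
    Runs (doubleAdd b) { m with cnt := v, cnt' := 0 }
      { m with cnt := 2 * v + b.toNat, cnt' := 0 } (7 * v + 3) := by
  have h1 : ∀ n a : ℕ, Runs (.loop (Sum.inl .cnt) unitCode fun _ =>
      .seq (.push (Sum.inl .cnt') ()) (.push (Sum.inl .cnt') ())) { m with cnt := n, cnt' := a }
      { m with cnt := 0, cnt' := a + 2 * n } (3 * n + 1) := by
    intro n
    induction n with
    | zero => exact fun a => Runs.loop_nil rfl
    | succ n ih =>
      intro a
      have h := ih (a + 2)
      rw [show a + 2 + 2 * n = a + 2 * (n + 1) by ring] at h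
      exact Runs.mono (Runs.loop_step rfl rfl (Mem.update_stk_cnt _ n)
        (Runs.seq (Runs.push (Mem.update_stk_cnt' _ (a + 1)))
          (Runs.push (Mem.update_stk_cnt' _ (a + 2)))) h) (by omega)
  have h2 := h1 v 0
  have h3 := runs_restoreCnt m 0 (2 * v)
  rw [Nat.zero_add] at h2 h3
  refine (h2.seq (h3.seq (t := 1) ?_)).mono (by omega)
  cases b
  · exact Runs.skip
  · exact Runs.push (Mem.update_stk_cnt _ (2 * v + 1))

/-- Reads a number in binary, with the most significant bit first. -/
def readBits : WProg G tm := .loop (Sum.inl .bits) bitCode (onBit doubleAdd)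

/-- Doubling takes time linear in the counter. The values of the prefixes never exceed the final
value `n`, so the total time is bounded by the number of bits times a linear function of `n`. -/
theorem runs_readBits (m : Mem G tm) (l : List Bool) (v n : ℕ)
    (h : l.foldl (fun v b => 2 * v + b.toNat) v = n) :
    Runs readBits { m with bits := l, cnt := v, cnt' := 0 }
      { m with bits := [], cnt := n, cnt' := 0 } (l.length * (7 * n + 4) + 1) := by
  have hle : ∀ (l : List Bool) v, v ≤ l.foldl (fun v b => 2 * v + b.toNat) v := by
    intro l
    induction l with
    | nil => exact fun v => le_rfl
    | cons b l ih => exact fun v => le_trans (by omega) (ih (2 * v + b.toNat))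
  induction l generalizing v with
  | nil =>
    subst h
    exact Runs.mono (Runs.loop_nil rfl) (by omega)
  | cons b l ih =>
    have hv : v ≤ n := h ▸ hle (b :: l) v
    exact Runs.mono (Runs.loop_step rfl rfl (Mem.update_stk_bits _ l)
      (runs_doubleAdd b { m with bits := l } v) (ih _ h))
      (by rw [List.length_cons, Nat.succ_mul l.length]; omega)

theorem foldr_encodePosNum (n : PosNum) :
    (Computability.encodePosNum n).foldr (fun b v => 2 * v + b.toNat) 0 = (n : ℕ) := by
  induction n with
  | one => rfl
  | bit1 n ih => rw [Computability.encodePosNum, List.foldr_cons, ih, PosNum.cast_bit1]; simp; ring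
  | bit0 n ih => rw [Computability.encodePosNum, List.foldr_cons, ih, PosNum.cast_bit0]; simp; ring

/-- `encodeNat` puts the least significant bit first. Moving the output of the first machine to
`bits` reverses it, as required by Horner's scheme in `readBits`. -/
theorem foldl_reverse_encodeNat (n : ℕ) :
    (Computability.encodeNat n).reverse.foldl (fun v b => 2 * v + b.toNat) 0 = n := by
  rw [List.foldl_reverse]
  conv_rhs => rw [← Num.to_of_nat n]
  unfold Computability.encodeNat
  cases (n : Num) with
  | zero => rfl
  | pos p => exact foldr_encodePosNum p

/-! ### Calling the machines -/

theorem Mem.update_stk_called_only (m : Mem G tm) (p : Σ i, (tm i).K)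
    (l l' : List ((tm p.1).Γ p.2)) :
    update ({ m with called := Runs.only p l } : Mem G tm).stk (Sum.inr p) l' =
      ({ m with called := Runs.only p l' } : Mem G tm).stk := by
  rw [Mem.update_stk_called]
  simp only [Runs.only, update_idem]

theorem Mem.stk_called_only (m : Mem G tm) (p : Σ i, (tm i).K) (l : List ((tm p.1).Γ p.2)) :
    ({ m with called := Runs.only p l } : Mem G tm).stk (Sum.inr p) = l := by
  change update (fun _ => []) p l p = l
  rw [update_self]

theorem only_nil (p : Σ i, (tm i).K) : Runs.only p [] = fun _ => [] :=
  update_eq_self p _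

/-- Moves the input to the stack `tmp`, and writes its length in unary. -/
def readInput (one : (tm false).Γ (tm false).k₀) : WProg G tm :=
  .loop (Sum.inl .inp) bitCode (onBit fun b =>
    .seq (.push (Sum.inl .tmp) b) (.push (Sum.inr ⟨false, (tm false).k₀⟩) one))

theorem runs_readInput (one : (tm false).Γ (tm false).k₀) (m : Mem G tm) (x y : List Bool)
    (l : List ((tm false).Γ (tm false).k₀)) :
    Runs (readInput one)
      { m with inp := x, tmp := y, called := Runs.only ⟨false, (tm false).k₀⟩ l }
      { m with
        inp := [], tmp := x.reverse ++ y
        called := Runs.only ⟨false, (tm false).k₀⟩ (List.replicate x.length one ++ l) }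
      (3 * x.length + 1) := by
  induction x generalizing y l with
  | nil => exact Runs.loop_nil rfl
  | cons b x ih =>
    have h := ih (b :: y) (one :: l)
    rw [show x.reverse ++ b :: y = (b :: x).reverse ++ y by simp, ← replicate_succ_append] at h
    exact Runs.mono (Runs.loop_step rfl rfl (Mem.update_stk_inp _ x)
      (Runs.seq (Runs.push (Mem.update_stk_tmp _ (b :: y)))
        (Runs.push (by
          rw [Mem.stk_called_only { m with inp := x, tmp := b :: y }]
          exact Mem.update_stk_called_only { m with inp := x, tmp := b :: y } _ _ _))) h)
      (by rw [List.length_cons]; omega)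

/-- Moves the output of the first machine to the stack `bits`. -/
def readNumber (e : (tm false).Γ (tm false).k₁ ≃ Bool) : WProg G tm :=
  .loop (Sum.inr ⟨false, (tm false).k₁⟩) (fun a => bitCode (e a)) (onBit fun b =>
    .push (Sum.inl .bits) b)

theorem runs_readNumber (e : (tm false).Γ (tm false).k₁ ≃ Bool) (m : Mem G tm)
    (l l' : List Bool) :
    Runs (readNumber e)
      { m with bits := l', called := Runs.only ⟨false, (tm false).k₁⟩ (l.map e.symm) }
      { m with bits := l.reverse ++ l', called := fun _ => [] } (2 * l.length + 1) := by
  induction l generalizing l' with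
  | nil =>
    rw [List.map_nil, only_nil]
    exact Runs.loop_nil rfl
  | cons b l ih =>
    have h := ih (b :: l')
    rw [show l.reverse ++ b :: l' = (b :: l).reverse ++ l' by simp] at h
    exact Runs.mono (Runs.loop_step (Mem.stk_called_only { m with bits := l' } _ _)
      (congrArg bitCode (e.apply_symm_apply b))
      (Mem.update_stk_called_only { m with bits := l' } _ _ _)
      (Runs.push (Mem.update_stk_bits _ (b :: l'))) h) (by rw [List.length_cons]; omega)

/-- Moves the stack `tmp` to the input of the second machine. -/
def passInput (e : (tm true).Γ (tm true).k₀ ≃ Bool) : WProg G tm :=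
  .loop (Sum.inl .tmp) bitCode (onBit fun b => .push (Sum.inr ⟨true, (tm true).k₀⟩) (e.symm b))

theorem runs_passInput (e : (tm true).Γ (tm true).k₀ ≃ Bool) (m : Mem G tm) (x y : List Bool) :
    Runs (passInput e)
      { m with tmp := x, called := Runs.only ⟨true, (tm true).k₀⟩ (y.map e.symm) }
      { m with
        tmp := [], called := Runs.only ⟨true, (tm true).k₀⟩ ((x.reverse ++ y).map e.symm) }
      (2 * x.length + 1) := by
  induction x generalizing y with
  | nil => exact Runs.loop_nil rfl
  | cons b x ih =>
    have h := ih (b :: y)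
    rw [show x.reverse ++ b :: y = (b :: x).reverse ++ y by simp] at h
    exact Runs.mono (Runs.loop_step rfl rfl (Mem.update_stk_tmp _ x)
      (Runs.push (by
        rw [Mem.stk_called_only { m with tmp := x }]
        exact Mem.update_stk_called_only { m with tmp := x } _ _ _)) h)
      (by rw [List.length_cons]; omega)

/-- Moves the output of the second machine to the stack `desc`. -/
def readDesc (e : (tm true).Γ (tm true).k₁ ≃ Sym G) : WProg G tm :=
  .seq (.loop (Sum.inr ⟨true, (tm true).k₁⟩) (fun a => symCode (e a)) (onSym fun s =>
    .push (Sum.inl .store') s))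
    (.loop (Sum.inl .store') symCode (onSym fun s => .push (Sum.inl .desc) s))

theorem runs_readDesc (e : (tm true).Γ (tm true).k₁ ≃ Sym G) (m : Mem G tm) (l : List (Sym G)) :
    Runs (readDesc e)
      { m with
        desc := [], store' := []
        called := Runs.only ⟨true, (tm true).k₁⟩ (l.map e.symm) }
      { m with desc := l, store' := [], called := fun _ => [] } (4 * l.length + 2) := by
  have h1 : ∀ l l' : List (Sym G), Runs (.loop (Sum.inr ⟨true, (tm true).k₁⟩)
      (fun a => symCode (e a)) (onSym fun s => .push (Sum.inl .store') s))
      { m with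
        desc := [], store' := l'
        called := Runs.only ⟨true, (tm true).k₁⟩ (l.map e.symm) }
      { m with desc := [], store' := l.reverse ++ l', called := fun _ => [] }
      (2 * l.length + 1) := by
    intro l
    induction l with
    | nil =>
      intro l'
      rw [List.map_nil, only_nil]
      exact Runs.loop_nil rfl
    | cons s l ih =>
      intro l'
      have h := ih (s :: l')
      rw [show l.reverse ++ s :: l' = (s :: l).reverse ++ l' by simp] at h
      exact Runs.mono (Runs.loop_step
        (Mem.stk_called_only { m with desc := [], store' := l' } _ _)
        (congrArg symCode (e.apply_symm_apply s))
        (Mem.update_stk_called_only { m with desc := [], store' := l' } _ _ _)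
        (Runs.push (Mem.update_stk_store' _ (s :: l'))) h) (by rw [List.length_cons]; omega)
  have h2 : ∀ l l' : List (Sym G), Runs (.loop (Sum.inl .store') symCode
      (onSym fun s => .push (Sum.inl .desc) s))
      ({ m with desc := l', store' := l, called := fun _ => [] } : Mem G tm)
      { m with desc := l.reverse ++ l', store' := [], called := fun _ => [] }
      (2 * l.length + 1) := by
    intro l
    induction l with
    | nil => exact fun _ => Runs.loop_nil rfl
    | cons s l ih =>
      intro l'
      have h := ih (s :: l')
      rw [show l.reverse ++ s :: l' = (s :: l).reverse ++ l' by simp] at h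
      exact Runs.mono (Runs.loop_step rfl rfl (Mem.update_stk_store' _ l)
        (Runs.push (Mem.update_stk_desc _ (s :: l'))) h) (by rw [List.length_cons]; omega)
  have h3 := h1 l []
  have h4 := h2 l.reverse []
  rw [List.append_nil] at h3 h4
  rw [List.reverse_reverse, List.length_reverse] at h4
  exact (h3.seq h4).mono (by omega)

/-- Moves the written string to the output, and clears the counter. -/
def finish : WProg G tm :=
  .seq (.loop (Sum.inl .rev) symCode (onSym fun s => .push (Sum.inl .out) s))
    (.loop (Sum.inl .cnt) unitCode fun _ => .skip)

theorem runs_finish (m : Mem G tm) (l : List (Sym G)) (k : ℕ) :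
    Runs finish { m with rev := l.reverse, out := [], cnt := k }
      { m with rev := [], out := l, cnt := 0 } (2 * l.length + 2 * k + 2) := by
  have h1 : ∀ l l' : List (Sym G), Runs (.loop (Sum.inl .rev) symCode
      (onSym fun s => .push (Sum.inl .out) s)) { m with rev := l, out := l', cnt := k }
      { m with rev := [], out := l.reverse ++ l', cnt := k } (2 * l.length + 1) := by
    intro l
    induction l with
    | nil => exact fun _ => Runs.loop_nil rfl
    | cons s l ih =>
      intro l'
      have h := ih (s :: l')
      rw [show l.reverse ++ s :: l' = (s :: l).reverse ++ l' by simp] at h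
      exact Runs.mono (Runs.loop_step rfl rfl (Mem.update_stk_rev _ l)
        (Runs.push (Mem.update_stk_out _ (s :: l'))) h) (by rw [List.length_cons]; omega)
  have h2 : ∀ k, Runs (.loop (Sum.inl .cnt) unitCode fun _ => .skip)
      { m with rev := [], out := l, cnt := k } { m with rev := [], out := l, cnt := 0 }
      (2 * k + 1) := by
    intro k
    induction k with
    | zero => exact Runs.loop_nil rfl
    | succ k ih =>
      exact Runs.mono (Runs.loop_step rfl rfl (Mem.update_stk_cnt _ k) Runs.skip ih) (by omega)
  have h3 := h1 l.reverse []
  rw [List.append_nil, List.reverse_reverse, List.length_reverse] at h3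
  exact (h3.seq (h2 k)).mono (by omega)

end ShortQuantumGames

namespace ShortQuantumGames

open Turing Function

variable {G : GateSet} {tm : Bool → FinTM2}

/-! ### The machine that describes the repeated verifier -/

/-- A step adds at most one symbol to a work stack, and calls change none of them. This bounds the
length of the new description by the time spent writing it. -/
theorem Exec.length_le {W : Type} [DecidableEq W] {ΓW : W → Type} {ι : Type} [DecidableEq ι]
    {tm : ι → FinTM2} {B : Type} {p : Prog ΓW tm B} {S S' : ∀ j, List (StackAlphabet ΓW tm j)}
    {t : ℕ} (h : Exec ΓW tm B p S S' t) (w : W) :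
    (S' (Sum.inl w)).length ≤ (S (Sum.inl w)).length + t := by
  have hup : ∀ {S : ∀ j, List (StackAlphabet ΓW tm j)} {j : StackIx W tm}
      {a : StackAlphabet ΓW tm j} {l : List (StackAlphabet ΓW tm j)}, S j = a :: l →
      (update S j l (Sum.inl w)).length ≤ (S (Sum.inl w)).length := by
    intro S j a l h
    by_cases hj : Sum.inl w = j
    · subst hj
      rw [update_self, h, List.length_cons]
      exact Nat.le_succ _
    · rw [update_of_ne hj]
  induction h with
  | skip => exact Nat.le_add_right _ _
  | push S j a =>
    by_cases hj : Sum.inl w = j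
    · subst hj
      rw [update_self, List.length_cons]
    · rw [update_of_ne hj]
      exact Nat.le_add_right _ _
  | seq _ _ h h' => omega
  | loop_nil _ => exact Nat.le_add_right _ _
  | loop_exit h _ => exact (hup h).trans (Nat.le_add_right _ _)
  | loop_step h _ _ _ ih ih' =>
    have := hup h
    omega
  | call _ _ _ h =>
    rw [h (Sum.inl w) (by simp)]
    exact Nat.le_add_right _ _

theorem unaryEncodeNat_eq_replicate (n : ℕ) :
    Computability.unaryEncodeNat n = List.replicate n true := by
  induction n with
  | zero => rfl
  | succ n ih => rw [Computability.unaryEncodeNat, ih, List.replicate_succ]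

/-- Empty stacks. -/
def Mem.empty : Mem G tm where
  inp := []
  tmp := []
  bits := []
  cnt := 0
  cnt' := 0
  idx := 0
  idx' := 0
  desc := []
  store := []
  store' := []
  rev := []
  out := []
  called := fun _ => []

theorem Mem.stk_empty : (Mem.empty : Mem G tm).stk = fun _ => [] := by
  funext j
  rcases j with w | p
  · cases w <;> rfl
  · rfl

/-- The program that describes the repeated verifier: the first machine computes the number of
copies, the second machine describes the verifier. -/
def repetition (D : ClassicalGates G) (neg : Bool) (eN : (tm false).Γ (tm false).k₀ ≃ Bool)
    (eN' : (tm false).Γ (tm false).k₁ ≃ Bool) (eV : (tm true).Γ (tm true).k₀ ≃ Bool)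
    (eV' : (tm true).Γ (tm true).k₁ ≃ Sym G) : WProg G tm :=
  .seq (readInput (eN.symm true)) <| .seq (.call false) <| .seq (readNumber eN') <|
  .seq readBits <| .seq (passInput eV) <| .seq (.call true) <| .seq (readDesc eV') <|
  .seq (describe D neg) finish

/-- The input is moved twice, with three and two steps per bit. The threefold bound in `c` accounts
for writing the description once and for reversing it in `finish`, with two steps per symbol, its
length being at most the time taken to write it. -/
theorem runs_repetition (D : ClassicalGates G) (neg : Bool)
    (eN : (tm false).Γ (tm false).k₀ ≃ Bool) (eN' : (tm false).Γ (tm false).k₁ ≃ Bool)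
    (eV : (tm true).Γ (tm true).k₀ ≃ Bool) (eV' : (tm true).Γ (tm true).k₁ ≃ Sym G) :
    ∃ c, ∀ (x : List Bool) (k : ℕ) (V : VerifierCircuits G) (t₁ t₂ : ℕ),
      (flip bind (tm false).step)^[t₁] (some (initList (tm false)
        ((Computability.unaryEncodeNat x.length).map eN.symm))) =
          some (haltList (tm false) ((Computability.encodeNat k).map eN'.symm)) →
      (flip bind (tm true).step)^[t₂] (some (initList (tm true) (x.map eV.symm))) =
          some (haltList (tm true) (V.encode.map eV'.symm)) →
      Runs (repetition D neg eN eN' eV eV') { Mem.empty with inp := x }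
        { Mem.empty with out := (D.repeated k neg V).encode }
        (5 * x.length + t₁ + t₂ + (Computability.encodeNat k).length * (7 * k + 6) +
          4 * V.encode.length + 3 * (c * (V.encode.length + 1) * (k + 1) ^ 2) + 2 * k + 12) := by
  obtain ⟨c, hc⟩ := writes_describe (tm := tm) D neg
  refine ⟨c, fun x k V t₁ t₂ hN hV => ?_⟩
  rw [unaryEncodeNat_eq_replicate, List.map_replicate] at hN
  have h1 := runs_readInput (G := G) (eN.symm true) Mem.empty x [] []
  rw [only_nil, List.append_nil, List.append_nil] at h1
  have h2 := Runs.call (G := G)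
    (m := ({ Mem.empty with inp := [], tmp := x.reverse } : Mem G tm)) hN
  have h3 := runs_readNumber (G := G) eN' ({ Mem.empty with inp := [], tmp := x.reverse } : Mem G tm)
    (Computability.encodeNat k) []
  rw [List.append_nil] at h3
  have h4 := runs_readBits ({ Mem.empty with inp := [], tmp := x.reverse } : Mem G tm) _ 0 k
    (foldl_reverse_encodeNat k)
  rw [List.length_reverse] at h4
  have h5 := runs_passInput (G := G) eV
    ({ Mem.empty with inp := [], cnt := k } : Mem G tm) x.reverse []
  rw [List.map_nil, only_nil, List.append_nil, List.reverse_reverse, List.length_reverse] at h5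
  have h6 := Runs.call (G := G) (m := ({ Mem.empty with cnt := k } : Mem G tm)) hV
  have h7 := runs_readDesc (G := G) eV' ({ Mem.empty with cnt := k } : Mem G tm) V.encode
  have h8 := hc k V Mem.empty []
  rw [List.append_nil] at h8
  have h9 := runs_finish (Mem.empty : Mem G tm) (D.repeated k neg V).encode k
  have hl : (D.repeated k neg V).encode.length ≤ c * (V.encode.length + 1) * (k + 1) ^ 2 := by
    obtain ⟨t, ht, hE⟩ := h8
    have h := hE.length_le .rev
    have h' : (D.repeated k neg V).encode.reverse.length ≤ ([] : List (Sym G)).length + t := h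
    rw [List.length_reverse, List.length_nil, Nat.zero_add] at h'
    exact h'.trans ht
  refine Runs.mono (Runs.seq h1 <| Runs.seq h2 <| Runs.seq h3 <| Runs.seq h4 <| Runs.seq h5 <|
    Runs.seq h6 <| Runs.seq h7 <| Runs.seq h8 h9) ?_
  have e : (Computability.encodeNat k).length * (7 * k + 6) =
    (Computability.encodeNat k).length * (7 * k + 4) +
      2 * (Computability.encodeNat k).length := by ring
  rw [e]
  omega

/-- `P₁` and `P₂` bound the lengths of the outputs of the two machines through their running times.
For the value of `k` this would not suffice, since a short binary number can be exponentially large;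
there the polynomial bound `p` from `IsPoly` enters. -/
theorem polyTimeVerifier_repeatedVerifier (D : ClassicalGates G) {k : ℕ → ℕ} (hk : IsPoly k)
    (neg : Bool) {V : List Bool → VerifierCircuits G} (hV : PolyTimeVerifier V) :
    PolyTimeVerifier (repeatedVerifier D k neg V) := by
  obtain ⟨-, ⟨p, hp⟩, ⟨MN⟩⟩ := hk
  obtain ⟨MV⟩ := hV
  let tm : Bool → FinTM2 := fun b => match b with
    | false => MN.tm
    | true => MV.tm
  obtain ⟨c, hc⟩ := runs_repetition (tm := tm) D neg MN.inputAlphabet MN.outputAlphabet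
    MV.inputAlphabet MV.outputAlphabet
  obtain ⟨D₁, hD₁⟩ := exists_length_output_le MN.tm
  obtain ⟨D₂, hD₂⟩ := exists_length_output_le MV.tm
  let P₁ : Polynomial ℕ := .X + MN.time * .C D₁
  let P₂ : Polynomial ℕ := .X + MV.time * .C D₂
  refine nonempty_tm2ComputableInPolyTime (ΓW := WorkAlphabet G) (w₀ := .inp) (w₁ := .out)
    (repetition (tm := tm) D neg MN.inputAlphabet MN.outputAlphabet MV.inputAlphabet
      MV.outputAlphabet)
    (5 * .X + MN.time + MV.time + P₁ * (7 * p + 6) + 4 * P₂ +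
      3 * (.C c * (P₂ + 1) * (p + 1) ^ 2) + 2 * p + 12) fun x => ?_
  obtain ⟨⟨t₁, hN⟩, ht₁⟩ := MN.outputsFun x.length
  obtain ⟨⟨t₂, hV⟩, ht₂⟩ := MV.outputsFun x
  simp only at ht₁ ht₂
  have hl : (Computability.unaryEncodeNat x.length).length = x.length := by
    rw [unaryEncodeNat_eq_replicate, List.length_replicate]
  rw [hl] at ht₁
  have hb := hD₁ _ _ _ hN
  have hd := hD₂ _ _ _ hV
  rw [List.length_map, List.length_map, hl] at hb
  rw [List.length_map, List.length_map] at hd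
  obtain ⟨t, ht, hE⟩ := hc x (k x.length) (V x) _ _ hN hV
  refine ⟨t, ht.trans ?_, ?_⟩
  · have hb' : (Computability.encodeNat (k x.length)).length ≤ P₁.eval x.length := by
      simp only [P₁, Polynomial.eval_add, Polynomial.eval_mul, Polynomial.eval_X,
        Polynomial.eval_C]
      exact hb.trans (Nat.add_le_add_left (Nat.mul_le_mul_right _ ht₁) _)
    have hd' : (V x).encode.length ≤ P₂.eval x.length := by
      simp only [P₂, Polynomial.eval_add, Polynomial.eval_mul, Polynomial.eval_X,
        Polynomial.eval_C]
      exact hd.trans (Nat.add_le_add_left (Nat.mul_le_mul_right _ ht₂) _)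
    have hpk := hp x.length
    simp only [Polynomial.eval_add, Polynomial.eval_mul, Polynomial.eval_X, Polynomial.eval_C,
      Polynomial.eval_pow, Polynomial.eval_one, Polynomial.eval_ofNat]
    gcongr
  · rw [← Mem.stk_empty (G := G) (tm := tm), Mem.update_stk_inp, Mem.update_stk_out]
    exact hE

end ShortQuantumGames

/-! ### The theorem -/

theorem mainTheorem4 (G : ShortQuantumGames.GateSet)
    (hNot : G.Implements ShortQuantumGames.notGate)
    (hToffoli : G.Implements ShortQuantumGames.toffoliGate)
    (c s : ℕ → ℝ) (hc : ∀ n, c n ∈ Set.Icc (0 : ℝ) 1) (hs : ∀ n, s n ∈ Set.Icc (0 : ℝ) 1)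
    (k : ℕ → ℕ) (hk : ShortQuantumGames.IsPoly k) :
    ShortQuantumGames.SQG G c s ⊆
        ShortQuantumGames.SQG G (fun n => (k n : ℝ) * c n) (fun n => s n ^ k n) ∩
          ShortQuantumGames.SQG G (fun n => c n ^ k n) (fun n => (k n : ℝ) * s n) ∧
      ShortQuantumGames.SQGStar G c s ⊆
        ShortQuantumGames.SQGStar G (fun n => (k n : ℝ) * c n) (fun n => s n ^ k n) ∩
          ShortQuantumGames.SQGStar G (fun n => c n ^ k n) (fun n => (k n : ℝ) * s n) := by
  open ShortQuantumGames in
  obtain ⟨D⟩ := GateSet.exists_classicalGates hNot hToffoli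
  constructor
  · rintro L ⟨V, hV, hL⟩
    exact ⟨⟨_, polyTimeVerifier_repeatedVerifier D hk false hV, hL.repeated_and D hk.1⟩,
      ⟨_, polyTimeVerifier_repeatedVerifier D hk true hV, hL.repeated_or D hk.1⟩⟩
  · rintro L ⟨V, hV, h0, hL⟩
    exact ⟨⟨_, polyTimeVerifier_repeatedVerifier D hk false hV,
        fun x => repeatedVerifier_V0 D k false (h0 x), hL.repeated_and D hk.1⟩,
      ⟨_, polyTimeVerifier_repeatedVerifier D hk true hV,
        fun x => repeatedVerifier_V0 D k true (h0 x), hL.repeated_or D hk.1⟩⟩
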